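/- Let $M$ be a Hausdorff smooth $n$-dimensional manifold with smooth vector fields $X_1,\dots,X_l$, let $T>0$, $q_0\in M$, and consider the control system $$\dot q(t)=\sum_{i=1}^l v_i(t)X_i(q(t)),\qquad q(0)=q_0,\qquad t\in[0,T],\tag{$\Lambda$}$$ with integrable controls $v\in L^1([0,T],\mathbb R^l)$; trajectories are absolutely continuous and satisfy the equation almost everywhere. Write $\mathrm{End}^t(v)=q(t)$ for the end-point map. Fix a control $u$ with a trajectory $q:[0,T]\to M$, and identify a neighbourhood of $q([0,T])$ with an open subset of $\mathbb R^n$ by a coordinate chart; all derivatives below are taken in this chart. For a control $\Delta u$ put $b^{(j)}(t)=\frac1{j!}\partial_s^j|_{s=0}\mathrm{End}^t(u+s\Delta u)$. For a multi-index $\alpha=(a_1,\dots,a_m)$ put $|\alpha|=\sum_i a_i$, $w(\alpha)=\sum_i i\,a_i$, $\alpha!=\prod_i a_i!$, and for an $|\alpha|$-linear map $\Phi$ let $\Phi[\vec b^{\,\alpha}]$ be its value on $b^{(1)}$ ($a_1$ times), …, $b^{(m)}$ ($a_m$ times). Let $\Phi^{(m)}_a(t)$, for $m\ge1$, $1\le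 a\le n$, $t\in[0,T]$, be symmetric $m$-linear forms on $\mathrm T_{q(t)}M\simeq\mathbb R^n$, absolutely continuous in $t$, such that $\{\Phi^{(1)}_a(0)\}_a$ is a basis of $\mathrm T^*_{q_0}M$, $\Phi^{(m)}_a(0)=0$ for $m\ge2$, and for almost every $t$ and all $b$ $$\dot\Phi^{(m)}_a(t)[b,\dots,b]+\sum_{i}u_i(t)\sum_{s=1}^m\binom ms\Phi^{(m-s+1)}_a(t)\big[\mathrm D^s_{q(t)}X_i[b,\dots,b],\underbrace{b,\dots,b}_{m-s}\big]=0 .$$ The adapted coordinates of $\Delta u$ are $$q^{(m)}_a(t)=\sum_{w(\alpha)=m}\frac1{\alpha!}\,\Phi^{(|\alpha|)}_a(t)[\vec b(t)^{\alpha}],\qquad q^{(m)}=(q^{(m)}_1,\dots,q^{(m)}_n)\in\mathbb R^n .$$ Theorem. For each $k$ there are vector fields $Y^{(k)}_1,\dots,Y^{(k)}_l$ on $\mathbb R\times(\mathbb R^n)^k\ni(t,q^{(1)},\dots,q^{(k)})$, depending only on the data above and not on $\Delta u$, which are continuous, and smooth in $(q^{(1)},\dots,q^{(k)})$ for each fixed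 $t$, such that: (i) for the grading $\deg t=0$, $\deg q^{(s)}_a=s$, each $Y^{(k)}_i$ is a homogeneous vector field of degree $-1$; (ii) for every control $\Delta u\in L^1([0,T],\mathbb R^l)$, the system $(\Lambda)$ has a trajectory on $[0,T]$ with control $u+s\Delta u$ for all small $s$ (and it stays in the chart domain), $s\mapsto\mathrm{End}^t(u+s\Delta u)$ is smooth at $s=0$ for every $t\in[0,T]$, and the curve $p^{(k)}(t)=(t,q^{(1)}(t),\dots,q^{(k)}(t))$, $t\in[0,T]$, built from the adapted coordinates of $\Delta u$, is the absolutely continuous curve with $$\dot p^{(k)}(t)=\partial_t+\sum_{i=1}^l\Delta u_i(t)\,Y^{(k)}_i(p^{(k)}(t))\ \text{ for a.e. }t,\qquad p^{(k)}(0)=(0,\dots,0);$$ (iii) for each $k\ge2$, $Y^{(k)}_i$ projects onto $Y^{(k-1)}_i$ under $(t,q^{(1)},\dots,q^{(k)})\mapsto(t,q^{(1)},\dots,q^{(k-1)})$. -/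

import Mathlib

open MeasureTheory Set Filter Topology
open scoped Manifold ContDiff

noncomputable section

namespace AdaptedCoords

/-- `ℝⁿ`, the model space of `n`-dimensional manifolds. -/
abbrev Vec (n : ℕ) : Type := EuclideanSpace ℝ (Fin n)

/-! ### Multi-indices -/

/-- The weight `∑ i · a_i` of a multi-index `(a_1, …, a_m)`; the entry `a_i` is `α (i - 1)`. -/
def weight {m : ℕ} (α : Fin m → ℕ) : ℕ := ∑ i : Fin m, ((i : ℕ) + 1) * α i

/-- The multi-indices `(a_1, …, a_m)` of weight `m`. -/
def multiIndices (m : ℕ) : Finset (Fin m → ℕ) :=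
  (Fintype.piFinset fun _ => Finset.range (m + 1)).filter fun α => weight α = m

theorem mem_multiIndices {m : ℕ} (α : Fin m → ℕ) : α ∈ multiIndices m ↔ weight α = m := by
  simp only [multiIndices, Finset.mem_filter, Fintype.mem_piFinset, Finset.mem_range,
    and_iff_right_iff_imp]
  intro h i
  have h1 : ((i : ℕ) + 1) * α i ≤ weight α :=
    Finset.single_le_sum (f := fun i : Fin m => ((i : ℕ) + 1) * α i)
      (fun _ _ => Nat.zero_le _) (Finset.mem_univ i)
  nlinarith

/-- The argument list `b_1, …, b_1, b_2, …, b_2, …, b_m, …, b_m`, in which `b_i` is repeated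
`a_i` times. -/
def repeated {n m : ℕ} (b : Fin m → Vec n) (α : Fin m → ℕ) : Fin (∑ i, α i) → Vec n :=
  fun j => b (finSigmaFinEquiv.symm j).1

/-- `∑_{w(α) = m} (1 / α!) Φ^{|α|}[b^α]` for a family `Φ^1, Φ^2, …` of multilinear forms. -/
def jetCoord {n : ℕ} (Φ : (j : ℕ) → (Vec n) [×j]→L[ℝ] ℝ) (m : ℕ) (b : Fin m → Vec n) : ℝ :=
  ∑ α ∈ multiIndices m,
    (1 / ((∏ i, Nat.factorial (α i) : ℕ) : ℝ)) * Φ (∑ i, α i) (repeated b α)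

/-! ### The control system and its end-point map -/

section System

variable {n l : ℕ} {M : Type*} [TopologicalSpace M] [ChartedSpace (EuclideanSpace ℝ (Fin n)) M]

/-- `q : [0, T] → M` is the trajectory, in the sense of Carathéodory, of
`q' = ∑ v_i(t) X_i(q)`, `q(0) = q₀`: it is absolutely continuous (in local coordinates) and
satisfies the equation almost everywhere. Values of `q` outside `[0, T]` play no role. -/
structure IsTrajectory (X : Fin l → (x : M) → TangentSpace (𝓡 n) x) (T : ℝ) (q₀ : M)
    (v : ℝ → Fin l → ℝ) (q : ℝ → M) : Prop where
  initial : q 0 = q₀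
  continuousOn : ContinuousOn q (Icc 0 T)
  absCont : ∀ e ∈ IsManifold.maximalAtlas (𝓡 n) ∞ M, ∀ a b : ℝ, 0 ≤ a → a ≤ b → b ≤ T →
    MapsTo q (Icc a b) e.source → AbsolutelyContinuousOnInterval (fun t => e (q t)) a b
  deriv : ∀ᵐ t ∂(volume.restrict (Icc 0 T)),
    HasMFDerivAt 𝓘(ℝ, ℝ) (𝓡 n) q t
      ((1 : ℝ →L[ℝ] ℝ).smulRight (∑ i, v t i • X i (q t)))

open Classical in
/-- The end-point map `End^t : v ↦ q(t)`, where `q` is the trajectory on `[0, T]` with control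
`v`. (If there is no such trajectory, the value is the dummy `q₀`.) -/
def endpoint (X : Fin l → (x : M) → TangentSpace (𝓡 n) x) (T : ℝ) (q₀ : M)
    (v : ℝ → Fin l → ℝ) (t : ℝ) : M :=
  if h : ∃ q : ℝ → M, IsTrajectory X T q₀ v q then h.choose t else q₀

/-- The curve `s ↦ End^t(u + s Δu)`, read in the coordinates `e`. -/
def variation (e : OpenPartialHomeomorph M (EuclideanSpace ℝ (Fin n)))
    (X : Fin l → (x : M) → TangentSpace (𝓡 n) x) (T : ℝ) (q₀ : M)
    (u Δu : ℝ → Fin l → ℝ) (t : ℝ) : ℝ → Vec n :=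
  fun s => e (endpoint X T q₀ (u + s • Δu) t)

/-- `b^(j)(t)`, the coefficient of `s ^ j` in the Taylor expansion of `s ↦ End^t(u + s Δu)` at
`s = 0` in the coordinates `e`. -/
def taylorCoeff (e : OpenPartialHomeomorph M (EuclideanSpace ℝ (Fin n)))
    (X : Fin l → (x : M) → TangentSpace (𝓡 n) x) (T : ℝ) (q₀ : M)
    (u Δu : ℝ → Fin l → ℝ) (j : ℕ) (t : ℝ) : Vec n :=
  (1 / (Nat.factorial j : ℝ)) • iteratedDeriv j (variation e X T q₀ u Δu t) 0

/-- The vector field `Z` on `M`, read in the coordinates `e`. -/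
def inChart (e : OpenPartialHomeomorph M (EuclideanSpace ℝ (Fin n)))
    (Z : (x : M) → TangentSpace (𝓡 n) x) : Vec n → Vec n :=
  fun y => mfderiv (𝓡 n) 𝓘(ℝ, Vec n) e (e.symm y) (Z (e.symm y))

/-! ### Adapted coordinates -/

/-- `Φ k a t` (`1 ≤ k`, `a = 1, …, n`, `t ∈ [0, T]`) are the multilinear forms that define adapted
coordinates along the trajectory `q` of the control `u`, in the coordinates `e`. Only `k ≥ 1`
matters. -/
structure IsAdaptedForms (e : OpenPartialHomeomorph M (EuclideanSpace ℝ (Fin n)))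
    (X : Fin l → (x : M) → TangentSpace (𝓡 n) x) (T : ℝ)
    (u : ℝ → Fin l → ℝ) (q : ℝ → M)
    (Φ : (k : ℕ) → Fin n → ℝ → (Vec n) [×k]→L[ℝ] ℝ) : Prop where
  symm : ∀ k, 1 ≤ k → ∀ a, ∀ t ∈ Icc 0 T, ∀ (σ : Equiv.Perm (Fin k)) (w : Fin k → Vec n),
    Φ k a t (w ∘ σ) = Φ k a t w
  /-- The `n` covectors `Φ^1_a(0)` are a basis of the `n`-dimensional cotangent space. -/
  basis : LinearIndependent ℝ (fun a => Φ 1 a 0)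
  initial : ∀ k, 2 ≤ k → ∀ a, Φ k a 0 = 0
  absCont : ∀ k, 1 ≤ k → ∀ a, AbsolutelyContinuousOnInterval (Φ k a) 0 T
  evolution : ∀ k, 1 ≤ k → ∀ a, ∀ᵐ t ∂(volume.restrict (Icc 0 T)), ∀ b : Vec n,
    HasDerivAt (fun τ => Φ k a τ (fun _ => b))
      (-∑ i, u t i * ∑ s ∈ Finset.Icc 1 k, (k.choose s : ℝ) *
        Φ (k - s + 1) a t (Fin.cons
          (iteratedFDeriv ℝ s (inChart e (X i)) (e (q t)) (fun _ => b)) (fun _ => b))) t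

/-- The adapted coordinate
`q^(m)_a(t) = ∑_{w(α) = m} (1 / α!) Φ^{|α|}_a(t)[b(t)^α]` of the direction `Δu`. -/
def adaptedCoord (e : OpenPartialHomeomorph M (EuclideanSpace ℝ (Fin n)))
    (X : Fin l → (x : M) → TangentSpace (𝓡 n) x) (T : ℝ) (q₀ : M) (u : ℝ → Fin l → ℝ)
    (Φ : (k : ℕ) → Fin n → ℝ → (Vec n) [×k]→L[ℝ] ℝ) (Δu : ℝ → Fin l → ℝ)
    (m : ℕ) (a : Fin n) (t : ℝ) : ℝ :=
  jetCoord (fun j => Φ j a t) m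
    (fun i => taylorCoeff e X T q₀ u Δu ((i : ℕ) + 1) t)

/-- The curve `p^(k)(t) = (t, q^(1)(t), …, q^(k)(t))` in `ℝ × (ℝⁿ)ᵏ`. -/
def adaptedCurve (e : OpenPartialHomeomorph M (EuclideanSpace ℝ (Fin n)))
    (X : Fin l → (x : M) → TangentSpace (𝓡 n) x) (T : ℝ) (q₀ : M) (u : ℝ → Fin l → ℝ)
    (Φ : (k : ℕ) → Fin n → ℝ → (Vec n) [×k]→L[ℝ] ℝ) (Δu : ℝ → Fin l → ℝ)
    (k : ℕ) (t : ℝ) : ℝ × (Fin k → Vec n) :=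
  (t, fun s => WithLp.toLp 2 fun a => adaptedCoord e X T q₀ u Φ Δu ((s : ℕ) + 1) a t)

end System

/-! ### The graded space `ℝ × (ℝⁿ)ᵏ` -/

/-- The dilation by `c`: `t` has degree `0` and `q^(s)` (the entry of index `s - 1`) has
degree `s`. It is linear, so it is also the formula for its own tangent map. -/
def dilation {n k : ℕ} (c : ℝ) (p : ℝ × (Fin k → Vec n)) : ℝ × (Fin k → Vec n) :=
  (p.1, fun s => c ^ ((s : ℕ) + 1) • p.2 s)

/-- `Y` is a homogeneous vector field of degree `d`: `Y (h_c p) = c ^ d • (T h_c) (Y p)` for the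
dilations `h_c`, `c ≠ 0`. In components: the component along a coordinate of degree `s` is
homogeneous of degree `s + d`. -/
def IsHomogeneousField {n k : ℕ} (d : ℤ)
    (Y : ℝ × (Fin k → Vec n) → ℝ × (Fin k → Vec n)) : Prop :=
  ∀ c : ℝ, c ≠ 0 → ∀ p, Y (dilation c p) = c ^ d • dilation c (Y p)

/-- The projection `(t, q^(1), …, q^(k+1)) ↦ (t, q^(1), …, q^(k))`. It is linear, so it is also
the formula for its own tangent map. -/
def truncate {n k : ℕ} (p : ℝ × (Fin (k + 1) → Vec n)) : ℝ × (Fin k → Vec n) :=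
  (p.1, fun s => p.2 s.castSucc)

/-- `p : [0, T] → ℝ × (ℝⁿ)ᵏ` is the trajectory, in the sense of Carathéodory, of the affine
control system `p' = ∂_t + ∑ w_i(t) Y_i(p)`, `p(0) = 0`, with control `w`. -/
structure IsAffineTrajectory {n k l : ℕ}
    (Y : Fin l → ℝ × (Fin k → Vec n) → ℝ × (Fin k → Vec n)) (T : ℝ)
    (w : ℝ → Fin l → ℝ) (p : ℝ → ℝ × (Fin k → Vec n)) : Prop where
  initial : p 0 = 0
  absCont : AbsolutelyContinuousOnInterval p 0 T
  deriv : ∀ᵐ t ∂(volume.restrict (Icc 0 T)),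
    HasDerivAt p ((1, 0) + ∑ i, w t i • Y i (p t)) t

end AdaptedCoords

end

/-! Put `F_a(t, b) = ∑ (1 / r!) Φ^r_a(t)[b^r]`, a formal power series in the displacement `b` from
`q(t)`. The evolution equations of the forms say that `F_a` is a formal first integral of the
unperturbed system read in displacements. Let `b(s)` be the Taylor series of `End^t(u + s Δu) -
q(t)`. Then `q^(m)_a` is the coefficient of `s ^ m` in `F_a(t, b(s))`; the multi-index formula is
this coefficient with equal terms collected (`jetCoord_eq_sum_mulJet`). In the time derivative
everything driven by `u` cancels, and `s ∑ Δu_i D_b F_a[X_i(q + b(s))]` remains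
(`hasDerivAt_sum_mulJet`). Because of the factor `s`, the derivative of `q^(m)` is a coefficient of
order `m - 1` and involves only `b^(1), …, b^(m-1)`.

The covectors `Φ^1_a(t)` stay a basis, by Gronwall (`IsAdaptedForms.linearIndependent`), so the
triangular relation between the `q^(j)` and the `b^(j)` is inverted recursively (`solveJet`).
Substituting the result gives the fields (`fieldJet`, `adaptedField`). Replacing `s` by `c s` gives
homogeneity, and triangularity gives the projection property.

The analytic half shows that the Taylor coefficients exist and solve the variational equations. The
fields in the chart are cut off to global ones, and the trajectory equation becomes an equation in
`C([0, T], ℝⁿ)` to which the implicit function theorem applies (`exists_smooth_family`):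
superposition operators are smooth, and the linearisation is the identity minus a Volterra operator.
Uniqueness on the Hausdorff manifold identifies the solutions with the end-point map
(`endpoint_eq`). Identities between Taylor coefficients come from uniqueness of jets, with no
formula for higher derivatives of a composition. -/

noncomputable section

namespace AdaptedCoords

/-! ### Absolutely continuous functions -/

section AbsCont

variable {E F X Y : Type*} [NormedAddCommGroup E] [NormedSpace ℝ E] [NormedAddCommGroup F]
  [NormedSpace ℝ F] [PseudoMetricSpace X] [PseudoMetricSpace Y] {a b : ℝ}

/-- Domination criterion for absolute continuity. -/
theorem absCont_of_dist_le {f : ℝ → X} {g : ℝ → Y} (C : ℝ)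
    (hg : AbsolutelyContinuousOnInterval g a b)
    (h : ∀ x ∈ uIcc a b, ∀ y ∈ uIcc a b, dist (f x) (f y) ≤ C * dist (g x) (g y)) :
    AbsolutelyContinuousOnInterval f a b := by
  have h0 := Tendsto.const_mul C hg
  rw [mul_zero] at h0
  refine squeeze_zero' (Eventually.of_forall fun _ => Finset.sum_nonneg fun _ _ => dist_nonneg) ?_ h0
  -- The domination is known only on `uIcc a b`, so the part of the filter that keeps all endpoints
  -- there is needed.
  filter_upwards [mem_inf_of_right (mem_principal_self _)] with E hE
  rw [Finset.mul_sum]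
  exact Finset.sum_le_sum fun i hi => h _ (hE.1 i (by simpa using hi)).1 _ (hE.1 i (by simpa using hi)).2

theorem absCont_congr {f g : ℝ → X} (hf : AbsolutelyContinuousOnInterval f a b)
    (h : EqOn f g (uIcc a b)) : AbsolutelyContinuousOnInterval g a b :=
  absCont_of_dist_le 1 hf fun x hx y hy => by rw [h hx, h hy, one_mul]

theorem absCont_const (c : X) : AbsolutelyContinuousOnInterval (fun _ => c) a b :=
  (LipschitzWith.const c).lipschitzOnWith.absolutelyContinuousOnInterval

theorem absCont_lipschitzOnWith_comp {f : X → Y} {g : ℝ → X} {s : Set X} {K : NNReal}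
    (hf : LipschitzOnWith K f s) (hg : AbsolutelyContinuousOnInterval g a b)
    (hs : MapsTo g (uIcc a b) s) : AbsolutelyContinuousOnInterval (fun t => f (g t)) a b :=
  absCont_of_dist_le K hg fun _ hx _ hy => hf.dist_le_mul _ (hs hx) _ (hs hy)

/-- The image of the interval is compact, and a locally Lipschitz map is Lipschitz on a compact set.
-/
theorem absCont_contDiffAt_comp {f : E → F} {g : ℝ → E}
    (hg : AbsolutelyContinuousOnInterval g a b)
    (hf : ∀ t ∈ uIcc a b, ContDiffAt ℝ 1 f (g t)) :
    AbsolutelyContinuousOnInterval (fun t => f (g t)) a b := by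
  have hK : IsCompact (g '' uIcc a b) := isCompact_uIcc.image_of_continuousOn hg.continuousOn
  have hl : LocallyLipschitzOn (g '' uIcc a b) f := by
    rintro _ ⟨t, ht, rfl⟩
    obtain ⟨K, s, hs, hK⟩ := (hf t ht).exists_lipschitzOnWith
    exact ⟨K, s, mem_nhdsWithin_of_mem_nhds hs, hK⟩
  obtain ⟨K, hK⟩ := hl.exists_lipschitzOnWith_of_compact hK
  exact absCont_lipschitzOnWith_comp hK hg (mapsTo_image _ _)

theorem absCont_prodMk {f : ℝ → X} {g : ℝ → Y} (hf : AbsolutelyContinuousOnInterval f a b)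
    (hg : AbsolutelyContinuousOnInterval g a b) :
    AbsolutelyContinuousOnInterval (fun t => (f t, g t)) a b := by
  have h0 := Tendsto.add hf hg
  rw [add_zero] at h0
  refine squeeze_zero (fun _ => Finset.sum_nonneg fun _ _ => dist_nonneg) (fun E => ?_) h0
  rw [← Finset.sum_add_distrib]
  exact Finset.sum_le_sum fun i _ => max_le_add_of_nonneg dist_nonneg dist_nonneg

theorem absCont_pi {ι : Type*} [Fintype ι] {f : ι → ℝ → X}
    (hf : ∀ i, AbsolutelyContinuousOnInterval (f i) a b) :
    AbsolutelyContinuousOnInterval (fun t i => f i t) a b := by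
  have h0 := tendsto_finsetSum Finset.univ fun i _ => hf i
  rw [Finset.sum_const_zero] at h0
  refine squeeze_zero (fun _ => Finset.sum_nonneg fun _ _ => dist_nonneg) (fun E => ?_) h0
  rw [Finset.sum_comm]
  refine Finset.sum_le_sum fun j _ => ?_
  refine (dist_pi_le_iff (Finset.sum_nonneg fun _ _ => dist_nonneg)).2 fun i => ?_
  exact Finset.single_le_sum (f := fun i => dist (f i (E.2 j).1) (f i (E.2 j).2))
    (fun _ _ => dist_nonneg) (Finset.mem_univ i)

theorem absCont_sum {ι G : Type*} [NormedAddCommGroup G] (s : Finset ι) {f : ι → ℝ → G}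
    (hf : ∀ i ∈ s, AbsolutelyContinuousOnInterval (f i) a b) :
    AbsolutelyContinuousOnInterval (fun t => ∑ i ∈ s, f i t) a b := by
  classical
  induction s using Finset.induction_on with
  | empty => simpa using absCont_const (0 : G)
  | insert i s hi ih =>
    simp only [Finset.sum_insert hi]
    exact (hf i (Finset.mem_insert_self _ _)).add (ih fun j hj => hf j (Finset.mem_insert_of_mem hj))

theorem absCont_clm_comp {f : ℝ → E} (hf : AbsolutelyContinuousOnInterval f a b) (L : E →L[ℝ] F) :
    AbsolutelyContinuousOnInterval (fun t => L (f t)) a b :=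
  absCont_contDiffAt_comp hf fun _ _ => L.contDiff.contDiffAt

theorem absCont_multilinear_apply [CompleteSpace F] {r : ℕ} {Φ : ℝ → E [×r]→L[ℝ] F} {v : Fin r → ℝ → E}
    (hΦ : AbsolutelyContinuousOnInterval Φ a b)
    (hv : ∀ i, AbsolutelyContinuousOnInterval (v i) a b) :
    AbsolutelyContinuousOnInterval (fun t => Φ t (fun i => v i t)) a b := by
  refine absCont_contDiffAt_comp (f := fun p : (E [×r]→L[ℝ] F) × (Fin r → E) => p.1 p.2)
    (g := fun t => (Φ t, fun i => v i t)) (absCont_prodMk hΦ (absCont_pi hv)) fun t _ => ?_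
  exact ((ContinuousLinearMap.id ℝ (E [×r]→L[ℝ] F)).analyticAt_uncurry_of_multilinear).contDiffAt

/-- Increments of the primitive are dominated by those of the primitive of `‖f‖`, which reduces the
claim to real functions. -/
theorem absCont_intervalIntegral {f : ℝ → E} (hf : IntervalIntegrable f volume a b) {c : ℝ}
    (hc : c ∈ uIcc a b) : AbsolutelyContinuousOnInterval (fun x => ∫ v in c..x, f v) a b := by
  refine absCont_of_dist_le 1
    (hf.norm.absolutelyContinuousOnInterval_intervalIntegral hc) fun x hx y hy => ?_
  have hi : ∀ x ∈ uIcc a b, ∀ y ∈ uIcc a b, IntervalIntegrable f volume x y :=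
    fun x hx y hy => hf.mono_set (uIcc_subset_uIcc hx hy)
  rw [dist_eq_norm, dist_eq_norm, one_mul,
    intervalIntegral.integral_interval_sub_left (hi _ hc _ hx) (hi _ hc _ hy),
    intervalIntegral.integral_interval_sub_left (hi _ hc _ hx).norm (hi _ hc _ hy).norm,
    Real.norm_eq_abs]
  exact intervalIntegral.norm_integral_le_abs_integral_norm

variable [CompleteSpace E]

/-- The difference of `y` and the primitive of `g` is absolutely continuous with derivative zero
almost everywhere, hence constant. -/
theorem absCont_eq_add_integral {y g : ℝ → E} (hy : AbsolutelyContinuousOnInterval y a b)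
    (hg : IntervalIntegrable g volume a b)
    (hd : ∀ᵐ t, t ∈ uIcc a b → HasDerivAt y (g t) t) {c t : ℝ} (hc : c ∈ uIcc a b)
    (ht : t ∈ uIcc a b) : y t = y c + ∫ τ in c..t, g τ := by
  have h1 := hy.sub (absCont_intervalIntegral hg hc)
  obtain ⟨C, hC⟩ := h1.const_of_ae_hasDerivAt_zero (by
    filter_upwards [hd, hg.ae_hasDerivAt_integral] with t h1 h2 ht
    simpa using (h1 ht).sub (h2 ht c hc))
  have e1 := hC t ht
  have e2 := hC c hc
  simp only [Pi.sub_apply, intervalIntegral.integral_same, sub_zero] at e1 e2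
  rw [e2, ← e1]; abel

end AbsCont

/-! ### Iterated integral inequalities -/

section Gronwall

variable {a b : ℝ} {k : ℝ → ℝ}

/-- The right side is absolutely continuous in `t` and has the integrand as derivative almost
everywhere; an integrable rate allows no more. -/
theorem integral_mul_pow_primitive (hab : a ≤ b) (hk : IntervalIntegrable k volume a b) (n : ℕ)
    {t : ℝ} (ht : t ∈ Icc a b) :
    ∫ τ in a..t, k τ * ((∫ σ in a..τ, k σ) ^ n / (n.factorial : ℝ)) =
      (∫ σ in a..t, k σ) ^ (n + 1) / ((n + 1).factorial : ℝ) := by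
  have hat : uIcc a t ⊆ uIcc a b := by
    rw [uIcc_of_le ht.1, uIcc_of_le hab]; exact Icc_subset_Icc_right ht.2
  have hk' := hk.mono_set hat
  set K : ℝ → ℝ := fun τ => ∫ σ in a..τ, k σ with hK
  have hKac : AbsolutelyContinuousOnInterval K a t :=
    absCont_intervalIntegral hk' left_mem_uIcc
  have h1 : AbsolutelyContinuousOnInterval (fun τ => K τ ^ (n + 1) / ((n + 1).factorial : ℝ)) a t :=
    absCont_contDiffAt_comp (f := fun x : ℝ => x ^ (n + 1) / ((n + 1).factorial : ℝ)) hKac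
      fun _ _ => by fun_prop
  have h2 := absCont_eq_add_integral (g := fun τ => k τ * (K τ ^ n / (n.factorial : ℝ))) h1 ?_ ?_
    left_mem_uIcc right_mem_uIcc
  · rw [h2]; simp [K]
  · refine hk'.mul_continuousOn ?_
    exact (hKac.continuousOn.pow n).div_const _
  · filter_upwards [hk'.ae_hasDerivAt_integral] with τ h hτ
    have h3 := ((h hτ a left_mem_uIcc).fun_pow (n + 1)).div_const ((n + 1).factorial : ℝ)
    refine h3.congr_deriv ?_
    rw [Nat.factorial_succ]
    push_cast
    have : (n.factorial : ℝ) ≠ 0 := by positivity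
    have : (n + 1 : ℝ) ≠ 0 := by positivity
    field_simp
    simp [K, mul_comm]

/-- Each integration raises the power of the primitive of `k` and completes the factorial. A
constant sequence yields Gronwall's lemma; the sequence `V ^ n h` shows that some power of a
Volterra operator is a contraction. -/
theorem le_pow_primitive_of_le_integral (hab : a ≤ b) (hk : IntervalIntegrable k volume a b)
    (hk0 : ∀ t, 0 ≤ k t) {φ : ℕ → ℝ → ℝ} {M : ℝ} (hφc : ∀ n, ContinuousOn (φ n) (Icc a b))
    (h0 : ∀ t ∈ Icc a b, φ 0 t ≤ M)
    (h : ∀ n, ∀ t ∈ Icc a b, φ (n + 1) t ≤ ∫ τ in a..t, k τ * φ n τ) (n : ℕ) :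
    ∀ t ∈ Icc a b, φ n t ≤ M * ((∫ τ in a..t, k τ) ^ n / (n.factorial : ℝ)) := by
  induction n with
  | zero => simpa using h0
  | succ n ih =>
    intro t ht
    have hsub : uIcc a t ⊆ uIcc a b := by
      rw [uIcc_of_le ht.1, uIcc_of_le hab]; exact Icc_subset_Icc_right ht.2
    have hk' := hk.mono_set hsub
    refine (h n t ht).trans ?_
    rw [← integral_mul_pow_primitive hab hk n ht, ← intervalIntegral.integral_const_mul]
    refine intervalIntegral.integral_mono_on ht.1 ?_ ?_ fun τ hτ => ?_
    · refine hk'.mul_continuousOn ((hφc n).mono ?_)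
      rwa [uIcc_of_le hab] at hsub
    · refine (hk'.mul_continuousOn ?_).const_mul _
      exact ((absCont_intervalIntegral hk' left_mem_uIcc).continuousOn.pow n).div_const _
    · rw [mul_left_comm]
      exact mul_le_mul_of_nonneg_left (ih τ ⟨hτ.1, hτ.2.trans ht.2⟩) (hk0 τ)

/-- The homogeneous Gronwall lemma with an integrable rate. -/
theorem eq_zero_of_norm_le_integral {E : Type*} [NormedAddCommGroup E] (hab : a ≤ b)
    (hk : IntervalIntegrable k volume a b)
    (hk0 : ∀ t, 0 ≤ k t) {y : ℝ → E} (hy : ContinuousOn y (Icc a b))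
    (h : ∀ t ∈ Icc a b, ‖y t‖ ≤ ∫ τ in a..t, k τ * ‖y τ‖) : ∀ t ∈ Icc a b, y t = 0 := by
  intro t ht
  obtain ⟨M, hM⟩ := (isCompact_Icc (a := a) (b := b)).exists_bound_of_continuousOn hy
  have key := fun n => le_pow_primitive_of_le_integral hab hk hk0 (φ := fun _ t => ‖y t‖)
    (fun _ => hy.norm) hM (fun _ => h) n t ht
  have hlim := (FloorSemiring.tendsto_pow_div_factorial_atTop (∫ τ in a..t, k τ)).const_mul M
  rw [mul_zero] at hlim
  exact norm_le_zero_iff.1 (ge_of_tendsto' hlim key)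

end Gronwall

/-! ### Superposition operators on spaces of continuous maps -/

section Superposition

universe w

variable {K : Type*} [TopologicalSpace K] [CompactSpace K] {E F : Type w} [NormedAddCommGroup E]
  [NormedSpace ℝ E] [NormedAddCommGroup F] [NormedSpace ℝ F]

/-- Pointwise application, as a bounded bilinear map. -/
def pointwiseApply : C(K, E →L[ℝ] F) →L[ℝ] C(K, E) →L[ℝ] C(K, F) :=
  LinearMap.mkContinuous₂
    (LinearMap.mk₂ ℝ (fun (A : C(K, E →L[ℝ] F)) (h : C(K, E)) => (⟨fun x => A x (h x), by fun_prop⟩ : C(K, F)))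
      (fun _ _ _ => by ext; simp) (fun _ _ _ => by ext; simp) (fun _ _ _ => by ext; simp)
      (fun _ _ _ => by ext; simp)) 1
    (fun A h => by
      rw [one_mul]
      refine (ContinuousMap.norm_le _ (by positivity)).2 fun x => ?_
      exact ((A x).le_opNorm _).trans
        (by gcongr; exacts [A.norm_coe_le_norm x, h.norm_coe_le_norm x]))

@[simp] theorem pointwiseApply_apply (A : C(K, E →L[ℝ] F)) (h : C(K, E)) (x : K) :
    pointwiseApply A h x = A x (h x) := rfl

/-- The mean value inequality is applied at each point of `K`. Continuity of `g ↦ f' ∘ g` in the sup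
norm bounds the oscillation of `f'` along all segments from `h x` to `h x + g x` at once, so the
remainder is uniform in `x`. -/
theorem hasFDerivAt_superposition {f : C(E, F)} {f' : C(E, E →L[ℝ] F)}
    (hf : ∀ x, HasFDerivAt f (f' x) x) (h : C(K, E)) :
    HasFDerivAt (fun h : C(K, E) => f.comp h) (pointwiseApply (f'.comp h)) h := by
  rw [hasFDerivAt_iff_isLittleO_nhds_zero, Asymptotics.isLittleO_iff]
  intro ε hε
  have hc : Continuous fun g : C(K, E) => f'.comp g := f'.continuous_postcomp
  obtain ⟨δ, hδ, hball⟩ := Metric.eventually_nhds_iff_ball.1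
    ((hc.tendsto h).eventually (Metric.ball_mem_nhds (f'.comp h) hε))
  filter_upwards [Metric.ball_mem_nhds (0 : C(K, E)) hδ] with g hg
  rw [mem_ball_zero_iff] at hg
  refine (ContinuousMap.norm_le _ (by positivity)).2 fun x => ?_
  have hseg : ∀ z ∈ segment ℝ (h x) (h x + g x), ‖f' z - f' (h x)‖ ≤ ε := by
    intro z hz
    rw [segment_eq_image'] at hz
    obtain ⟨r, hr, rfl⟩ := hz
    have h1 : dist (f'.comp (h + r • g)) (f'.comp h) < ε := by
      refine hball _ ?_
      rw [Metric.mem_ball, dist_eq_norm, add_sub_cancel_left, norm_smul, Real.norm_of_nonneg hr.1]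
      exact (mul_le_of_le_one_left (norm_nonneg _) hr.2).trans_lt hg
    have h2 := (ContinuousMap.dist_apply_le_dist x).trans h1.le
    simpa [dist_eq_norm] using h2
  have h3 := (convex_segment (h x) (h x + g x)).norm_image_sub_le_of_norm_hasFDerivWithin_le'
    (φ := f' (h x)) (fun z _ => (hf z).hasFDerivWithinAt) hseg (left_mem_segment _ _ _)
    (right_mem_segment _ _ _)
  simp only [add_sub_cancel_left] at h3
  refine le_trans (by simpa using h3) ?_
  exact mul_le_mul_of_nonneg_left (g.norm_coe_le_norm x) hε.le

/-- The induction passes from `F` to `E →L[ℝ] F`, so the spaces are quantified inside the statement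
and share one universe. -/
theorem contDiff_superposition_nat (n : ℕ) : ∀ {E F : Type w} [NormedAddCommGroup E]
    [NormedSpace ℝ E] [NormedAddCommGroup F] [NormedSpace ℝ F] (f : C(E, F)),
    ContDiff ℝ n f → ContDiff ℝ n (fun h : C(K, E) => f.comp h) := by
  induction n with
  | zero =>
    intro E F _ _ _ _ f _
    exact contDiff_zero.2 f.continuous_postcomp
  | succ n ih =>
    intro E F _ _ _ _ f hf
    have hf1 : ContDiff ℝ n (fderiv ℝ f) := hf.fderiv_right (by norm_cast)
    refine contDiff_succ_iff_hasFDerivAt.2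
      ⟨fun h => pointwiseApply ((⟨fderiv ℝ f, hf1.continuous⟩ : C(E, E →L[ℝ] F)).comp h), ?_, ?_⟩
    · exact pointwiseApply.contDiff.comp (ih (⟨fderiv ℝ f, hf1.continuous⟩ : C(E, E →L[ℝ] F)) hf1)
    · exact hasFDerivAt_superposition fun x =>
        ((hf.differentiable (by simp)) x).hasFDerivAt

theorem contDiff_superposition (f : C(E, F)) (hf : ContDiff ℝ ∞ f) :
    ContDiff ℝ ∞ (fun h : C(K, E) => f.comp h) :=
  contDiff_infty.2 fun n => contDiff_superposition_nat n f (contDiff_infty.1 hf n)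

end Superposition

/-! ### Volterra operators -/

section Volterra

variable {E : Type*} [NormedAddCommGroup E] [NormedSpace ℝ E] {T : ℝ}

/-- The operator `h ↦ (t ↦ ∫₀ᵗ w h)` for an integrable weight `w`. -/
def primitiveCLM [CompleteSpace E] (hT : 0 ≤ T) (w : ℝ → ℝ) (hw : IntervalIntegrable w volume 0 T) :
    C(Icc 0 T, E) →L[ℝ] C(Icc 0 T, E) :=
  have hi : ∀ h : C(Icc 0 T, E),
      IntervalIntegrable (fun τ => w τ • IccExtend hT h τ) volume 0 T := fun h =>
    hw.smul_continuousOn h.continuous.Icc_extend'.continuousOn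
  have hi' : ∀ (h : C(Icc 0 T, E)) (t : Icc 0 T),
      IntervalIntegrable (fun τ => w τ • IccExtend hT h τ) volume 0 t := fun h t =>
    (hi h).mono_set (by rw [uIcc_of_le t.2.1, uIcc_of_le hT]; exact Icc_subset_Icc_right t.2.2)
  LinearMap.mkContinuous
    { toFun := fun h => ⟨fun t => ∫ τ in 0..t, w τ • IccExtend hT h τ, by
        have := (absCont_intervalIntegral (hi h) left_mem_uIcc).continuousOn
        rw [uIcc_of_le hT] at this
        exact this.domRestrict⟩
      map_add' := fun h g => by
        ext t
        refine Eq.trans ?_ (intervalIntegral.integral_add (hi' h t) (hi' g t))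
        refine intervalIntegral.integral_congr fun τ _ => ?_
        exact smul_add _ _ _
      map_smul' := fun c h => by
        ext t
        refine Eq.trans ?_ (intervalIntegral.integral_smul c _)
        refine intervalIntegral.integral_congr fun τ _ => ?_
        exact smul_comm _ _ _ }
    (∫ τ in 0..T, |w τ|) (fun h => by
      have h0 : 0 ≤ ∫ τ in 0..T, |w τ| :=
        intervalIntegral.integral_nonneg hT fun _ _ => abs_nonneg _
      refine (ContinuousMap.norm_le _ (by positivity)).2 fun t => ?_
      have hw' : IntervalIntegrable w volume 0 t := hw.mono_set
        (by rw [uIcc_of_le t.2.1, uIcc_of_le hT]; exact Icc_subset_Icc_right t.2.2)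
      calc ‖∫ τ in 0..(t : ℝ), w τ • IccExtend hT h τ‖
          ≤ ∫ τ in 0..(t : ℝ), |w τ| * ‖h‖ := by
            refine (intervalIntegral.norm_integral_le_integral_norm t.2.1).trans ?_
            refine intervalIntegral.integral_mono_on t.2.1 (hi' h t).norm (hw'.abs.mul_const _)
              fun τ _ => ?_
            rw [norm_smul, Real.norm_eq_abs]
            exact mul_le_mul_of_nonneg_left (h.norm_coe_le_norm _) (abs_nonneg _)
        _ = (∫ τ in 0..(t : ℝ), |w τ|) * ‖h‖ := intervalIntegral.integral_mul_const _ _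
        _ ≤ _ := by
            refine mul_le_mul_of_nonneg_right ?_ (norm_nonneg _)
            exact intervalIntegral.integral_mono_interval le_rfl t.2.1 t.2.2
              (Eventually.of_forall fun _ => abs_nonneg _) hw.abs)

theorem primitiveCLM_apply [CompleteSpace E] (hT : 0 ≤ T) (w : ℝ → ℝ)
    (hw : IntervalIntegrable w volume 0 T) (h : C(Icc 0 T, E)) (t : Icc 0 T) :
    primitiveCLM hT w hw h t = ∫ τ in 0..(t : ℝ), w τ • IccExtend hT h τ := rfl

/-- `1 - V` is invertible for a Volterra operator `V`, because some power of `V` is a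
contraction. -/
theorem isUnit_one_sub_of_volterra [CompleteSpace E] (hT : 0 ≤ T) {k : ℝ → ℝ}
    (hk : IntervalIntegrable k volume 0 T) (hk0 : ∀ t, 0 ≤ k t)
    (V : C(Icc 0 T, E) →L[ℝ] C(Icc 0 T, E))
    (hV : ∀ h (t : Icc 0 T), ‖V h t‖ ≤ ∫ τ in 0..(t : ℝ), k τ * ‖IccExtend hT h τ‖) :
    IsUnit (1 - V) := by
  set κ := ∫ τ in 0..T, k τ with hκ
  have hκ0 : 0 ≤ κ := intervalIntegral.integral_nonneg hT fun _ _ => hk0 _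
  obtain ⟨n, hn⟩ : ∃ n : ℕ, κ ^ n / (n.factorial : ℝ) < 1 :=
    ((FloorSemiring.tendsto_pow_div_factorial_atTop κ).eventually_lt_const one_pos).exists
  have hnorm : ‖V ^ n‖ < 1 := by
    refine lt_of_le_of_lt (ContinuousLinearMap.opNorm_le_bound _ (by positivity) fun h => ?_) hn
    refine (ContinuousMap.norm_le _ (by positivity)).2 fun t => ?_
    have h1 := le_pow_primitive_of_le_integral hT hk hk0
      (φ := fun n t => ‖IccExtend hT ((V ^ n) h) t‖) (M := ‖h‖)
      (fun n => ((V ^ n) h).continuous.Icc_extend'.norm.continuousOn)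
      (fun t _ => by simpa [IccExtend] using h.norm_coe_le_norm _)
      (fun n t ht => by
        have := hV ((V ^ n) h) ⟨t, ht⟩
        rwa [IccExtend_of_mem _ _ ht, pow_succ']) n t t.2
    simp only [IccExtend_of_mem _ _ t.2, Subtype.coe_eta] at h1
    rw [mul_comm]
    refine h1.trans (mul_le_mul_of_nonneg_left ?_ (norm_nonneg _))
    have h2 : 0 ≤ ∫ τ in 0..(t : ℝ), k τ := intervalIntegral.integral_nonneg t.2.1 fun _ _ => hk0 _
    have h3 : ∫ τ in 0..(t : ℝ), k τ ≤ κ := intervalIntegral.integral_mono_interval le_rfl t.2.1 t.2.2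
      (Eventually.of_forall hk0) hk
    gcongr
  have hu := isUnit_one_sub_of_norm_lt_one (R := C(Icc 0 T, E) →L[ℝ] C(Icc 0 T, E)) hnorm
  -- `1 - V ^ n` is the product of `1 - V` and a geometric sum that commutes with it, so both
  -- factors are invertible.
  rw [← mul_neg_geom_sum] at hu
  refine ((Commute.isUnit_mul_iff ?_).1 hu).1
  refine Commute.sum_right _ _ _ fun i _ => ?_
  exact ((Commute.one_left V).sub_left (Commute.refl V)).pow_right i

end Volterra

/-! ### Jets of curves -/

section Jets

variable {E F : Type*} [NormedAddCommGroup E] [NormedSpace ℝ E] [NormedAddCommGroup F]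
  [NormedSpace ℝ F] {m : ℕ}

/-- `c 0, …, c m` are the coefficients of a Taylor expansion of order `m` of `f` at `0`. -/
def HasJet (f : ℝ → E) (c : ℕ → E) (m : ℕ) : Prop :=
  (fun s => f s - ∑ j ∈ Finset.range (m + 1), s ^ j • c j) =o[𝓝 0] fun s : ℝ => s ^ m

theorem pow_succ_isLittleO (m : ℕ) : (fun s : ℝ => s ^ (m + 1)) =o[𝓝 0] fun s : ℝ => s ^ m :=
  Asymptotics.isLittleO_pow_pow (Nat.lt_succ_self m)

theorem HasJet.of_succ {f : ℝ → E} {c : ℕ → E} (h : HasJet f c (m + 1)) : HasJet f c m := by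
  have h1 := h.trans (pow_succ_isLittleO m)
  have h2 : (fun s : ℝ => s ^ (m + 1) • c (m + 1)) =o[𝓝 0] fun s : ℝ => s ^ m := by
    refine Asymptotics.IsBigO.trans_isLittleO ?_ (pow_succ_isLittleO m)
    exact Asymptotics.IsBigO.of_bound ‖c (m + 1)‖
      (Eventually.of_forall fun s => by rw [norm_smul, mul_comm])
  refine (h1.add h2).congr_left fun s => ?_
  rw [Finset.sum_range_succ _ (m + 1)]
  abel

theorem HasJet.of_le {f : ℝ → E} {c : ℕ → E} {k : ℕ} (h : HasJet f c m) (hk : k ≤ m) :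
    HasJet f c k := by
  induction m, hk using Nat.le_induction with
  | base => exact h
  | succ n _ ih => exact ih h.of_succ

theorem HasJet.congr {f : ℝ → E} {c d : ℕ → E} (h : HasJet f c m) (hcd : ∀ j ≤ m, c j = d j) :
    HasJet f d m := by
  refine Asymptotics.IsLittleO.congr_left h fun s => ?_
  rw [Finset.sum_congr rfl fun j hj => by rw [hcd j (Nat.lt_succ_iff.1 (Finset.mem_range.1 hj))]]

theorem HasJet.congr_fun {f g : ℝ → E} {c : ℕ → E} (h : HasJet f c m) (hfg : f =ᶠ[𝓝 0] g) :
    HasJet g c m :=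
  Asymptotics.IsLittleO.congr' h (hfg.mono fun s hs => by simp only [hs]) EventuallyEq.rfl

theorem hasJet_of_sub_isLittleO {f g : ℝ → E} {c : ℕ → E} (h : HasJet f c m)
    (hfg : (fun s => g s - f s) =o[𝓝 0] fun s : ℝ => s ^ m) : HasJet g c m :=
  (hfg.add h).congr_left fun s => by abel

theorem hasJet_polynomial (c : ℕ → E) :
    HasJet (fun s => ∑ j ∈ Finset.range (m + 1), s ^ j • c j) c m :=
  (Asymptotics.isLittleO_zero _ _).congr_left fun s => by simp

theorem HasJet.add {f g : ℝ → E} {c d : ℕ → E} (hf : HasJet f c m) (hg : HasJet g d m) :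
    HasJet (fun s => f s + g s) (fun j => c j + d j) m :=
  (Asymptotics.IsLittleO.add hf hg).congr_left fun s => by
    simp only [smul_add, Finset.sum_add_distrib]; abel

theorem HasJet.clm_comp {f : ℝ → E} {c : ℕ → E} (hf : HasJet f c m) (L : E →L[ℝ] F) :
    HasJet (fun s => L (f s)) (fun j => L (c j)) m :=
  ((L.isBigO_comp _ _).trans_isLittleO hf).congr_left fun s => by simp

theorem HasJet.const_smul {f : ℝ → E} {c : ℕ → E} (hf : HasJet f c m) (r : ℝ) :
    HasJet (fun s => r • f s) (fun j => r • c j) m :=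
  hf.clm_comp (r • ContinuousLinearMap.id ℝ E)

theorem hasJet_const (x : E) : HasJet (fun _ => x) (fun j => if j = 0 then x else 0) m :=
  (hasJet_polynomial (m := m) _).congr_fun (Eventually.of_forall fun s => by
    simp)

theorem hasJet_zero : HasJet (fun _ => (0 : E)) (fun _ => 0) m :=
  (hasJet_const (0 : E)).congr fun j _ => by simp

theorem hasJet_sum {ι : Type*} (t : Finset ι) {f : ι → ℝ → E} {c : ι → ℕ → E}
    (h : ∀ i ∈ t, HasJet (f i) (c i) m) :
    HasJet (fun s => ∑ i ∈ t, f i s) (fun j => ∑ i ∈ t, c i j) m := by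
  classical
  induction t using Finset.induction_on with
  | empty => simpa using hasJet_zero
  | insert i t hi ih =>
    simp only [Finset.sum_insert hi]
    exact (h i (Finset.mem_insert_self _ _)).add (ih fun j hj => h j (Finset.mem_insert_of_mem hj))

/-- Multiplication of a jet by the variable. -/
def shiftJet {G : Type*} [Zero G] (c : ℕ → G) (j : ℕ) : G := if j = 0 then 0 else c (j - 1)

@[simp] theorem shiftJet_zero {G : Type*} [Zero G] (c : ℕ → G) : shiftJet c 0 = 0 := rfl

@[simp] theorem shiftJet_succ {G : Type*} [Zero G] (c : ℕ → G) (j : ℕ) : shiftJet c (j + 1) = c j := rfl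

theorem HasJet.smul_id {f : ℝ → E} {c : ℕ → E} (hf : HasJet f c m) :
    HasJet (fun s => s • f s) (shiftJet c) m := by
  refine HasJet.of_succ (((Asymptotics.isBigO_refl (fun s : ℝ => s) _).smul_isLittleO hf).congr
    (fun s => ?_) fun s => by rw [smul_eq_mul, pow_succ'])
  rw [Finset.sum_range_succ' _ (m + 1)]
  simp [smul_sub, Finset.smul_sum, smul_smul, pow_succ']

/-- The first coefficient not yet known to vanish satisfies `s ^ k • c k = o(s ^ k)`. -/
theorem HasJet.eq_zero {c : ℕ → E} (h : HasJet (fun _ => (0 : E)) c m) : ∀ j ≤ m, c j = 0 := by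
  have key : ∀ k, HasJet (fun _ => (0 : E)) c k → (∀ j < k, c j = 0) → c k = 0 := by
    intro k hk hz
    have h1 : (fun s : ℝ => s ^ k • c k) =o[𝓝 0] fun s : ℝ => s ^ k := by
      refine (Asymptotics.IsLittleO.neg_left hk).congr_left fun s => ?_
      rw [Finset.sum_range_succ, Finset.sum_eq_zero fun j hj => by
        rw [hz j (Finset.mem_range.1 hj), smul_zero]]
      simp
    rw [Asymptotics.isLittleO_iff] at h1
    refine norm_le_zero_iff.1 (le_of_forall_pos_le_add fun ε hε => ?_)
    have h2 := (h1 hε).filter_mono (nhdsWithin_le_nhds (s := {(0 : ℝ)}ᶜ))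
    obtain ⟨s, hs, hs0⟩ := (h2.and self_mem_nhdsWithin).exists
    rw [norm_smul, mul_comm] at hs
    have : 0 < ‖s ^ k‖ := norm_pos_iff.2 (pow_ne_zero k hs0)
    simpa using le_of_mul_le_mul_right hs this
  intro j
  induction j using Nat.strong_induction_on with
  | _ j ih => exact fun hj => key j (h.of_le hj) fun i hi => ih i hi (hi.le.trans hj)

/-- Coefficient identities are proved through this lemma: two expansions of one function are
exhibited and compared. -/
theorem HasJet.unique {f : ℝ → E} {c d : ℕ → E} (hc : HasJet f c m) (hd : HasJet f d m) :
    ∀ j ≤ m, c j = d j := fun j hj => by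
  have h := (hc.add (hd.const_smul (-1))).congr_fun (g := fun _ => (0 : E))
    (Eventually.of_forall fun s => by simp)
  have := h.eq_zero j hj
  rwa [neg_one_smul, ← sub_eq_add_neg, sub_eq_zero] at this

/-- The coefficients of the Taylor expansion of `f` at `0`. -/
def taylorSeq (f : ℝ → E) (j : ℕ) : E := (1 / (j.factorial : ℝ)) • iteratedDeriv j f 0

theorem hasJet_taylorSeq {f : ℝ → E} (hf : ContDiffAt ℝ ∞ f 0) : HasJet f (taylorSeq f) m := by
  obtain ⟨u, hu, hfu⟩ := (hf.of_le (m := m) (by exact_mod_cast le_top)).contDiffOn le_rfl (by simp)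
  obtain ⟨ε, hε, hball⟩ := Metric.mem_nhds_iff.1 hu
  have h0 : (0 : ℝ) ∈ Metric.ball (0 : ℝ) ε := Metric.mem_ball_self hε
  have h1 := taylor_isLittleO (convex_ball (0 : ℝ) ε) h0 (hfu.mono hball)
  rw [nhdsWithin_eq_nhds.2 (Metric.ball_mem_nhds _ hε)] at h1
  refine h1.congr (fun s => ?_) fun s => by rw [sub_zero]
  rw [taylor_within_apply]
  congr 1
  refine Finset.sum_congr rfl fun j _ => ?_
  rw [iteratedDerivWithin_of_isOpen Metric.isOpen_ball h0, taylorSeq, smul_smul, sub_zero, one_div,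
    mul_comm]

/-- With `L` the evaluation at a time, Taylor coefficients in the space of curves become Taylor
coefficients at that time. -/
theorem taylorSeq_clm_comp {g : ℝ → E}
    (hg : ContDiffAt ℝ ∞ g 0) (L : E →L[ℝ] F) (j : ℕ) :
    taylorSeq (fun s => L (g s)) j = L (taylorSeq g j) :=
  HasJet.unique (hasJet_taylorSeq (L.contDiff.contDiffAt.comp 0 hg))
    ((hasJet_taylorSeq (m := j) hg).clm_comp L) j le_rfl

theorem taylorSeq_congr {g h : ℝ → E} (hgh : g =ᶠ[𝓝 0] h) (j : ℕ) :
    taylorSeq g j = taylorSeq h j := by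
  rw [taylorSeq, taylorSeq, hgh.iteratedDeriv_eq]

theorem taylorSeq_zero (g : ℝ → E) : taylorSeq g 0 = g 0 := by simp [taylorSeq]

/-! ### Multilinear maps applied to jets -/

/-- The coefficients of `Φ (c_1(s), …, c_r(s))` for the formal power series
`c_i(s) = ∑ s ^ j • c i j`. -/
def mulJet {r : ℕ} (Φ : E [×r]→L[ℝ] F) (c : Fin r → ℕ → E) (j : ℕ) : F :=
  ∑ p ∈ Finset.Nat.antidiagonalTuple r j, Φ fun i => c i (p i)

theorem mulJet_congr {r : ℕ} (Φ : E [×r]→L[ℝ] F) {c d : Fin r → ℕ → E} {j : ℕ}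
    (h : ∀ i, ∀ k ≤ j, c i k = d i k) : mulJet Φ c j = mulJet Φ d j := by
  refine Finset.sum_congr rfl fun p hp => ?_
  rw [Finset.Nat.mem_antidiagonalTuple] at hp
  congr 1
  ext1 i
  exact h i _ (hp ▸ Finset.single_le_sum (fun _ _ => Nat.zero_le _) (Finset.mem_univ i))

/-- Replacing each `f i` by its Taylor polynomial `P i` costs `o(s ^ m)`, since `Φ` is Lipschitz on
bounded sets. Expanding `Φ` on the `P i` gives one term for each choice `p` of a degree in every
slot; total degrees up to `m` form the jet, and higher ones are `o(s ^ m)`. -/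
theorem HasJet.multilinear {r : ℕ} (Φ : E [×r]→L[ℝ] F) {f : Fin r → ℝ → E} {c : Fin r → ℕ → E}
    (h : ∀ i, HasJet (f i) (c i) m) :
    HasJet (fun s => Φ fun i => f i s) (mulJet Φ c) m := by
  set P : Fin r → ℝ → E := fun i s => ∑ j ∈ Finset.range (m + 1), s ^ j • c i j with hP
  have hsub : (fun s i => f i s - P i s) =o[𝓝 0] fun s : ℝ => s ^ m := Asymptotics.isLittleO_pi.2 h
  have hPc : Continuous fun s i => P i s := by fun_prop
  have hPb : (fun s i => P i s) =O[𝓝 0] fun _ : ℝ => (1 : ℝ) := hPc.continuousAt.isBigO_one ℝ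
  have hsb : (fun s i => f i s - P i s) =O[𝓝 0] fun _ : ℝ => (1 : ℝ) := by
    refine hsub.isBigO.trans ?_
    exact (continuous_pow m).continuousAt.isBigO_one ℝ
  have hfb : (fun s i => f i s) =O[𝓝 0] fun _ : ℝ => (1 : ℝ) :=
    (hsb.add hPb).congr_left fun s => by ext i; simp
  have h1 : (fun s => Φ (fun i => f i s) - Φ (fun i => P i s)) =o[𝓝 0] fun s : ℝ => s ^ m := by
    obtain ⟨C, hC⟩ := hfb.bound
    obtain ⟨D, hD⟩ := hPb.bound
    refine Asymptotics.IsBigO.trans_isLittleO (Asymptotics.IsBigO.of_bound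
      (‖Φ‖ * r * max C D ^ (r - 1)) ?_) hsub
    filter_upwards [hC, hD] with s hs1 hs2
    rw [norm_one, mul_one] at hs1 hs2
    have := Φ.norm_image_sub_le (fun i => f i s) (fun i => P i s)
    rw [Fintype.card_fin] at this
    refine this.trans ?_
    have hle : max ‖fun i => f i s‖ ‖fun i => P i s‖ ≤ max C D := max_le_max hs1 hs2
    have : (fun i => f i s) - (fun i => P i s) = fun i => f i s - P i s := rfl
    rw [this]
    gcongr
  refine hasJet_of_sub_isLittleO ?_ h1
  set A := Fintype.piFinset fun _ : Fin r => Finset.range (m + 1) with hA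
  have h2 : ∀ s : ℝ, Φ (fun i => P i s) = ∑ p ∈ A, s ^ (∑ i, p i) • Φ fun i => c i (p i) := by
    intro s
    have e1 := Φ.toMultilinearMap.map_sum_finset (fun i j => s ^ j • c i j)
      (fun _ => Finset.range (m + 1))
    refine e1.trans (Finset.sum_congr rfl fun p _ => ?_)
    rw [MultilinearMap.map_smul_univ, Finset.prod_pow_eq_pow_sum]
    rfl
  have h3 : ∀ s : ℝ, ∑ j ∈ Finset.range (m + 1), s ^ j • mulJet Φ c j =
      ∑ p ∈ A with ∑ i, p i ∈ Finset.range (m + 1), s ^ (∑ i, p i) • Φ fun i => c i (p i) := by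
    intro s
    rw [← Finset.sum_fiberwise_of_maps_to (s := A.filter fun p => ∑ i, p i ∈ Finset.range (m + 1))
      (t := Finset.range (m + 1)) (g := fun p => ∑ i, p i) fun p hp => (Finset.mem_filter.1 hp).2]
    refine Finset.sum_congr rfl fun j hj => ?_
    rw [mulJet, Finset.smul_sum]
    refine Finset.sum_congr ?_ fun p hp => ?_
    · ext p
      simp only [Finset.Nat.mem_antidiagonalTuple, Finset.mem_filter, hA, Fintype.mem_piFinset,
        Finset.mem_range] at hj ⊢
      refine ⟨fun h => ⟨⟨fun i => ?_, h ▸ hj⟩, h⟩, fun h => h.2⟩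
      exact lt_of_le_of_lt (h ▸ Finset.single_le_sum (f := p) (fun _ _ => Nat.zero_le _)
        (Finset.mem_univ i)) hj
    · rw [(Finset.mem_filter.1 hp).2]
  have h4 : (fun s : ℝ => ∑ p ∈ A with ¬ (∑ i, p i ∈ Finset.range (m + 1)),
      s ^ (∑ i, p i) • Φ fun i => c i (p i)) =o[𝓝 0] fun s : ℝ => s ^ m := by
    refine Asymptotics.IsLittleO.fun_sum fun p hp => ?_
    have hp' : m < ∑ i, p i := by simpa using (Finset.mem_filter.1 hp).2
    have hO : (fun s : ℝ => s ^ (∑ i, p i) • Φ fun i => c i (p i)) =O[𝓝 0]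
        fun s : ℝ => s ^ (∑ i, p i) :=
      Asymptotics.IsBigO.of_bound (‖Φ fun i => c i (p i)‖)
        (Eventually.of_forall fun s => by rw [norm_smul, mul_comm])
    exact hO.trans_isLittleO (Asymptotics.isLittleO_pow_pow hp')
  refine h4.congr_left fun s => ?_
  simp only [h2, h3]
  rw [← Finset.sum_filter_add_sum_filter_not A (fun p => ∑ i, p i ∈ Finset.range (m + 1))]
  abel

/-- Here `o i` is a lower bound for the order of the series in slot `i`. If the degrees add up to
less than `∑ o i`, some slot falls below its order. -/
theorem mulJet_eq_zero {r j l : ℕ} (Φ : E [×r]→L[ℝ] F) {c : Fin r → ℕ → E} (o : Fin r → ℕ)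
    (hc : ∀ i, ∀ k < o i, c i k = 0) (hl : ∑ i, o i = l) (hj : j < l) : mulJet Φ c j = 0 := by
  refine Finset.sum_eq_zero fun p hp => ?_
  rw [Finset.Nat.mem_antidiagonalTuple] at hp
  obtain ⟨i, hi⟩ : ∃ i, p i < o i := by
    by_contra! h
    exact absurd (Finset.sum_le_sum fun i (_ : i ∈ Finset.univ) => h i) (by omega)
  exact Φ.map_coord_zero i (hc i _ hi)

theorem mulJet_const_eq_zero {r j : ℕ} (Φ : E [×r]→L[ℝ] F) {b : ℕ → E} (hb : b 0 = 0) (hj : j < r) :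
    mulJet Φ (fun _ => b) j = 0 :=
  mulJet_eq_zero Φ (fun _ => 1) (fun _ k hk => by rw [Nat.lt_one_iff.1 hk, hb]) (by simp) hj

/-- This is the substitution of `x s` for `s`, the source of homogeneity. -/
theorem mulJet_smul_pow {r : ℕ} (Φ : E [×r]→L[ℝ] F) (c : Fin r → ℕ → E) (x : ℝ) (j : ℕ) :
    mulJet Φ (fun i k => x ^ k • c i k) j = x ^ j • mulJet Φ c j := by
  rw [mulJet, mulJet, Finset.smul_sum]
  refine Finset.sum_congr rfl fun p hp => ?_
  rw [Finset.Nat.mem_antidiagonalTuple] at hp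
  have := Φ.toMultilinearMap.map_smul_univ (fun i => x ^ p i) (fun i => c i (p i))
  rw [Finset.prod_pow_eq_pow_sum, hp] at this
  exact this

/-! ### Composition of jets with smooth maps -/

/-- The coefficients of `f (x₀ + b(s))` for a formal power series `b(s)` with `b 0 = 0`. -/
def compJet (f : E → F) (x₀ : E) (b : ℕ → E) (j : ℕ) : F :=
  ∑ σ ∈ Finset.range (j + 1),
    (σ.factorial : ℝ)⁻¹ • mulJet (iteratedFDeriv ℝ σ f x₀) (fun _ => b) j

/-- Since `b` starts in degree one, terms with `σ > j` do not reach degree `j`; one bound `N` can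
thus serve all `j ≤ N`. -/
theorem compJet_eq_sum (f : E → F) (x₀ : E) {b : ℕ → E} (hb : b 0 = 0) {j N : ℕ} (h : j ≤ N) :
    compJet f x₀ b j = ∑ σ ∈ Finset.range (N + 1),
      (σ.factorial : ℝ)⁻¹ • mulJet (iteratedFDeriv ℝ σ f x₀) (fun _ => b) j := by
  refine Finset.sum_subset (Finset.range_mono (by omega)) fun σ _ hσ => ?_
  rw [mulJet_const_eq_zero _ hb (by simpa using hσ), smul_zero]

theorem HasJet.isBigO_id {y : ℝ → E} {b : ℕ → E} (hy : HasJet y b 1) (hb : b 0 = 0) :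
    y =O[𝓝 0] fun s : ℝ => s := by
  have h1 : (fun s : ℝ => s • b 1) =O[𝓝 0] fun s : ℝ => s :=
    Asymptotics.IsBigO.of_bound ‖b 1‖ (Eventually.of_forall fun s => by rw [norm_smul, mul_comm])
  refine (((Asymptotics.IsLittleO.isBigO hy).congr_right fun s => pow_one s).add h1).congr_left fun s => ?_
  simp [Finset.sum_range_succ, hb]

/-- The Taylor polynomial of `f` at `x₀`, evaluated on `y`, has the required jet by multilinearity.
The integral remainder is `O(‖y‖ ^ (m + 1))`, which is `o(s ^ m)`. -/
theorem HasJet.comp_contDiff [CompleteSpace F] {f : E → F} (hf : ContDiff ℝ ∞ f) (x₀ : E)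
    {y : ℝ → E} {b : ℕ → E} (hy : HasJet y b m) (hb : b 0 = 0) :
    HasJet (fun s => f (x₀ + y s)) (compJet f x₀ b) m := by
  have hy0 : HasJet y b 0 := hy.of_le (Nat.zero_le _)
  have hy1 : y =o[𝓝 0] fun _ : ℝ => (1 : ℝ) := by
    refine Asymptotics.IsLittleO.congr hy0 (fun s => ?_) fun s => pow_zero s
    simp [hb]
  have hlim : Tendsto y (𝓝 0) (𝓝 0) := (Asymptotics.isLittleO_one_iff ℝ).1 hy1
  have hpow : (fun s => ‖y s‖ ^ (m + 1)) =o[𝓝 0] fun s : ℝ => s ^ m := by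
    -- A jet of order zero gives only `y = o(1)`; `y = O(s)` needs `m ≥ 1`.
    rcases Nat.eq_zero_or_pos m with rfl | hm
    · simpa using hy1.norm_left
    · have h1 := (((hy.of_le hm).isBigO_id hb).norm_left).pow (m + 1)
      exact h1.trans_isLittleO (pow_succ_isLittleO m)
  have hT : HasJet (fun s => ∑ σ ∈ Finset.range (m + 1),
      (σ.factorial : ℝ)⁻¹ • iteratedFDeriv ℝ σ f x₀ fun _ => y s) (compJet f x₀ b) m :=
    (hasJet_sum (Finset.range (m + 1)) fun σ _ =>
      (HasJet.multilinear (iteratedFDeriv ℝ σ f x₀) fun _ => hy).const_smul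
        (σ.factorial : ℝ)⁻¹).congr fun j hj => (compJet_eq_sum f x₀ hb hj).symm
  refine hasJet_of_sub_isLittleO hT ?_
  have hcont : Continuous (iteratedFDeriv ℝ (m + 1) f) :=
    hf.continuous_iteratedFDeriv (by exact_mod_cast le_top)
  obtain ⟨δ, hδ, hball⟩ := Metric.eventually_nhds_iff_ball.1
    ((hcont.norm.tendsto x₀).eventually_lt_const (lt_add_one ‖iteratedFDeriv ℝ (m + 1) f x₀‖))
  set C := ‖iteratedFDeriv ℝ (m + 1) f x₀‖ + 1 with hC
  refine Asymptotics.IsBigO.trans_isLittleO (Asymptotics.IsBigO.of_bound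
    ((m.factorial : ℝ)⁻¹ * C) ?_) hpow
  filter_upwards [hlim.eventually (Metric.ball_mem_nhds 0 hδ)] with s hs
  have hs' : ‖y s‖ < δ := by simpa using hs
  rw [map_add_eq_sum_add_integral_iteratedFDeriv (n := m)
    fun t _ => hf.contDiffAt.of_le (by exact_mod_cast le_top), add_sub_cancel_left, norm_smul,
    norm_inv, Real.norm_natCast, mul_assoc]
  refine mul_le_mul_of_nonneg_left ?_ (by positivity)
  have hI := intervalIntegral.norm_integral_le_of_norm_le_const (a := 0) (b := 1)
    (f := fun t : ℝ => (1 - t) ^ m • iteratedFDeriv ℝ (m + 1) f (x₀ + t • y s) fun _ => y s)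
    (C := C * ‖y s‖ ^ (m + 1)) fun t ht => ?_
  · simpa using hI
  · rw [uIoc_of_le zero_le_one] at ht
    rw [norm_smul, norm_pow, Real.norm_of_nonneg (by linarith [ht.2])]
    have h1 : (1 - t) ^ m ≤ 1 := pow_le_one₀ (by linarith [ht.2]) (by linarith [ht.1])
    have h2 : ‖iteratedFDeriv ℝ (m + 1) f (x₀ + t • y s) fun _ => y s‖ ≤ C * ‖y s‖ ^ (m + 1) := by
      refine (ContinuousMultilinearMap.le_opNorm _ _).trans ?_
      rw [Finset.prod_const, Finset.card_univ, Fintype.card_fin]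
      refine mul_le_mul_of_nonneg_right (hball _ ?_).le (by positivity)
      rw [Metric.mem_ball, dist_eq_norm, add_sub_cancel_left, norm_smul,
        Real.norm_of_nonneg ht.1.le]
      exact (mul_le_of_le_one_left (norm_nonneg _) ht.2).trans_lt hs'
    calc _ ≤ 1 * (C * ‖y s‖ ^ (m + 1)) := by gcongr
      _ = _ := one_mul _

end Jets

/-! ### Smooth dependence of trajectories on a parameter of the control -/

section Family

universe w

variable {E : Type w} [NormedAddCommGroup E] [NormedSpace ℝ E] [CompleteSpace E] {T : ℝ} {l : ℕ}

/-- The implicit function theorem is applied to `G(s, h)`, the defect of `h` in the integral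
equation with control `u + s v`. Its derivative in `h` at `(0, x)` is `1 - V` with `V` of Volterra
type, hence invertible with no smallness of `T` or `u`. -/
theorem exists_smooth_family (hT : 0 ≤ T) {f : Fin l → C(E, E)} (hf : ∀ i, ContDiff ℝ ∞ (f i))
    {u v : Fin l → ℝ → ℝ} (hu : ∀ i, IntervalIntegrable (u i) volume 0 T)
    (hv : ∀ i, IntervalIntegrable (v i) volume 0 T) (x₀ : E) {x : C(Icc 0 T, E)}
    (hx : x = ContinuousMap.const _ x₀ + ∑ i, primitiveCLM hT (u i) (hu i) ((f i).comp x)) :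
    ∃ ξ : ℝ → C(Icc 0 T, E), ContDiffAt ℝ ∞ ξ 0 ∧ ξ 0 = x ∧ ∀ᶠ s in 𝓝 0,
      ξ s = ContinuousMap.const _ x₀ + (∑ i, primitiveCLM hT (u i) (hu i) ((f i).comp (ξ s)) +
        s • ∑ i, primitiveCLM hT (v i) (hv i) ((f i).comp (ξ s))) := by
  have hN : ∀ i, ContDiff ℝ ∞ fun h : C(Icc 0 T, E) => (f i).comp h :=
    fun i => contDiff_superposition (f i) (hf i)
  set G : ℝ × C(Icc 0 T, E) → C(Icc 0 T, E) := fun p => p.2 - (ContinuousMap.const _ x₀ +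
    (∑ i, primitiveCLM hT (u i) (hu i) ((f i).comp p.2) +
      p.1 • ∑ i, primitiveCLM hT (v i) (hv i) ((f i).comp p.2))) with hG
  have hGs : ContDiff ℝ ∞ G := by
    have h1 : ∀ (w : Fin l → ℝ → ℝ) (hw : ∀ i, IntervalIntegrable (w i) volume 0 T),
        ContDiff ℝ ∞ fun p : ℝ × C(Icc 0 T, E) =>
          ∑ i, primitiveCLM hT (w i) (hw i) ((f i).comp p.2) := fun w hw =>
      ContDiff.sum fun i _ => (primitiveCLM hT (w i) (hw i)).contDiff.comp ((hN i).comp contDiff_snd)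
    exact contDiff_snd.sub (contDiff_const.add ((h1 u hu).add (contDiff_fst.smul (h1 v hv))))
  have hfc : ∀ i, Continuous (fderiv ℝ (f i)) := fun i => (hf i).continuous_fderiv (by simp)
  set D : Fin l → C(Icc 0 T, E →L[ℝ] E) := fun i =>
    (⟨fderiv ℝ (f i), hfc i⟩ : C(E, E →L[ℝ] E)).comp x with hD
  set V : C(Icc 0 T, E) →L[ℝ] C(Icc 0 T, E) :=
    ∑ i, (primitiveCLM hT (u i) (hu i)).comp (pointwiseApply (D i)) with hV
  have hVunit : IsUnit (1 - V) := by
    have hint : ∀ i, IntervalIntegrable (fun τ => |u i τ| * ‖D i‖) volume 0 T :=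
      fun i => (hu i).abs.mul_const _
    refine isUnit_one_sub_of_volterra hT (k := fun τ => ∑ i, |u i τ| * ‖D i‖)
      (by simpa only [Finset.sum_fn] using IntervalIntegrable.sum Finset.univ fun i _ => hint i)
      (fun t => Finset.sum_nonneg fun _ _ => by positivity) V fun h t => ?_
    have hsub : uIcc 0 (t : ℝ) ⊆ uIcc 0 T := by
      rw [uIcc_of_le t.2.1, uIcc_of_le hT]; exact Icc_subset_Icc_right t.2.2
    have e1 : V h t = ∑ i, primitiveCLM hT (u i) (hu i) (pointwiseApply (D i) h) t := by
      simp [hV, ContinuousMap.sum_apply]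
    have e2 : ∫ τ in 0..(t : ℝ), (∑ i, |u i τ| * ‖D i‖) * ‖IccExtend hT h τ‖ =
        ∑ i, ∫ τ in 0..(t : ℝ), |u i τ| * ‖D i‖ * ‖IccExtend hT h τ‖ := by
      simp_rw [Finset.sum_mul]
      refine intervalIntegral.integral_finsetSum fun i _ => ?_
      exact ((hint i).mono_set hsub).mul_continuousOn h.continuous.Icc_extend'.norm.continuousOn
    rw [e1, e2]
    refine norm_sum_le_of_le _ fun i _ => ?_
    rw [primitiveCLM_apply]
    refine (intervalIntegral.norm_integral_le_integral_norm t.2.1).trans ?_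
    refine intervalIntegral.integral_mono_on t.2.1 ?_ ?_ fun τ _ => ?_
    · exact (((hu i).mono_set hsub).smul_continuousOn
        (pointwiseApply (D i) h).continuous.Icc_extend'.continuousOn).norm
    · exact ((hint i).mono_set hsub).mul_continuousOn h.continuous.Icc_extend'.norm.continuousOn
    · rw [norm_smul, Real.norm_eq_abs, mul_assoc]
      refine mul_le_mul_of_nonneg_left ?_ (abs_nonneg _)
      exact ((D i _).le_opNorm _).trans (mul_le_mul_of_nonneg_right ((D i).norm_coe_le_norm _)
        (norm_nonneg _))
  have hderiv : (fderiv ℝ G (0, x)).comp (ContinuousLinearMap.inr ℝ ℝ (C(Icc 0 T, E))) = 1 - V := by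
    have h1 : HasFDerivAt (fun y => G (0, y))
        ((fderiv ℝ G (0, x)).comp (ContinuousLinearMap.inr ℝ ℝ (C(Icc 0 T, E)))) x :=
      ((hGs.differentiable (by simp)) (0, x)).hasFDerivAt.comp x (hasFDerivAt_prodMk_right 0 x)
    refine h1.unique ?_
    have h2 : HasFDerivAt (fun y : C(Icc 0 T, E) => y - (ContinuousMap.const _ x₀ +
        ∑ i, primitiveCLM hT (u i) (hu i) ((f i).comp y))) (1 - V) x := by
      refine (hasFDerivAt_id x).sub (HasFDerivAt.const_add _ ?_)
      refine HasFDerivAt.fun_sum fun i _ => ?_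
      refine (ContinuousLinearMap.hasFDerivAt (𝕜 := ℝ) (E := C(Icc 0 T, E)) (F := C(Icc 0 T, E))
        (primitiveCLM hT (u i) (hu i))).comp x ?_
      exact hasFDerivAt_superposition
        (f' := (⟨fderiv ℝ (f i), hfc i⟩ : C(E, E →L[ℝ] E)))
        (fun z => (((hf i).differentiable (by simp)) z).hasFDerivAt) x
    refine h2.congr_of_eventuallyEq (Eventually.of_forall fun y => ?_)
    simp [hG]
  have hG0 : G (0, x) = 0 := by
    simp only [hG, zero_smul, add_zero]
    rw [← hx, sub_self]
  have hinv : ((fderiv ℝ G (0, x)).comp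
      (ContinuousLinearMap.inr ℝ ℝ (C(Icc 0 T, E)))).IsInvertible := by
    rw [hderiv]
    obtain ⟨U, hU⟩ := hVunit
    exact ⟨ContinuousLinearEquiv.unitsEquiv ℝ _ U, by rw [← hU]; rfl⟩
  have hGat : ContDiffAt ℝ ∞ G (0, x) := hGs.contDiffAt
  refine ⟨hGat.implicitFunction (by simp) hinv, hGat.contDiffAt_implicitFunction (by simp) hinv,
    hGat.implicitFunction_apply_self (by simp) hinv, ?_⟩
  filter_upwards [hGat.eventually_apply_implicitFunction (by simp) hinv] with s hs
  rw [hG0] at hs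
  exact sub_eq_zero.1 hs

/-- The Taylor coefficients of the family of trajectories satisfy the variational equations. -/
theorem taylorSeq_family (hT : 0 ≤ T) {f : Fin l → C(E, E)} (hf : ∀ i, ContDiff ℝ ∞ (f i))
    {u v : Fin l → ℝ → ℝ} (hu : ∀ i, IntervalIntegrable (u i) volume 0 T)
    (hv : ∀ i, IntervalIntegrable (v i) volume 0 T) {x₀ : E} {ξ : ℝ → C(Icc 0 T, E)}
    (hξ : ContDiffAt ℝ ∞ ξ 0)
    (heq : ∀ᶠ s in 𝓝 0, ξ s = ContinuousMap.const _ x₀ +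
      (∑ i, primitiveCLM hT (u i) (hu i) ((f i).comp (ξ s)) +
        s • ∑ i, primitiveCLM hT (v i) (hv i) ((f i).comp (ξ s)))) (j : ℕ) (t : Icc 0 T) :
    IntervalIntegrable (fun τ => ∑ i,
      (u i τ • taylorSeq (fun s => f i (IccExtend hT (ξ s) τ)) (j + 1) +
        v i τ • taylorSeq (fun s => f i (IccExtend hT (ξ s) τ)) j)) volume 0 T ∧
    taylorSeq (fun s => ξ s t) (j + 1) = ∫ τ in 0..(t : ℝ), ∑ i,
      (u i τ • taylorSeq (fun s => f i (IccExtend hT (ξ s) τ)) (j + 1) +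
        v i τ • taylorSeq (fun s => f i (IccExtend hT (ξ s) τ)) j) := by
  have hg : ∀ i, ContDiffAt ℝ ∞ (fun s => (f i).comp (ξ s)) 0 := fun i =>
    (contDiff_superposition (f i) (hf i)).contDiffAt.comp 0 hξ
  set c : Fin l → ℕ → C(Icc 0 T, E) := fun i => taylorSeq fun s => (f i).comp (ξ s) with hc
  -- Both sides of the integral equation are expanded in the space of curves; the factor `s` shifts
  -- the coefficients of the `v`-terms by one.
  have hJ : ∀ m, HasJet ξ (fun j => (if j = 0 then ContinuousMap.const _ x₀ else 0) +
      (∑ i, primitiveCLM hT (u i) (hu i) (c i j) +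
        shiftJet (fun j => ∑ i, primitiveCLM hT (v i) (hv i) (c i j)) j)) m := fun m => by
    have h1 : ∀ (w : Fin l → ℝ → ℝ) (hw : ∀ i, IntervalIntegrable (w i) volume 0 T),
        HasJet (fun s => ∑ i, primitiveCLM hT (w i) (hw i) ((f i).comp (ξ s)))
          (fun j => ∑ i, primitiveCLM hT (w i) (hw i) (c i j)) m := fun w hw =>
      hasJet_sum _ fun i _ => (hasJet_taylorSeq (hg i)).clm_comp _
    exact ((hasJet_const _).add ((h1 u hu).add (h1 v hv).smul_id)).congr_fun
      (heq.mono fun s hs => hs.symm)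
  have h1 := HasJet.unique (hasJet_taylorSeq (m := j + 1) hξ) (hJ (j + 1)) (j + 1) le_rfl
  have hev : ∀ (i : Fin l) (k : ℕ) (τ : ℝ), taylorSeq (fun s => f i (IccExtend hT (ξ s) τ)) k =
      IccExtend hT (c i k) τ := fun i k τ =>
    taylorSeq_clm_comp (hg i) (ContinuousMap.evalCLM ℝ (projIcc 0 T hT τ)) k
  have hev' : taylorSeq (fun s => ξ s t) (j + 1) = taylorSeq ξ (j + 1) t :=
    taylorSeq_clm_comp hξ (ContinuousMap.evalCLM ℝ t) (j + 1)
  simp only [hev]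
  have hi : ∀ i, IntervalIntegrable (fun τ => u i τ • IccExtend hT (c i (j + 1)) τ +
      v i τ • IccExtend hT (c i j) τ) volume 0 T := fun i =>
    ((hu i).smul_continuousOn (c i (j + 1)).continuous.Icc_extend'.continuousOn).add
      ((hv i).smul_continuousOn (c i j).continuous.Icc_extend'.continuousOn)
  have hsub : uIcc 0 (t : ℝ) ⊆ uIcc 0 T := by
    rw [uIcc_of_le t.2.1, uIcc_of_le hT]; exact Icc_subset_Icc_right t.2.2
  refine ⟨by simpa only [Finset.sum_fn] using IntervalIntegrable.sum Finset.univ fun i _ => hi i,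
    ?_⟩
  rw [hev', h1, intervalIntegral.integral_finsetSum fun i _ => (hi i).mono_set hsub]
  simp only [Nat.add_eq_zero_iff, one_ne_zero, and_false, if_false, zero_add, shiftJet_succ,
    ← Finset.sum_add_distrib]
  rw [ContinuousMap.sum_apply]
  refine Finset.sum_congr rfl fun i _ => ?_
  rw [intervalIntegral.integral_add
    (((hu i).smul_continuousOn (c i (j + 1)).continuous.Icc_extend'.continuousOn).mono_set hsub)
    (((hv i).smul_continuousOn (c i j).continuous.Icc_extend'.continuousOn).mono_set hsub)]
  rfl

end Family

/-! ### The multinomial expansion of symmetric multilinear forms -/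

section Multinomial

/-- The multi-index counting how often each value is taken. -/
def fiberCount {r m : ℕ} (p : Fin r → Fin m) (i : Fin m) : ℕ := Fintype.card {a // p a = i}

theorem sum_fiberCount_mul {r m : ℕ} (p : Fin r → Fin m) (g : Fin m → ℕ) :
    ∑ i, g i * fiberCount p i = ∑ a, g (p a) := by
  rw [← Finset.sum_fiberwise Finset.univ p fun a => g (p a)]
  refine Finset.sum_congr rfl fun i _ => ?_
  rw [Finset.sum_congr rfl fun a ha => by rw [(Finset.mem_filter.1 ha).2], Finset.sum_const,
    fiberCount, Fintype.card_subtype, smul_eq_mul, mul_comm]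

theorem weight_fiberCount {r m : ℕ} (p : Fin r → Fin m) :
    weight (fiberCount p) = ∑ a, ((p a : ℕ) + 1) :=
  sum_fiberCount_mul p fun i => (i : ℕ) + 1

theorem sum_fiberCount {r m : ℕ} (p : Fin r → Fin m) : ∑ i, fiberCount p i = r := by
  simpa using sum_fiberCount_mul p fun _ => 1

theorem fiberCount_repeated {m : ℕ} (α : Fin m → ℕ) :
    fiberCount (fun j : Fin (∑ i, α i) => (finSigmaFinEquiv.symm j).1) = α := by
  ext i
  rw [fiberCount, Fintype.card_congr (finSigmaFinEquiv.symm.subtypeEquiv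
    (q := fun x : (i : Fin m) × Fin (α i) => x.1 = i) fun a => Iff.rfl),
    Fintype.card_congr (Equiv.sigmaSubtype i), Fintype.card_fin]

/-- Equal fibre sizes provide one permutation `σ₀` carrying `f₀` to `p`. The others form a coset of
the stabilizer of `f₀`, which permutes each fibre freely. -/
theorem card_comp_perm_eq {r m : ℕ} {f₀ p : Fin r → Fin m} (hp : fiberCount p = fiberCount f₀) :
    (Finset.univ.filter fun σ : Equiv.Perm (Fin r) => f₀ ∘ σ = p).card =
      ∏ i, (fiberCount f₀ i).factorial := by
  let σ₀ : Fin r ≃ Fin r := Equiv.ofFiberEquiv (f := p) (g := f₀) fun i =>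
    Fintype.equivOfCardEq (congrFun hp i)
  have hσ₀ : f₀ ∘ σ₀ = p := funext fun a => Equiv.ofFiberEquiv_map _ a
  refine Eq.trans ?_ (DomMulAct.stabilizer_card f₀)
  rw [← Fintype.card_subtype]
  refine Fintype.card_congr ((Equiv.mulRight σ₀⁻¹).subtypeEquiv fun σ => ?_)
  rw [← hσ₀]
  simp only [Equiv.coe_mulRight, Equiv.Perm.coe_mul, ← Function.comp_assoc]
  constructor
  · intro h
    rw [h, Function.comp_assoc]
    ext a; simp
  · intro h
    conv_rhs => rw [← h]
    rw [Function.comp_assoc]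
    ext a; simp

/-- In the sum of `g (f₀ ∘ σ)` over all permutations, each `p` with the fibre sizes of `f₀` occurs
`∏ (fiberCount f₀ i)!` times. This turns the factor `1 / r!` into `1 / α!`. -/
theorem sum_same_fibers {r m : ℕ} (f₀ : Fin r → Fin m) {g : (Fin r → Fin m) → ℝ}
    (hg : ∀ p (σ : Equiv.Perm (Fin r)), g (p ∘ σ) = g p) :
    (∏ i, ((fiberCount f₀ i).factorial : ℝ)) *
      ∑ p : Fin r → Fin m with fiberCount p = fiberCount f₀, g p = (r.factorial : ℝ) * g f₀ := by
  have h1 : ∑ σ : Equiv.Perm (Fin r), g (f₀ ∘ σ) = (r.factorial : ℝ) * g f₀ := by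
    simp [hg, Fintype.card_perm]
  have hmaps : ∀ σ ∈ (Finset.univ : Finset (Equiv.Perm (Fin r))),
      f₀ ∘ σ ∈ Finset.univ.filter fun p : Fin r → Fin m => fiberCount p = fiberCount f₀ :=
    fun σ _ => by
      refine Finset.mem_filter.2 ⟨Finset.mem_univ _, funext fun i => ?_⟩
      exact Fintype.card_congr (σ.subtypeEquiv fun a => Iff.rfl)
  rw [← h1, ← Finset.sum_fiberwise_of_maps_to hmaps, Finset.mul_sum]
  refine Finset.sum_congr rfl fun p hp => ?_
  rw [Finset.sum_congr rfl fun σ hσ => by rw [(Finset.mem_filter.1 hσ).2], Finset.sum_const,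
    nsmul_eq_mul, card_comp_perm_eq (Finset.mem_filter.1 hp).2]
  push_cast
  rfl

variable {n : ℕ}

theorem sum_fiberCount_eq {m : ℕ} (α : Fin m → ℕ) (Φ : (Vec n) [×(∑ i, α i)]→L[ℝ] ℝ)
    (hΦ : ∀ (σ : Equiv.Perm (Fin (∑ i, α i))) w, Φ (w ∘ σ) = Φ w) (b : Fin m → Vec n) :
    (((∑ i, α i).factorial : ℝ))⁻¹ *
      ∑ p : Fin (∑ i, α i) → Fin m with fiberCount p = α, Φ (b ∘ p) =
    (1 / ((∏ i, Nat.factorial (α i) : ℕ) : ℝ)) * Φ (repeated b α) := by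
  have h := sum_same_fibers (fun j : Fin (∑ i, α i) => (finSigmaFinEquiv.symm j).1)
    (g := fun p => Φ (b ∘ p)) fun p σ => hΦ σ (b ∘ p)
  rw [fiberCount_repeated] at h
  have e : (b ∘ fun j : Fin (∑ i, α i) => (finSigmaFinEquiv.symm j).1) = repeated b α := rfl
  rw [e] at h
  push_cast
  have h1 : (∏ i, ((α i).factorial : ℝ)) ≠ 0 := Finset.prod_ne_zero_iff.2 fun i _ => by positivity
  have h2 : (((∑ i, α i).factorial : ℝ)) ≠ 0 := by positivity
  rw [inv_mul_eq_iff_eq_mul₀ h2, mul_left_comm, ← h]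
  field_simp

/-- As `b 0 = 0`, only positive degrees contribute, and none exceeds `m`; the degree `d` corresponds
to the index `d - 1` in `Fin m`. -/
theorem mulJet_eq_sum_fin {r m : ℕ} (Φ : (Vec n) [×r]→L[ℝ] ℝ) {b : ℕ → Vec n} (hb : b 0 = 0) :
    mulJet Φ (fun _ => b) m =
      ∑ p : Fin r → Fin m with ∑ a, ((p a : ℕ) + 1) = m, Φ ((fun i : Fin m => b ((i : ℕ) + 1)) ∘ p) := by
  classical
  symm
  refine Finset.sum_of_injOn (fun p a => (p a : ℕ) + 1) ?_ ?_ ?_ ?_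
  · intro p _ p' _ h
    ext a
    simpa using congrFun h a
  · intro p hp
    simp only [Finset.coe_filter, Finset.mem_univ, true_and, mem_ofPred_eq] at hp
    simpa [Finset.Nat.mem_antidiagonalTuple] using hp
  · intro p hp hp'
    rw [Finset.Nat.mem_antidiagonalTuple] at hp
    by_contra hne
    have hpos : ∀ a, p a ≠ 0 := fun a ha => hne (Φ.map_coord_zero a (by simp [ha, hb]))
    refine hp' ⟨fun a => ⟨p a - 1, ?_⟩, ?_, ?_⟩
    · have h1 : p a ≤ m := hp ▸ Finset.single_le_sum (f := p) (fun _ _ => Nat.zero_le _)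
        (Finset.mem_univ a)
      have := hpos a
      omega
    · simp only [Finset.coe_filter, Finset.mem_univ, true_and, mem_ofPred_eq]
      rw [← hp]
      exact Finset.sum_congr rfl fun a _ => Nat.sub_add_cancel (Nat.pos_of_ne_zero (hpos a))
    · ext a
      exact Nat.sub_add_cancel (Nat.pos_of_ne_zero (hpos a))
  · intro p _
    rfl

/-- Grouping the degree tuples by how often each degree occurs gives the multi-indices of weight
`m`, and symmetry makes the terms of a group equal. The adapted coordinate thus becomes a
coefficient of a generating series. -/
theorem jetCoord_eq_sum_mulJet {Φ : (j : ℕ) → (Vec n) [×j]→L[ℝ] ℝ}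
    (hΦ : ∀ k, 1 ≤ k → ∀ (σ : Equiv.Perm (Fin k)) w, Φ k (w ∘ σ) = Φ k w) {b : ℕ → Vec n}
    (hb : b 0 = 0) (m : ℕ) :
    jetCoord Φ m (fun i => b ((i : ℕ) + 1)) =
      ∑ r ∈ Finset.range (m + 1), (r.factorial : ℝ)⁻¹ * mulJet (Φ r) (fun _ => b) m := by
  classical
  have hΦ' : ∀ k (σ : Equiv.Perm (Fin k)) w, Φ k (w ∘ σ) = Φ k w := by
    intro k σ w
    rcases Nat.eq_zero_or_pos k with rfl | hk
    · congr 1; exact Subsingleton.elim _ _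
    · exact hΦ k hk σ w
  set b' : Fin m → Vec n := fun i => b ((i : ℕ) + 1) with hb'
  have h1 : ∀ r, (r.factorial : ℝ)⁻¹ * mulJet (Φ r) (fun _ => b) m =
      ∑ α ∈ multiIndices m with ∑ i, α i = r,
        (1 / ((∏ i, Nat.factorial (α i) : ℕ) : ℝ)) * Φ (∑ i, α i) (repeated b' α) := by
    intro r
    rw [mulJet_eq_sum_fin (Φ r) hb, ← Finset.sum_fiberwise_of_maps_to
      (t := (multiIndices m).filter fun α => ∑ i, α i = r) (g := fiberCount), Finset.mul_sum]
    · refine Finset.sum_congr rfl fun α hα => ?_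
      rw [Finset.mem_filter, mem_multiIndices] at hα
      obtain ⟨hw, rfl⟩ := hα
      rw [← sum_fiberCount_eq α (Φ _) (hΦ' _) b', Finset.filter_filter]
      congr 2
      ext p
      simp only [Finset.mem_filter, Finset.mem_univ, true_and, and_iff_right_iff_imp]
      intro hp
      rw [← weight_fiberCount, hp, hw]
    · intro p hp
      rw [Finset.mem_filter, mem_multiIndices, weight_fiberCount, sum_fiberCount]
      exact ⟨(Finset.mem_filter.1 hp).2, rfl⟩
  rw [Finset.sum_congr rfl fun r _ => h1 r, Finset.sum_fiberwise_of_maps_to]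
  · rfl
  · intro α hα
    rw [mem_multiIndices] at hα
    refine Finset.mem_range.2 (Nat.lt_succ_of_le (le_of_le_of_eq ?_ hα))
    exact Finset.sum_le_sum fun i _ => by nlinarith [Nat.zero_le ((i : ℕ) * α i)]

end Multinomial

/-! ### Uniqueness of Carathéodory solutions and cut-offs in a vector space -/

section VectorSpace

variable {E : Type*} [NormedAddCommGroup E] [NormedSpace ℝ E] {l : ℕ}

theorem intervalIntegrable_sum_smul {a b : ℝ} {v : Fin l → ℝ → ℝ} {g : Fin l → ℝ → E}
    (hv : ∀ i, IntervalIntegrable (v i) volume a b) (hg : ∀ i, ContinuousOn (g i) (uIcc a b)) :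
    IntervalIntegrable (fun t => ∑ i, v i t • g i t) volume a b := by
  simpa only [Finset.sum_fn] using
    IntervalIntegrable.sum Finset.univ fun i _ => (hv i).smul_continuousOn (hg i)

/-- Both curves lie in a compact part of `U`, where the fields are Lipschitz; Gronwall applies to
the difference with rate `∑ |v i| L i`. -/
theorem caratheodory_unique [CompleteSpace E] {a b : ℝ} (hab : a ≤ b) {U : Set E} (hU : IsOpen U)
    {f : Fin l → E → E}
    (hf : ∀ i, ContDiffOn ℝ 1 (f i) U) {v : Fin l → ℝ → ℝ}
    (hv : ∀ i, IntervalIntegrable (v i) volume a b) {y z : ℝ → E}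
    (hy : AbsolutelyContinuousOnInterval y a b) (hz : AbsolutelyContinuousOnInterval z a b)
    (hyU : MapsTo y (Icc a b) U) (hzU : MapsTo z (Icc a b) U) (h0 : y a = z a)
    (hy' : ∀ᵐ t, t ∈ Icc a b → HasDerivAt y (∑ i, v i t • f i (y t)) t)
    (hz' : ∀ᵐ t, t ∈ Icc a b → HasDerivAt z (∑ i, v i t • f i (z t)) t) :
    EqOn y z (Icc a b) := by
  have huI : uIcc a b = Icc a b := uIcc_of_le hab
  have hyc : ContinuousOn y (Icc a b) := huI ▸ hy.continuousOn
  have hzc : ContinuousOn z (Icc a b) := huI ▸ hz.continuousOn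
  set K := y '' Icc a b ∪ z '' Icc a b with hK
  have hKc : IsCompact K :=
    (isCompact_Icc.image_of_continuousOn hyc).union (isCompact_Icc.image_of_continuousOn hzc)
  have hKU : K ⊆ U := union_subset hyU.image_subset hzU.image_subset
  have hL : ∀ i, ∃ L, LipschitzOnWith L (f i) K := fun i => by
    refine LocallyLipschitzOn.exists_lipschitzOnWith_of_compact hKc fun x hx => ?_
    obtain ⟨L, s, hs, hL⟩ :=
      ((hf i).contDiffAt (hU.mem_nhds (hKU hx))).exists_lipschitzOnWith
    exact ⟨L, s, mem_nhdsWithin_of_mem_nhds hs, hL⟩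
  choose L hL using hL
  have hyK : ∀ t ∈ Icc a b, y t ∈ K := fun t ht => Or.inl (mem_image_of_mem _ ht)
  have hzK : ∀ t ∈ Icc a b, z t ∈ K := fun t ht => Or.inr (mem_image_of_mem _ ht)
  have hiy : IntervalIntegrable (fun t => ∑ i, v i t • f i (y t)) volume a b :=
    intervalIntegrable_sum_smul hv fun i => huI ▸ (hf i).continuousOn.comp hyc hyU
  have hiz : IntervalIntegrable (fun t => ∑ i, v i t • f i (z t)) volume a b :=
    intervalIntegrable_sum_smul hv fun i => huI ▸ (hf i).continuousOn.comp hzc hzU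
  have hk : IntervalIntegrable (fun t => ∑ i, |v i t| * (L i : ℝ)) volume a b := by
    simpa only [Finset.sum_fn] using
      IntervalIntegrable.sum Finset.univ fun i _ => (hv i).abs.mul_const (L i : ℝ)
  have hw := eq_zero_of_norm_le_integral hab hk
    (fun t => Finset.sum_nonneg fun i _ => by positivity) (y := fun t => y t - z t)
    (hyc.sub hzc) fun t ht => by
      have hat : uIcc a t ⊆ uIcc a b := by
        rw [uIcc_of_le ht.1, huI]; exact Icc_subset_Icc_right ht.2
      have ht' : t ∈ uIcc a b := huI ▸ ht
      rw [absCont_eq_add_integral hy hiy (huI.symm ▸ hy') left_mem_uIcc ht',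
        absCont_eq_add_integral hz hiz (huI.symm ▸ hz') left_mem_uIcc ht', h0,
        add_sub_add_left_eq_sub,
        ← intervalIntegral.integral_sub (hiy.mono_set hat) (hiz.mono_set hat)]
      refine (intervalIntegral.norm_integral_le_integral_norm ht.1).trans ?_
      refine intervalIntegral.integral_mono_on ht.1
        ((hiy.mono_set hat).sub (hiz.mono_set hat)).norm ?_ fun τ hτ => ?_
      · refine (hk.mono_set hat).mul_continuousOn ?_
        rw [huI] at hat
        exact ((hyc.sub hzc).mono hat).norm
      · have hτ' : τ ∈ Icc a b := ⟨hτ.1, hτ.2.trans ht.2⟩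
        rw [← Finset.sum_sub_distrib, Finset.sum_mul]
        refine norm_sum_le_of_le _ fun i _ => ?_
        rw [← smul_sub, norm_smul, Real.norm_eq_abs, mul_assoc, ← dist_eq_norm, ← dist_eq_norm]
        exact mul_le_mul_of_nonneg_left ((hL i).dist_le_mul _ (hyK τ hτ') _ (hzK τ hτ'))
          (abs_nonneg _)
  exact fun t ht => sub_eq_zero.1 (hw t ht)

/-- Superposition on all continuous curves needs globally defined fields. Agreement on a
neighbourhood of `K`, not just on `K`, preserves all derivatives along the trajectory. -/
theorem exists_contDiff_eq_nhdsSet [FiniteDimensional ℝ E] {F : Type*} [NormedAddCommGroup F]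
    [NormedSpace ℝ F] {f : E → F} {U K : Set E} (hU : IsOpen U) (hK : IsClosed K) (hKU : K ⊆ U)
    (hf : ContDiffOn ℝ ∞ f U) : ∃ g : E → F, ContDiff ℝ ∞ g ∧ ∀ᶠ x in 𝓝ˢ K, g x = f x := by
  obtain ⟨χ, h0, h1, -⟩ := exists_contMDiffMap_zero_one_nhds_of_isClosed (n := ⊤) 𝓘(ℝ, E)
    hU.isClosed_compl hK (disjoint_compl_left_iff_subset.2 hKU)
  have hχ : ContDiff ℝ ∞ χ := χ.contMDiff.contDiff
  refine ⟨fun x => χ x • f x, contDiff_iff_contDiffAt.2 fun x => ?_, h1.mono fun x hx => ?_⟩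
  · by_cases hx : x ∈ U
    · exact hχ.contDiffAt.smul (hf.contDiffAt (hU.mem_nhds hx))
    · have hz : (fun x => χ x • f x) =ᶠ[𝓝 x] fun _ => 0 :=
        (eventually_nhdsSet_iff_forall.1 h0 x hx).mono fun z hz => by simp only [hz, zero_smul]
      exact contDiffAt_const.congr_of_eventuallyEq hz
  · simp only [hx, one_smul]

end VectorSpace

/-! ### Trajectories in a chart -/

section Chart

variable {n l : ℕ} {M : Type*} [TopologicalSpace M] [ChartedSpace (EuclideanSpace ℝ (Fin n)) M]
  {e : OpenPartialHomeomorph M (EuclideanSpace ℝ (Fin n))}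
  {X : Fin l → (x : M) → TangentSpace (𝓡 n) x} {T : ℝ} {q₀ : M} {v : ℝ → Fin l → ℝ}

theorem contDiffOn_inChart [IsManifold (𝓡 n) ∞ M] (he : e ∈ IsManifold.maximalAtlas (𝓡 n) ∞ M)
    {Z : (x : M) → TangentSpace (𝓡 n) x}
    (hZ : ContMDiff (𝓡 n) (𝓡 n).tangent ∞ fun x => (⟨x, Z x⟩ : TangentBundle (𝓡 n) M)) :
    ContDiffOn ℝ ∞ (inChart e Z) e.target := by
  have : IsManifold (𝓡 n) 1 M := IsManifold.of_le (n := ∞) (by simp)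
  have h1 := (contMDiffOn_of_mem_maximalAtlas he).contMDiffOn_tangentMapWithin (m := ∞)
    (by simp) e.open_source.uniqueMDiffOn
  have h2 : ContMDiffOn (𝓡 n) (𝓡 n).tangent ∞
      (fun y => (⟨e.symm y, Z (e.symm y)⟩ : TangentBundle (𝓡 n) M)) e.target :=
    hZ.comp_contMDiffOn (contMDiffOn_symm_of_mem_maximalAtlas he)
  have h3 := h1.comp h2 fun y hy => e.map_target hy
  refine (contMDiffOn_vectorSpace_iff_contDiffOn (𝕜 := ℝ) (E := Vec n)).1 ?_
  refine h3.congr fun y hy => ?_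
  have h4 := e.map_target hy
  simp only [Function.comp, tangentMapWithin, inChart]
  rw [mfderivWithin_of_isOpen e.open_source h4]
  congr 1
  exact (e.right_inv hy).symm

theorem IsTrajectory.ae_hasDerivAt_chart (he : e ∈ IsManifold.maximalAtlas (𝓡 n) ∞ M) {q : ℝ → M}
    (hq : IsTrajectory X T q₀ v q) : ∀ᵐ t, t ∈ Icc 0 T → q t ∈ e.source →
      HasDerivAt (fun t => e (q t)) (∑ i, v t i • inChart e (X i) (e (q t))) t := by
  have h := hq.deriv
  rw [ae_restrict_iff' measurableSet_Icc] at h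
  filter_upwards [h] with t ht htT hs
  have h1 : HasMFDerivAt (𝓡 n) 𝓘(ℝ, Vec n) e (q t) (mfderiv (𝓡 n) 𝓘(ℝ, Vec n) e (q t)) :=
    ((contMDiffAt_of_mem_maximalAtlas he hs).mdifferentiableAt (by simp)).hasMFDerivAt
  let D : Vec n →L[ℝ] Vec n := mfderiv (𝓡 n) 𝓘(ℝ, Vec n) e (q t)
  let x : Fin l → Vec n := fun i => X i (q t)
  have h2 : HasFDerivAt (fun t => e (q t))
      (D.comp ((1 : ℝ →L[ℝ] ℝ).smulRight (∑ i, v t i • x i))) t :=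
    (h1.comp t (ht htT)).hasFDerivAt
  have hx : ∀ i, inChart e (X i) (e (q t)) = D (x i) := fun i => by
    rw [inChart, e.left_inv hs]; rfl
  refine h2.hasDerivAt.congr_deriv ?_
  simp [hx]

theorem isTrajectory_of_chart (he : e ∈ IsManifold.maximalAtlas (𝓡 n) ∞ M)
    (hT : 0 ≤ T) (hq₀ : q₀ ∈ e.source) {y : ℝ → Vec n}
    (hy : AbsolutelyContinuousOnInterval y 0 T) (hy0 : y 0 = e q₀)
    (hyt : MapsTo y (Icc 0 T) e.target)
    (hd : ∀ᵐ t, t ∈ Icc 0 T → HasDerivAt y (∑ i, v t i • inChart e (X i) (y t)) t) :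
    IsTrajectory X T q₀ v (fun t => e.symm (y t)) where
  initial := by rw [hy0, e.left_inv hq₀]
  continuousOn := e.continuousOn_symm.comp (uIcc_of_le hT ▸ hy.continuousOn) hyt
  absCont e' he' a b ha hab hb hm := by
    have hsub : Icc a b ⊆ Icc 0 T := Icc_subset_Icc ha hb
    have hy' : AbsolutelyContinuousOnInterval y a b :=
      hy.mono (by rwa [uIcc_of_le hab, uIcc_of_le hT])
    refine absCont_contDiffAt_comp (f := fun x => e' (e.symm x)) hy' fun t ht => ?_
    rw [uIcc_of_le hab] at ht
    have h1 := contMDiffAt_symm_of_mem_maximalAtlas he (hyt (hsub ht))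
    have h2 := contMDiffAt_of_mem_maximalAtlas he' (hm ht)
    exact ((h2.comp (y t) h1).contDiffAt).of_le (by simp)
  deriv := by
    rw [ae_restrict_iff' measurableSet_Icc]
    filter_upwards [hd] with t ht htT
    have hyT := hyt htT
    have hs := e.map_target hyT
    have h1 : HasMFDerivAt 𝓘(ℝ, Vec n) (𝓡 n) e.symm (y t)
        (mfderiv 𝓘(ℝ, Vec n) (𝓡 n) e.symm (y t)) :=
      ((contMDiffAt_symm_of_mem_maximalAtlas he hyT).mdifferentiableAt (by simp)).hasMFDerivAt
    have h0 : HasMFDerivAt (𝓡 n) 𝓘(ℝ, Vec n) e (e.symm (y t))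
        (mfderiv (𝓡 n) 𝓘(ℝ, Vec n) e (e.symm (y t))) :=
      ((contMDiffAt_of_mem_maximalAtlas he hs).mdifferentiableAt (by simp)).hasMFDerivAt
    have h1' : HasMFDerivAt 𝓘(ℝ, Vec n) (𝓡 n) e.symm (e (e.symm (y t)))
        (mfderiv 𝓘(ℝ, Vec n) (𝓡 n) e.symm (y t)) := by
      rw [e.right_inv hyT]; exact h1
    have h4 : HasMFDerivAt (𝓡 n) (𝓡 n) (e.symm ∘ e) (e.symm (y t))
        (ContinuousLinearMap.id ℝ (TangentSpace (𝓡 n) (e.symm (y t)))) := by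
      refine (hasMFDerivAt_id (I := 𝓡 n) (e.symm (y t))).congr_of_eventuallyEq ?_
      filter_upwards [e.open_source.mem_nhds hs] with x hx
      exact e.left_inv hx
    let D : Vec n →L[ℝ] Vec n := mfderiv 𝓘(ℝ, Vec n) (𝓡 n) e.symm (y t)
    let D' : Vec n →L[ℝ] Vec n := mfderiv (𝓡 n) 𝓘(ℝ, Vec n) e (e.symm (y t))
    -- `e.symm ∘ e` is the identity near the point, so the derivative of `e.symm` undoes the chart
    -- representation of the fields.
    have h5 : D.comp D' = ContinuousLinearMap.id ℝ (Vec n) :=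
      hasMFDerivAt_unique (h1'.comp (e.symm (y t)) h0) h4
    let x : Fin l → Vec n := fun i => X i (e.symm (y t))
    have h2 := h1.comp t ((ht htT).hasFDerivAt.hasMFDerivAt)
    have h6 : D.comp (ContinuousLinearMap.toSpanSingleton ℝ (∑ i, v t i • D' (x i))) =
        (1 : ℝ →L[ℝ] ℝ).smulRight (∑ i, v t i • x i) := by
      ext1
      have h7 : ∀ w, D (D' w) = w := fun w => congrArg (fun L => L w) h5
      simp [h7]
    exact h6 ▸ h2

/-- `endpoint` picks an arbitrary trajectory, which might leave the chart, so only `q` is assumed to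
stay in it. The coincidence set is closed because `M` is Hausdorff. At a coincidence time `q'` is in
the chart and stays there for a while, so uniqueness in the chart extends the coincidence to the
right. -/
theorem IsTrajectory.eqOn [T2Space M] [IsManifold (𝓡 n) ∞ M]
    (he : e ∈ IsManifold.maximalAtlas (𝓡 n) ∞ M)
    (hX : ∀ i, ContMDiff (𝓡 n) (𝓡 n).tangent ∞ fun x => (⟨x, X i x⟩ : TangentBundle (𝓡 n) M))
    (hT : 0 ≤ T) (hv : ∀ i, IntervalIntegrable (fun t => v t i) volume 0 T) {q q' : ℝ → M}
    (hq : IsTrajectory X T q₀ v q) (hqe : MapsTo q (Icc 0 T) e.source)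
    (hq' : IsTrajectory X T q₀ v q') : EqOn q q' (Icc 0 T) := by
  have hclosed : IsClosed ({t | q t = q' t} ∩ Icc 0 T) := by
    have := (hq.continuousOn.prodMk hq'.continuousOn).preimage_isClosed_of_isClosed isClosed_Icc
      isClosed_diagonal
    rw [inter_comm]
    exact this
  refine hclosed.Icc_subset_of_forall_exists_gt (by
    rw [mem_ofPred_eq, hq.initial, hq'.initial]) ?_
  rintro t ⟨hteq, ht⟩ s hs
  have htq' : q' t ∈ e.source := by
    rw [mem_ofPred_eq] at hteq
    exact hteq ▸ hqe (Ico_subset_Icc_self ht)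
  have hnhds : q' ⁻¹' e.source ∈ 𝓝[Icc t T] t := by
    have h1 := (hq'.continuousOn t (Ico_subset_Icc_self ht)).mono (Icc_subset_Icc_left ht.1)
    exact h1 (e.open_source.mem_nhds htq')
  rw [mem_nhdsWithin] at hnhds
  obtain ⟨O, hO, htO, hOs⟩ := hnhds
  obtain ⟨c, hc, hcO⟩ := (nhdsGE_basis_Icc (a := t)).mem_iff.1
    (mem_nhdsWithin_of_mem_nhds (hO.mem_nhds htO))
  -- Up to `c` the curve `q'` is in the chart; the bound `s` is demanded by the continuation
  -- criterion.
  set d := min c (min s T) with hd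
  have htd : t < d := lt_min hc (lt_min hs ht.2)
  have hdT : d ≤ T := (min_le_right _ _).trans (min_le_right _ _)
  have hsub : Icc t d ⊆ Icc 0 T := Icc_subset_Icc ht.1 hdT
  have hq'e : MapsTo q' (Icc t d) e.source := fun τ hτ =>
    hOs ⟨hcO ⟨hτ.1, hτ.2.trans (min_le_left _ _)⟩, ⟨hτ.1, hτ.2.trans hdT⟩⟩
  have hqe' : MapsTo q (Icc t d) e.source := fun τ hτ => hqe (hsub hτ)
  have key := caratheodory_unique htd.le e.open_target
    (fun i => (contDiffOn_inChart he (hX i)).of_le (by simp))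
    (fun i => (hv i).mono_set (by rwa [uIcc_of_le htd.le, uIcc_of_le hT]))
    (hq.absCont e he t d ht.1 htd.le hdT hqe') (hq'.absCont e he t d ht.1 htd.le hdT hq'e)
    (fun τ hτ => e.map_source (hqe' hτ)) (fun τ hτ => e.map_source (hq'e hτ))
    (congrArg e hteq)
    ((hq.ae_hasDerivAt_chart he).mono fun τ h hτ => h (hsub hτ) (hqe' hτ))
    ((hq'.ae_hasDerivAt_chart he).mono fun τ h hτ => h (hsub hτ) (hq'e hτ))
  have hd' : d ∈ Icc t d := right_mem_Icc.2 htd.le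
  refine ⟨d, e.injOn (hqe' hd') (hq'e hd') (key hd'), htd, ?_⟩
  exact (min_le_right _ _).trans (min_le_left _ _)

theorem endpoint_eq [T2Space M] [IsManifold (𝓡 n) ∞ M]
    (he : e ∈ IsManifold.maximalAtlas (𝓡 n) ∞ M)
    (hX : ∀ i, ContMDiff (𝓡 n) (𝓡 n).tangent ∞ fun x => (⟨x, X i x⟩ : TangentBundle (𝓡 n) M))
    (hT : 0 ≤ T) (hv : ∀ i, IntervalIntegrable (fun t => v t i) volume 0 T) {q : ℝ → M}
    (hq : IsTrajectory X T q₀ v q) (hqe : MapsTo q (Icc 0 T) e.source) {t : ℝ}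
    (ht : t ∈ Icc 0 T) : endpoint X T q₀ v t = q t := by
  have h : ∃ q : ℝ → M, IsTrajectory X T q₀ v q := ⟨q, hq⟩
  rw [endpoint, dif_pos h]
  exact (hq.eqOn he hX hT hv hqe h.choose_spec ht).symm

end Chart

/-- The identity is known only on `[0, T]`, so the endpoints, where a two-sided derivative could
fail, are discarded as a null set. -/
theorem absCont_and_ae_hasDerivAt_of_eq_integral {E : Type*} [NormedAddCommGroup E]
    [NormedSpace ℝ E] [CompleteSpace E] {T : ℝ} (hT : 0 ≤ T) {y G : ℝ → E} {c : E}
    (hG : IntervalIntegrable G volume 0 T) (hy : ∀ t ∈ Icc 0 T, y t = c + ∫ τ in 0..t, G τ) :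
    AbsolutelyContinuousOnInterval y 0 T ∧ ∀ᵐ t, t ∈ Icc 0 T → HasDerivAt y (G t) t := by
  have huI : uIcc 0 T = Icc 0 T := uIcc_of_le hT
  refine ⟨absCont_congr ((absCont_const c).add (absCont_intervalIntegral hG left_mem_uIcc))
    fun t ht => (hy t (huI ▸ ht)).symm, ?_⟩
  have h0 : ∀ᵐ t : ℝ, t ≠ 0 := by simp [ae_iff, measure_singleton]
  have h1 : ∀ᵐ t : ℝ, t ≠ T := by simp [ae_iff, measure_singleton]
  filter_upwards [hG.ae_hasDerivAt_integral, h0, h1] with t ht h0 h1 htT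
  have h2 := (ht (huI.symm ▸ htT) 0 left_mem_uIcc).const_add c
  refine h2.congr_of_eventuallyEq ?_
  filter_upwards [Icc_mem_nhds (lt_of_le_of_ne htT.1 h0.symm) (lt_of_le_of_ne htT.2 h1)]
    with s hs using hy s hs

/-! ### Taylor coefficients of the end-point map -/

section Variation

variable {n l : ℕ} {M : Type*} [TopologicalSpace M] [ChartedSpace (EuclideanSpace ℝ (Fin n)) M]

/-- The Taylor coefficients of `s ↦ End^t(u + s Δu) - End^t(u)` in the coordinates `e`. -/
def variationJet (e : OpenPartialHomeomorph M (EuclideanSpace ℝ (Fin n)))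
    (X : Fin l → (x : M) → TangentSpace (𝓡 n) x) (T : ℝ) (q₀ : M)
    (u Δu : ℝ → Fin l → ℝ) (t : ℝ) (j : ℕ) : Vec n :=
  if j = 0 then 0 else taylorCoeff e X T q₀ u Δu j t

variable [T2Space M] [IsManifold (𝓡 n) ∞ M]
  {e : OpenPartialHomeomorph M (EuclideanSpace ℝ (Fin n))}
  {X : Fin l → (x : M) → TangentSpace (𝓡 n) x} {T : ℝ} {q₀ : M} {u : ℝ → Fin l → ℝ} {q : ℝ → M}
  {g : Fin l → Vec n → Vec n}

/-- The family `ξ` is built for the cut-off fields `g`. For small `s` it is uniformly close to the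
base curve, hence stays where `g` agrees with the given fields, and its curves are trajectories on
`M`; uniqueness identifies them with `endpoint`. -/
theorem variation_family (he : e ∈ IsManifold.maximalAtlas (𝓡 n) ∞ M)
    (hX : ∀ i, ContMDiff (𝓡 n) (𝓡 n).tangent ∞ fun x => (⟨x, X i x⟩ : TangentBundle (𝓡 n) M))
    (hT : 0 ≤ T) (hu : ∀ i, IntervalIntegrable (fun t => u t i) volume 0 T)
    (hq : IsTrajectory X T q₀ u q) (hqe : MapsTo q (Icc 0 T) e.source)
    (hg : ∀ i, ContDiff ℝ ∞ (g i))
    (hgX : ∀ᶠ x in 𝓝ˢ ((fun t => e (q t)) '' Icc 0 T), ∀ i, g i x = inChart e (X i) x)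
    {Δu : ℝ → Fin l → ℝ} (hΔu : ∀ i, IntervalIntegrable (fun t => Δu t i) volume 0 T) :
    (∀ᶠ s in 𝓝 (0 : ℝ), ∃ qs : ℝ → M,
      IsTrajectory X T q₀ (u + s • Δu) qs ∧ MapsTo qs (Icc 0 T) e.source) ∧
    ∃ ξ : ℝ → C(Icc 0 T, Vec n), ContDiffAt ℝ ∞ ξ 0 ∧ (∀ t : Icc 0 T, ξ 0 t = e (q t)) ∧
      (∀ᶠ s in 𝓝 (0 : ℝ), ∀ t : Icc 0 T, variation e X T q₀ u Δu t s = ξ s t) ∧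
      ∀ᶠ s in 𝓝 0, ξ s = ContinuousMap.const _ (e q₀) +
        (∑ i, primitiveCLM hT (fun t => u t i) (hu i)
          ((⟨g i, (hg i).continuous⟩ : C(Vec n, Vec n)).comp (ξ s)) +
        s • ∑ i, primitiveCLM hT (fun t => Δu t i) (hΔu i)
          ((⟨g i, (hg i).continuous⟩ : C(Vec n, Vec n)).comp (ξ s))) := by
  have h0T : (0 : ℝ) ∈ Icc 0 T := left_mem_Icc.2 hT
  have huI : uIcc 0 T = Icc 0 T := uIcc_of_le hT
  have hq₀ : q₀ ∈ e.source := hq.initial ▸ hqe h0T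
  have hac : AbsolutelyContinuousOnInterval (fun t => e (q t)) 0 T :=
    hq.absCont e he 0 T le_rfl hT le_rfl hqe
  have hcont : ContinuousOn (fun t => e (q t)) (Icc 0 T) := huI ▸ hac.continuousOn
  set f : Fin l → C(Vec n, Vec n) := fun i => ⟨g i, (hg i).continuous⟩ with hf
  set x : C(Icc 0 T, Vec n) := ⟨fun t => e (q t), hcont.domRestrict⟩ with hx
  set K : Set (Vec n) := (fun t => e (q t)) '' Icc 0 T with hK
  have hKc : IsCompact K := isCompact_Icc.image_of_continuousOn hcont
  have hsub : ∀ t : Icc 0 T, uIcc 0 (t : ℝ) ⊆ uIcc 0 T := fun t => by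
    rw [uIcc_of_le t.2.1, huI]; exact Icc_subset_Icc_right t.2.2
  have hint : ∀ (h : C(Icc 0 T, Vec n)) (w : ℝ → Fin l → ℝ),
      (∀ i, IntervalIntegrable (fun t => w t i) volume 0 T) → ∀ i,
      IntervalIntegrable (fun τ => w τ i • g i (IccExtend hT h τ)) volume 0 T := fun h w hw i =>
    (hw i).smul_continuousOn
      ((hg i).continuous.comp h.continuous.Icc_extend').continuousOn
  have hprim : ∀ (h : C(Icc 0 T, Vec n)) (w : ℝ → Fin l → ℝ)
      (hw : ∀ i, IntervalIntegrable (fun t => w t i) volume 0 T) (t : Icc 0 T),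
      (∑ i, primitiveCLM hT (fun t => w t i) (hw i) ((f i).comp h)) t =
        ∫ τ in 0..(t : ℝ), ∑ i, w τ i • g i (IccExtend hT h τ) := fun h w hw t => by
    rw [ContinuousMap.sum_apply, intervalIntegral.integral_finsetSum
      fun i _ => (hint h w hw i).mono_set (hsub t)]
    rfl
  have hsumint : ∀ (h : C(Icc 0 T, Vec n)) (w : ℝ → Fin l → ℝ),
      (∀ i, IntervalIntegrable (fun t => w t i) volume 0 T) →
      IntervalIntegrable (fun τ => ∑ i, w τ i • g i (IccExtend hT h τ)) volume 0 T :=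
    fun h w hw => by
      simpa only [Finset.sum_fn] using IntervalIntegrable.sum Finset.univ fun i _ => hint h w hw i
  have hxeq : x = ContinuousMap.const _ (e q₀) +
      ∑ i, primitiveCLM hT (fun t => u t i) (hu i) ((f i).comp x) := by
    ext1 t
    rw [ContinuousMap.add_apply, hprim x u hu t, ContinuousMap.const_apply, ← hq.initial]
    refine absCont_eq_add_integral hac (hsumint x u hu) ?_ left_mem_uIcc (huI.symm ▸ t.2)
    filter_upwards [hq.ae_hasDerivAt_chart he] with τ hτ hτT
    rw [huI] at hτT
    refine (hτ hτT (hqe hτT)).congr_deriv (Finset.sum_congr rfl fun i _ => ?_)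
    rw [IccExtend_of_mem _ _ hτT]
    congr 1
    exact (hgX.self_of_nhdsSet (e (q τ)) (mem_image_of_mem _ hτT) i).symm
  obtain ⟨ξ, hξ, hξ0, hξeq⟩ := exists_smooth_family hT (f := f) hg hu hΔu (e q₀) hxeq
  have hW : ∃ W : Set (Vec n), IsOpen W ∧ K ⊆ W ∧ W ⊆ e.target ∧
      ∀ y ∈ W, ∀ i, g i y = inChart e (X i) y := by
    obtain ⟨W, hWo, hKW, hW⟩ := mem_nhdsSet_iff_exists.1 hgX
    refine ⟨W ∩ e.target, hWo.inter e.open_target, subset_inter hKW ?_, inter_subset_right,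
      fun y hy => hW hy.1⟩
    rintro _ ⟨t, ht, rfl⟩
    exact e.map_source (hqe ht)
  obtain ⟨W, hWo, hKW, hWt, hWg⟩ := hW
  obtain ⟨δ, hδ, hthick⟩ := hKc.exists_thickening_subset_open hWo hKW
  -- Continuity of `ξ` in the sup norm makes the choice of `s` uniform in `t`.
  have hnear : ∀ᶠ s in 𝓝 (0 : ℝ), ∀ t : Icc 0 T, ξ s t ∈ W := by
    have h1 : Tendsto ξ (𝓝 0) (𝓝 x) := hξ0 ▸ hξ.continuousAt
    filter_upwards [h1.eventually (Metric.ball_mem_nhds x hδ)] with s hs t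
    refine hthick (Metric.mem_thickening_iff.2 ⟨e (q t), mem_image_of_mem _ t.2, ?_⟩)
    exact (ContinuousMap.dist_apply_le_dist (f := ξ s) (g := x) t).trans_lt hs
  have hadd : ∀ s : ℝ, ∀ i, IntervalIntegrable (fun t => (u + s • Δu) t i) volume 0 T :=
    fun s i => (hu i).add ((hΔu i).const_mul s)
  have htraj : ∀ᶠ s in 𝓝 (0 : ℝ),
      IsTrajectory X T q₀ (u + s • Δu) (fun t => e.symm (IccExtend hT (ξ s) t)) ∧
      MapsTo (fun t => e.symm (IccExtend hT (ξ s) t)) (Icc 0 T) e.source ∧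
      ∀ t : Icc 0 T, ξ s t ∈ e.target := by
    filter_upwards [hnear, hξeq] with s hs heq
    have hy : ∀ t ∈ Icc 0 T, IccExtend hT (ξ s) t = e q₀ +
        ∫ τ in 0..t, ∑ i, (u + s • Δu) τ i • g i (IccExtend hT (ξ s) τ) := by
      intro t ht
      have h1 := congrArg (fun h : C(Icc 0 T, Vec n) => h ⟨t, ht⟩) heq
      simp only [ContinuousMap.add_apply, ContinuousMap.smul_apply, hprim,
        ContinuousMap.const_apply] at h1
      have hA : IntervalIntegrable (fun τ => ∑ i, u τ i • g i (IccExtend hT (ξ s) τ))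
          volume 0 t := (hsumint (ξ s) u hu).mono_set (hsub ⟨t, ht⟩)
      have hB : IntervalIntegrable (fun τ => s • ∑ i, Δu τ i • g i (IccExtend hT (ξ s) τ))
          volume 0 t := ((hsumint (ξ s) Δu hΔu).mono_set (hsub ⟨t, ht⟩)).smul s
      rw [IccExtend_of_mem _ _ ht, h1, ← intervalIntegral.integral_smul,
        ← intervalIntegral.integral_add hA hB]
      congr 1
      refine intervalIntegral.integral_congr fun τ _ => ?_
      simp only [Finset.smul_sum, ← Finset.sum_add_distrib, Pi.add_apply, Pi.smul_apply, add_smul,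
        smul_eq_mul, mul_smul]
    obtain ⟨hyac, hyd⟩ :=
      absCont_and_ae_hasDerivAt_of_eq_integral hT (hsumint (ξ s) _ (hadd s)) hy
    have htgt : MapsTo (IccExtend hT (ξ s)) (Icc 0 T) e.target := fun t ht => by
      rw [IccExtend_of_mem _ _ ht]; exact hWt (hs _)
    refine ⟨isTrajectory_of_chart he hT hq₀ hyac ?_ htgt ?_, fun t ht => e.map_target (htgt ht),
      fun t => hWt (hs t)⟩
    · rw [hy 0 h0T]; simp
    · filter_upwards [hyd] with t ht htT
      refine (ht htT).congr_deriv (Finset.sum_congr rfl fun i _ => ?_)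
      rw [IccExtend_of_mem _ _ htT, hWg _ (hs _)]
  refine ⟨htraj.mono fun s hs => ⟨_, hs.1, hs.2.1⟩, ξ, hξ, fun t => by rw [hξ0]; rfl, ?_, hξeq⟩
  filter_upwards [htraj] with s hs t
  rw [variation, endpoint_eq he hX hT (hadd s) hs.1 hs.2.1 t.2, IccExtend_of_mem _ _ t.2,
    e.right_inv (hs.2.2 _)]

/-- The expansion of `g i` along `ξ s t` has the coefficients `compJet` by uniqueness of jets.
Inserted in the expanded integral equation, they give the variational equations. -/
theorem contDiffAt_variation_and_variationJet (he : e ∈ IsManifold.maximalAtlas (𝓡 n) ∞ M)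
    (hX : ∀ i, ContMDiff (𝓡 n) (𝓡 n).tangent ∞ fun x => (⟨x, X i x⟩ : TangentBundle (𝓡 n) M))
    (hT : 0 ≤ T) (hu : ∀ i, IntervalIntegrable (fun t => u t i) volume 0 T)
    (hq : IsTrajectory X T q₀ u q) (hqe : MapsTo q (Icc 0 T) e.source)
    (hg : ∀ i, ContDiff ℝ ∞ (g i))
    (hgX : ∀ᶠ x in 𝓝ˢ ((fun t => e (q t)) '' Icc 0 T), ∀ i, g i x = inChart e (X i) x)
    {Δu : ℝ → Fin l → ℝ} (hΔu : ∀ i, IntervalIntegrable (fun t => Δu t i) volume 0 T) :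
    (∀ t ∈ Icc 0 T, ContDiffAt ℝ ∞ (variation e X T q₀ u Δu t) 0) ∧
    (∀ j, variationJet e X T q₀ u Δu 0 j = 0) ∧
    ∀ j, AbsolutelyContinuousOnInterval (fun t => variationJet e X T q₀ u Δu t j) 0 T ∧
      ∀ᵐ t, t ∈ Icc 0 T → HasDerivAt (fun t => variationJet e X T q₀ u Δu t (j + 1))
        (∑ i, (u t i • compJet (g i) (e (q t)) (variationJet e X T q₀ u Δu t) (j + 1) +
          Δu t i • compJet (g i) (e (q t)) (variationJet e X T q₀ u Δu t) j)) t := by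
  obtain ⟨-, ξ, hξ, hξ0, hvar, hξeq⟩ := variation_family he hX hT hu hq hqe hg hgX hΔu
  have hvar' : ∀ t : Icc 0 T, (fun s => ξ s t) =ᶠ[𝓝 0] variation e X T q₀ u Δu t :=
    fun t => hvar.mono fun s hs => (hs t).symm
  have hsm : ∀ t : Icc 0 T, ContDiffAt ℝ ∞ (fun s => ξ s t) 0 := fun t =>
    (ContinuousMap.evalCLM ℝ t : C(Icc 0 T, Vec n) →L[ℝ] Vec n).contDiff.contDiffAt.comp 0 hξ
  have hsm' : ∀ t ∈ Icc 0 T, ContDiffAt ℝ ∞ (variation e X T q₀ u Δu t) 0 := fun t ht =>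
    (hsm ⟨t, ht⟩).congr_of_eventuallyEq (hvar' ⟨t, ht⟩).symm
  have hb : ∀ (t : Icc 0 T) (j : ℕ),
      variationJet e X T q₀ u Δu t (j + 1) = taylorSeq (fun s => ξ s t) (j + 1) := fun t j => by
    rw [taylorSeq_congr (hvar' t)]
    rfl
  have hjet : ∀ (t : Icc 0 T) (m : ℕ),
      HasJet (fun s => ξ s t - e (q t)) (variationJet e X T q₀ u Δu t) m := fun t m => by
    have h1 := (hasJet_taylorSeq (m := m) (hsm t)).add (hasJet_const (-e (q t)))
    refine (h1.congr fun j _ => ?_).congr_fun (Eventually.of_forall fun s =>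
      (sub_eq_add_neg _ _).symm)
    rcases j with _ | j
    · simp [taylorSeq_zero, variationJet, hξ0]
    · simp [hb]
  have hcomp : ∀ (t : Icc 0 T) (i : Fin l) (j : ℕ),
      taylorSeq (fun s => g i (IccExtend hT (ξ s) t)) j =
        compJet (g i) (e (q t)) (variationJet e X T q₀ u Δu t) j := fun t i j => by
    have h1 := (hjet t j).comp_contDiff (hg i) (e (q t)) rfl
    have h2 : HasJet (fun s => g i (IccExtend hT (ξ s) t)) _ j :=
      h1.congr_fun (Eventually.of_forall fun s => by
        simp only []
        rw [add_sub_cancel, IccExtend_of_mem _ _ t.2])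
    refine HasJet.unique (hasJet_taylorSeq ?_) h2 j le_rfl
    refine (hg i).contDiffAt.comp 0 ?_
    refine (hsm t).congr_of_eventuallyEq (Eventually.of_forall fun s => ?_)
    exact IccExtend_of_mem _ _ t.2
  have key : ∀ j, AbsolutelyContinuousOnInterval
      (fun t => variationJet e X T q₀ u Δu t (j + 1)) 0 T ∧
      variationJet e X T q₀ u Δu 0 (j + 1) = 0 ∧
      ∀ᵐ t, t ∈ Icc 0 T → HasDerivAt (fun t => variationJet e X T q₀ u Δu t (j + 1))
        (∑ i, (u t i • compJet (g i) (e (q t)) (variationJet e X T q₀ u Δu t) (j + 1) +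
          Δu t i • compJet (g i) (e (q t)) (variationJet e X T q₀ u Δu t) j)) t := by
    intro j
    have h := fun t => taylorSeq_family hT (f := fun i => ⟨g i, (hg i).continuous⟩) hg hu hΔu hξ
      hξeq j t
    have hy : ∀ t ∈ Icc 0 T, variationJet e X T q₀ u Δu t (j + 1) = 0 + ∫ τ in 0..t, ∑ i,
        (u τ i • taylorSeq (fun s => g i (IccExtend hT (ξ s) τ)) (j + 1) +
          Δu τ i • taylorSeq (fun s => g i (IccExtend hT (ξ s) τ)) j) := fun t ht => by
      rw [zero_add, hb ⟨t, ht⟩]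
      exact (h ⟨t, ht⟩).2
    obtain ⟨h1, h2⟩ := absCont_and_ae_hasDerivAt_of_eq_integral hT
      (h ⟨0, left_mem_Icc.2 hT⟩).1 hy
    refine ⟨h1, by rw [hy 0 (left_mem_Icc.2 hT)]; simp, ?_⟩
    filter_upwards [h2] with t ht htT
    have h3 := ht htT
    refine h3.congr_deriv (Finset.sum_congr rfl fun i _ => ?_)
    rw [← hcomp ⟨t, htT⟩ i, ← hcomp ⟨t, htT⟩ i]
    rfl
  refine ⟨hsm', fun j => ?_, fun j => ⟨?_, (key j).2.2⟩⟩
  · rcases j with _ | j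
    · rfl
    · exact (key j).2.1
  · rcases j with _ | j
    · exact absCont_const (0 : Vec n)
    · exact (key j).1

end Variation

/-! ### Time derivatives of multilinear expressions in jets -/

section SlotJet

variable {E F : Type*} [NormedAddCommGroup E] [NormedSpace ℝ E]
  [NormedAddCommGroup F] [NormedSpace ℝ F]

theorem mulJet_comp_perm {r : ℕ} (Φ : E [×r]→L[ℝ] F) {σ : Equiv.Perm (Fin r)}
    (hΦ : ∀ w, Φ (w ∘ σ) = Φ w) (c : Fin r → ℕ → E) (j : ℕ) :
    mulJet Φ (c ∘ σ) j = mulJet Φ c j := by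
  refine (Finset.sum_bijective (fun p => p ∘ σ) (σ.symm.arrowCongr (Equiv.refl ℕ)).bijective
    (fun p => ?_) fun p _ => (hΦ fun i => c i (p i)).symm).symm
  rw [Finset.Nat.mem_antidiagonalTuple, Finset.Nat.mem_antidiagonalTuple]
  simp only [Function.comp_apply, Equiv.sum_comp σ p]

/-- By symmetry the modified slot can be moved to the front, so all slots contribute equally to a
derivative. -/
theorem mulJet_update_const {r : ℕ} (Φ : E [×(r + 1)]→L[ℝ] F)
    (hΦ : ∀ (σ : Equiv.Perm (Fin (r + 1))) w, Φ (w ∘ σ) = Φ w) (b c : ℕ → E) (i : Fin (r + 1))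
    (j : ℕ) : mulJet Φ (Function.update (fun _ => b) i c) j =
      mulJet Φ (Fin.cons c fun _ => b) j := by
  rw [← mulJet_comp_perm Φ (hΦ (Equiv.swap 0 i)) (Fin.cons c fun _ => b)]
  congr 1
  ext1 k
  rcases eq_or_ne k i with rfl | hk
  · simp
  · rw [Function.update_of_ne hk, Function.comp_apply]
    have h : Equiv.swap 0 i k ≠ 0 := fun h => hk (by
      rw [← Equiv.swap_apply_left (0 : Fin (r + 1)) i] at h ⊢
      simpa [Equiv.swap_apply_eq_iff] using h)
    obtain ⟨k', hk'⟩ := Fin.exists_succ_eq.2 h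
    rw [← hk', Fin.cons_succ]

theorem hasDerivAt_mulJet {r : ℕ} {Φ : ℝ → E [×r]→L[ℝ] F} {Φ' : E [×r]→L[ℝ] F}
    {b : ℝ → ℕ → E} {b' : ℕ → E} {t : ℝ} (hΦ : HasDerivAt Φ Φ' t)
    (hb : ∀ k, HasDerivAt (fun τ => b τ k) (b' k) t) (j : ℕ) :
    HasDerivAt (fun τ => mulJet (Φ τ) (fun _ => b τ) j)
      (mulJet Φ' (fun _ => b t) j +
        ∑ i, mulJet (Φ t) (Function.update (fun _ => b t) i b') j) t := by
  simp only [mulJet]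
  rw [Finset.sum_comm, ← Finset.sum_add_distrib]
  refine HasDerivAt.fun_sum fun p _ => ?_
  have h := (hΦ.hasFDerivAt.continuousMultilinearMap_apply
    (g := fun i τ => b τ (p i)) fun i => (hb (p i)).hasFDerivAt).hasDerivAt
  refine h.congr_deriv ?_
  simp only [add_apply, ContinuousLinearMap.comp_apply,
    sum_apply, ContinuousLinearMap.toSpanSingleton_apply, one_smul,
    ContinuousMultilinearMap.apply_apply]
  congr 1
  refine Finset.sum_congr rfl fun i _ => ?_
  simp only [ContinuousMultilinearMap.toContinuousLinearMap_apply]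
  congr 1
  ext1 k
  rcases eq_or_ne k i with rfl | hk
  · simp
  · simp [hk]

theorem hasJet_cons {r m : ℕ} {f g : ℝ → E} {c d : ℕ → E} (hf : HasJet f c m) (hg : HasJet g d m)
    (Θ : E [×(r + 1)]→L[ℝ] F) :
    HasJet (fun s => Θ (Fin.cons (f s) fun _ => g s)) (mulJet Θ (Fin.cons c fun _ => d)) m := by
  have h := HasJet.multilinear (m := m) Θ (f := Fin.cons f fun _ => g) (c := Fin.cons c fun _ => d)
    (Fin.cases hf fun _ => hg)
  refine h.congr_fun (Eventually.of_forall fun s => ?_)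
  simp only []
  congr 1
  ext1 k
  cases k using Fin.cases <;> rfl

/-- The evolution equation is given only on the diagonal. Inserting the polynomial `∑ s ^ j • b j`
and comparing coefficients replaces polarization. -/
theorem mulJet_eq_of_diagonal {ι : Type*} [Fintype ι] {r : ℕ} {Ψ : E [×r]→L[ℝ] ℝ} {w : ι → ℝ}
    {C : ℕ → ℝ} {Θ : (s : ℕ) → E [×(r - s + 1)]→L[ℝ] ℝ} {D : ι → (s : ℕ) → E [×s]→L[ℝ] E}
    (h : ∀ b : E, Ψ (fun _ => b) = -∑ i, w i * ∑ s ∈ Finset.Icc 1 r,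
      C s * Θ s (Fin.cons (D i s fun _ => b) fun _ => b)) (b : ℕ → E) (j : ℕ) :
    mulJet Ψ (fun _ => b) j = -∑ i, w i * ∑ s ∈ Finset.Icc 1 r,
      C s * mulJet (Θ s) (Fin.cons (mulJet (D i s) fun _ => b) fun _ => b) j := by
  have hB := hasJet_polynomial (m := j) b
  have h1 := HasJet.multilinear (m := j) Ψ (f := fun _ s => _) (c := fun _ => b) fun _ => hB
  have h2 := (hasJet_sum (m := j) Finset.univ fun i (_ : i ∈ Finset.univ) =>
    (hasJet_sum (m := j) (Finset.Icc 1 r) fun s _ =>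
      (hasJet_cons (HasJet.multilinear (m := j) (D i s) (f := fun _ s => _) (c := fun _ => b)
        fun _ => hB) hB (Θ s)).const_smul (C s)).const_smul (w i)).const_smul (-1)
  have h3 := HasJet.unique h1 (h2.congr_fun (Eventually.of_forall fun s => ?_)) j le_rfl
  · simpa using h3
  · simp only [h, smul_eq_mul, neg_one_mul]

/-- The coefficients of `∑ (1 / r!) Φ^{r+1}[c(s), b(s), …, b(s)]` for formal power series `b` and
`c`: the derivative of `∑ (1 / r!) Φ^r[b(s)^r]` in the direction `c`. -/
def slotJet (Φ : (k : ℕ) → E [×k]→L[ℝ] F) (c b : ℕ → E) (j : ℕ) : F :=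
  ∑ r ∈ Finset.range (j + 1),
    (r.factorial : ℝ)⁻¹ • mulJet (Φ (r + 1)) (Fin.cons c fun _ => b) j

theorem mulJet_cons_eq_zero {r j o : ℕ} (Φ : E [×(r + 1)]→L[ℝ] F) {c b : ℕ → E} (hb : b 0 = 0)
    (hc : ∀ k < o, c k = 0) (hj : j < o + r) : mulJet Φ (Fin.cons c fun _ => b) j = 0 := by
  refine mulJet_eq_zero Φ (l := o + r) (Fin.cons o fun _ => 1)
    (Fin.cases hc fun i k (hk : k < 1) => ?_) (by simp) hj
  rw [Fin.cons_succ, Nat.lt_one_iff.1 hk, hb]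

theorem slotJet_eq_sum (Φ : (k : ℕ) → E [×k]→L[ℝ] F) {c b : ℕ → E} (hb : b 0 = 0) {j N : ℕ}
    (h : j ≤ N) : slotJet Φ c b j = ∑ r ∈ Finset.range (N + 1),
      (r.factorial : ℝ)⁻¹ • mulJet (Φ (r + 1)) (Fin.cons c fun _ => b) j := by
  refine Finset.sum_subset (Finset.range_mono (by omega)) fun σ _ hσ => ?_
  rw [mulJet_cons_eq_zero (o := 0) _ hb (by simp) (by simpa using hσ), smul_zero]

theorem mulJet_cons_sum {r : ℕ} {ι : Type*} (t : Finset ι) (Φ : E [×(r + 1)]→L[ℝ] F)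
    (w : ι → ℝ) (c : ι → ℕ → E) (b : Fin r → ℕ → E) (j : ℕ) :
    mulJet Φ (Fin.cons (fun k => ∑ i ∈ t, w i • c i k) b) j =
      ∑ i ∈ t, w i • mulJet Φ (Fin.cons (c i) b) j := by
  simp only [mulJet, Finset.smul_sum]
  rw [Finset.sum_comm]
  refine Finset.sum_congr rfl fun p _ => ?_
  have key : ∀ c : ℕ → E, (fun i => (Fin.cons c b : Fin (r + 1) → ℕ → E) i (p i)) =
      Fin.cons (c (p 0)) fun i => b i (p i.succ) := fun c => by
    ext1 k
    cases k using Fin.cases <;> rfl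
  simp only [key]
  have h := map_sum (Φ.toMultilinearMap.toLinearMap (Fin.cons 0 fun i => b i (p i.succ)) 0)
    (fun i => w i • c i (p 0)) t
  simp only [map_smul, MultilinearMap.toLinearMap_apply, Fin.update_cons_zero] at h
  exact h

theorem mulJet_cons_shiftJet {r : ℕ} (Φ : E [×(r + 1)]→L[ℝ] F) (c : ℕ → E) (b : Fin r → ℕ → E)
    (j : ℕ) : mulJet Φ (Fin.cons (shiftJet c) b) (j + 1) = mulJet Φ (Fin.cons c b) j := by
  symm
  refine Finset.sum_of_injOn (fun p => Fin.cons (p 0 + 1) (Fin.tail p)) ?_ ?_ ?_ ?_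
  · intro p _ p' _ h
    have h0 := congrFun h 0
    simp only [Fin.cons_zero, add_left_inj] at h0
    ext k
    cases k using Fin.cases with
    | zero => exact h0
    | succ k => exact congrFun h k.succ
  · intro p hp
    simp only [Finset.mem_coe, Finset.Nat.mem_antidiagonalTuple, Fin.sum_univ_succ, Fin.cons_zero,
      Fin.cons_succ, Fin.tail] at hp ⊢
    omega
  · intro p hp hp'
    rcases hp0 : p 0 with _ | k
    · refine Φ.map_coord_zero 0 ?_
      rw [hp0]; rfl
    · refine absurd ⟨Fin.cons k (Fin.tail p), ?_, ?_⟩ hp'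
      · simp only [Finset.mem_coe, Finset.Nat.mem_antidiagonalTuple, Fin.sum_univ_succ,
          Fin.cons_zero, Fin.cons_succ, Fin.tail] at hp ⊢
        omega
      · simp [← hp0]
  · intro p _
    congr 1
    ext1 k
    cases k using Fin.cases <;> rfl

theorem slotJet_sum {ι : Type*} (t : Finset ι) (Φ : (k : ℕ) → E [×k]→L[ℝ] F) (w : ι → ℝ)
    (c : ι → ℕ → E) (b : ℕ → E) (j : ℕ) :
    slotJet Φ (fun k => ∑ i ∈ t, w i • c i k) b j = ∑ i ∈ t, w i • slotJet Φ (c i) b j := by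
  simp only [slotJet, mulJet_cons_sum, Finset.smul_sum]
  rw [Finset.sum_comm]
  exact Finset.sum_congr rfl fun i _ => Finset.sum_congr rfl fun r _ => smul_comm _ _ _

theorem slotJet_shiftJet (Φ : (k : ℕ) → E [×k]→L[ℝ] F) (c : ℕ → E) {b : ℕ → E} (hb : b 0 = 0)
    (j : ℕ) : slotJet Φ (shiftJet c) b (j + 1) = slotJet Φ c b j := by
  rw [slotJet_eq_sum Φ hb (Nat.le_succ j)]
  simp only [slotJet, mulJet_cons_shiftJet]

theorem slotJet_congr (Φ : (k : ℕ) → E [×k]→L[ℝ] F) {c c' b b' : ℕ → E} {j : ℕ}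
    (hc : ∀ k ≤ j, c k = c' k) (hb : ∀ k ≤ j, b k = b' k) :
    slotJet Φ c b j = slotJet Φ c' b' j :=
  Finset.sum_congr rfl fun _ _ => congrArg _ (mulJet_congr _ (Fin.cases hc fun _ => hb))

theorem mulJet_zero_succ (Φ : E [×0]→L[ℝ] F) (c : Fin 0 → ℕ → E) (j : ℕ) :
    mulJet Φ c (j + 1) = 0 := rfl

/-- This is the expansion of `f (x + b(s)) - f x`: a displacement moves with the difference of two
velocities. Hence the sum starts at `s = 1`, as in the evolution equation. -/
theorem compJet_sub_constantCoeff_eq_sum (f : E → F) (x : E) {b : ℕ → E} (hb : b 0 = 0) {j N : ℕ}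
    (h : j ≤ N) : (if j = 0 then 0 else compJet f x b j) = ∑ s ∈ Finset.Icc 1 N,
      (s.factorial : ℝ)⁻¹ • mulJet (iteratedFDeriv ℝ s f x) (fun _ => b) j := by
  rcases j with _ | j
  · rw [if_pos rfl, Finset.sum_eq_zero fun s hs => ?_]
    rw [mulJet_const_eq_zero _ hb (Finset.mem_Icc.1 hs).1, smul_zero]
  · rw [if_neg (Nat.succ_ne_zero j), compJet_eq_sum f x hb h, Finset.range_eq_Ico,
      Finset.sum_eq_sum_Ico_succ_bot (Nat.succ_pos N), mulJet_zero_succ, smul_zero, zero_add]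
    rfl

/-- With `ρ = r + 1 - s`, the coefficient `choose / (r + 1)!` splits as `1 / (s! ρ!)`. The new
indices fill a triangle in the rectangle on the right, and `hG` kills the rest. -/
theorem sum_factorial_inv_mul_choose {G : ℕ → ℕ → ℝ} {j : ℕ} (hG : ∀ ρ s, j < ρ + s → G ρ s = 0) :
    ∑ r ∈ Finset.range j, ((r + 1).factorial : ℝ)⁻¹ *
      ∑ s ∈ Finset.Icc 1 (r + 1), ((r + 1).choose s : ℝ) * G (r + 1 - s) s =
    ∑ s ∈ Finset.Icc 1 j, (s.factorial : ℝ)⁻¹ *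
      ∑ ρ ∈ Finset.range (j + 1), (ρ.factorial : ℝ)⁻¹ * G ρ s := by
  simp only [Finset.mul_sum]
  rw [Finset.sum_sigma', Finset.sum_sigma']
  refine Finset.sum_of_injOn (fun x => ⟨x.2, x.1 + 1 - x.2⟩) ?_ ?_ ?_ ?_
  · rintro ⟨r, s⟩ h ⟨r', s'⟩ h' heq
    simp only [Finset.coe_sigma, Set.mem_sigma_iff, Finset.mem_coe, Finset.mem_range,
      Finset.mem_Icc, Sigma.mk.injEq, heq_eq_eq] at h h' heq ⊢
    omega
  · rintro ⟨r, s⟩ h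
    simp only [Finset.coe_sigma, Set.mem_sigma_iff, Finset.mem_coe, Finset.mem_range,
      Finset.mem_Icc] at h ⊢
    omega
  · rintro ⟨s, ρ⟩ h h'
    simp only [Finset.mem_sigma, Finset.mem_range, Finset.mem_Icc] at h
    rw [hG ρ s, mul_zero, mul_zero]
    by_contra! hlt
    refine h' ⟨⟨ρ + s - 1, s⟩, ?_, ?_⟩
    · simp only [Finset.coe_sigma, Set.mem_sigma_iff, Finset.mem_coe, Finset.mem_range,
        Finset.mem_Icc]
      omega
    · simp only [Sigma.mk.injEq, heq_eq_eq, true_and]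
      omega
  · rintro ⟨r, s⟩ h
    simp only [Finset.mem_sigma, Finset.mem_range, Finset.mem_Icc] at h
    simp only []
    rw [Nat.cast_choose ℝ h.2.2]
    have := Nat.factorial_pos (r + 1)
    field_simp

/-- The defining evolution of adapted forms: along a family `b` that solves the equations of
variation, `∑ (1 / r!) Φ^r[b(s)^r]` is only moved by the perturbation of the control. -/
theorem hasDerivAt_sum_mulJet {ι : Type*} [Fintype ι] {Φ : ℝ → (k : ℕ) → E [×k]→L[ℝ] ℝ} {t : ℝ}
    {Φ' : (k : ℕ) → E [×k]→L[ℝ] ℝ} {u w : ι → ℝ} {f : ι → E → E} {x : E} {b : ℝ → ℕ → E}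
    (hsymm : ∀ k, 1 ≤ k → ∀ (σ : Equiv.Perm (Fin k)) w, Φ t k (w ∘ σ) = Φ t k w)
    (hd : ∀ k, 1 ≤ k → HasDerivAt (fun τ => Φ τ k) (Φ' k) t)
    (hev : ∀ k, 1 ≤ k → ∀ b : E, Φ' k (fun _ => b) = -∑ i, u i * ∑ s ∈ Finset.Icc 1 k,
      (k.choose s : ℝ) * Φ t (k - s + 1)
        (Fin.cons (iteratedFDeriv ℝ s (f i) x fun _ => b) fun _ => b))
    (hb0 : ∀ τ, b τ 0 = 0)
    (hb : ∀ k, HasDerivAt (fun τ => b τ (k + 1))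
      (∑ i, (u i • compJet (f i) x (b t) (k + 1) + w i • compJet (f i) x (b t) k)) t) (j : ℕ) :
    HasDerivAt (fun τ => ∑ r ∈ Finset.range (j + 1 + 1),
        (r.factorial : ℝ)⁻¹ * mulJet (Φ τ r) (fun _ => b τ) (j + 1))
      (∑ i, w i * slotJet (Φ t) (compJet (f i) x (b t)) (b t) j) t := by
  -- The velocity of `b(s)`: the `u`-part without its constant term, plus `s` times the `w`-part.
  set b' : ℕ → E := fun k => ∑ i, u i • (if k = 0 then 0 else compJet (f i) x (b t) k) +
    ∑ i, w i • shiftJet (compJet (f i) x (b t)) k with hb'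
  have hbd : ∀ k, HasDerivAt (fun τ => b τ k) (b' k) t := by
    rintro (_ | k)
    · simp only [hb0, hb', if_pos, smul_zero, shiftJet_zero, Finset.sum_const_zero, add_zero]
      exact hasDerivAt_const t _
    · simpa [hb', Finset.sum_add_distrib] using hb k
  have hb'0 : b' 0 = 0 := by simp [hb']
  have hslot : slotJet (Φ t) b' (b t) (j + 1) =
      ∑ i, u i * slotJet (Φ t) (fun k => if k = 0 then 0 else compJet (f i) x (b t) k) (b t)
        (j + 1) + ∑ i, w i * slotJet (Φ t) (compJet (f i) x (b t)) (b t) j := by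
    have h := slotJet_sum Finset.univ (Φ t) (Sum.elim u w)
      (Sum.elim (fun i k => if k = 0 then 0 else compJet (f i) x (b t) k)
        fun i => shiftJet (compJet (f i) x (b t))) (b t) (j + 1)
    simpa only [Fintype.sum_sum_type, Sum.elim_inl, Sum.elim_inr, smul_eq_mul,
      slotJet_shiftJet _ _ (hb0 t)] using h
  have hfree : ∀ i, slotJet (Φ t) (fun k => if k = 0 then 0 else compJet (f i) x (b t) k) (b t)
      (j + 1) = ∑ r ∈ Finset.range (j + 1), ((r + 1).factorial : ℝ)⁻¹ *
        ∑ s ∈ Finset.Icc 1 (r + 1), ((r + 1).choose s : ℝ) * mulJet (Φ t (r + 1 - s + 1))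
          (Fin.cons (mulJet (iteratedFDeriv ℝ s (f i) x) fun _ => b t) fun _ => b t) (j + 1) :=
    fun i => by
    rw [slotJet_congr (Φ t) (fun k hk => compJet_sub_constantCoeff_eq_sum (f i) x (hb0 t) hk)
      (fun _ _ => rfl), slotJet_sum]
    refine (sum_factorial_inv_mul_choose (G := fun ρ s => mulJet (Φ t (ρ + 1))
      (Fin.cons (mulJet (iteratedFDeriv ℝ s (f i) x) fun _ => b t) fun _ => b t) (j + 1))
      fun ρ s h => ?_).symm
    exact mulJet_cons_eq_zero (o := s) _ (hb0 t)
      (fun k hk => mulJet_const_eq_zero _ (hb0 t) hk) (by omega)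
  -- The `r + 1` equal slot terms reduce `1 / (r + 1)!` to `1 / r!`.
  have hterm : ∀ r ∈ Finset.range (j + 1), HasDerivAt
      (fun τ => ((r + 1).factorial : ℝ)⁻¹ * mulJet (Φ τ (r + 1)) (fun _ => b τ) (j + 1))
      (((r + 1).factorial : ℝ)⁻¹ * mulJet (Φ' (r + 1)) (fun _ => b t) (j + 1) +
        (r.factorial : ℝ)⁻¹ • mulJet (Φ t (r + 1)) (Fin.cons b' fun _ => b t) (j + 1)) t :=
    fun r _ => by
    refine ((hasDerivAt_mulJet (hd (r + 1) (by omega)) hbd (j + 1)).const_mul _).congr_deriv ?_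
    simp only [mulJet_update_const _ (hsymm (r + 1) (by omega)), Finset.sum_const,
      Finset.card_univ, Fintype.card_fin, nsmul_eq_mul, smul_eq_mul, mul_add, Nat.factorial_succ,
      Nat.cast_mul]
    have := Nat.factorial_pos r
    field_simp
  have hsum := HasDerivAt.fun_sum hterm
  -- The top summand `r = j + 1` drops out because `b' 0 = 0`.
  have hlast : slotJet (Φ t) b' (b t) (j + 1) = ∑ r ∈ Finset.range (j + 1),
      (r.factorial : ℝ)⁻¹ • mulJet (Φ t (r + 1)) (Fin.cons b' fun _ => b t) (j + 1) := by
    rw [slotJet, Finset.sum_range_succ, mulJet_cons_eq_zero (o := 1) _ (hb0 t)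
      (fun k hk => by rw [Nat.lt_one_iff.1 hk, hb'0]) (by omega), smul_zero, add_zero]
  -- The evolution of the forms is exactly opposite to the motion of `b` under `u`.
  have hcancel : ∑ r ∈ Finset.range (j + 1),
      ((r + 1).factorial : ℝ)⁻¹ * mulJet (Φ' (r + 1)) (fun _ => b t) (j + 1) =
      -∑ i, u i * slotJet (Φ t) (fun k => if k = 0 then 0 else compJet (f i) x (b t) k) (b t)
        (j + 1) := by
    simp only [hfree]
    rw [Finset.sum_congr rfl fun r _ => by rw [mulJet_eq_of_diagonal (hev (r + 1) (by omega))]]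
    simp only [Finset.mul_sum, mul_neg, Finset.sum_neg_distrib]
    rw [Finset.sum_comm]
    refine congrArg _ (Finset.sum_congr rfl fun i _ => Finset.sum_congr rfl fun r _ =>
      Finset.sum_congr rfl fun s _ => ?_)
    ring
  rw [Finset.sum_add_distrib, hcancel, ← hlast, hslot, neg_add_cancel_left] at hsum
  refine hsum.congr_of_eventuallyEq (Eventually.of_forall fun τ => ?_)
  simp only []
  rw [Finset.sum_range_succ', mulJet_zero_succ, mul_zero, add_zero]

end SlotJet

/-! ### Linear independence along the evolution of covectors -/

section Evolution

variable {E : Type*} [NormedAddCommGroup E] [NormedSpace ℝ E]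

/-- Solutions of the linear equation `ψ' = -∑ u_i ψ ∘ A_i` that vanish at some time vanish at
time `0`. -/
theorem eq_zero_of_covector_evolution {l : ℕ} {T : ℝ} {ψ : ℝ → E [×1]→L[ℝ] ℝ} {u : ℝ → Fin l → ℝ}
    {A : Fin l → ℝ → E →L[ℝ] E} (hψ : AbsolutelyContinuousOnInterval ψ 0 T)
    (hu : ∀ i, IntervalIntegrable (fun t => u t i) volume 0 T)
    (hA : ∀ i, ContinuousOn (A i) (Icc 0 T))
    (hd : ∀ b : E, ∀ᵐ t, t ∈ Icc 0 T → HasDerivAt (fun τ => ψ τ fun _ => b)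
      (-∑ i, u t i * ψ t fun _ => A i t b) t)
    {t₀ : ℝ} (ht₀ : t₀ ∈ Icc 0 T) (h0 : ψ t₀ = 0) : ψ 0 = 0 := by
  have hT : 0 ≤ T := ht₀.1.trans ht₀.2
  have huI : uIcc 0 T = Icc 0 T := uIcc_of_le hT
  have hψc : ContinuousOn ψ (Icc 0 T) := huI ▸ hψ.continuousOn
  have hC : ∃ C : ℝ, 0 ≤ C ∧ ∀ i, ∀ t ∈ Icc 0 T, ‖A i t‖ ≤ C := by
    choose C hC using fun i => isCompact_Icc.exists_bound_of_continuousOn (hA i)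
    refine ⟨∑ i, |C i|, Finset.sum_nonneg fun i _ => abs_nonneg _, fun i t ht => (hC i t ht).trans ((le_abs_self _).trans ?_)⟩
    exact Finset.single_le_sum (f := fun i => |C i|) (fun _ _ => abs_nonneg _) (Finset.mem_univ i)
  obtain ⟨C, hC0, hC⟩ := hC
  set κ : ℝ → ℝ := fun t => ∑ i, |u t i| * C with hκ
  have hκ0 : ∀ t, 0 ≤ κ t := fun t =>
    Finset.sum_nonneg fun i _ => mul_nonneg (abs_nonneg _) hC0
  have hκi : IntervalIntegrable κ volume 0 T := by
    simpa only [Finset.sum_fn] using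
      IntervalIntegrable.sum Finset.univ fun i _ => (hu i).abs.mul_const C
  have hGi : ∀ b : E, IntervalIntegrable (fun t => -∑ i, u t i * ψ t fun _ => A i t b) volume 0 T :=
    fun b => by
    have h1 : ∀ i, IntervalIntegrable (fun t => u t i * ψ t fun _ => A i t b) volume 0 T :=
      fun i => (hu i).mul_continuousOn (huI.symm ▸ continuous_eval.comp_continuousOn
        (hψc.prodMk (continuousOn_pi.2 fun _ => (hA i).clm_apply continuousOn_const)))
    have h2 := IntervalIntegrable.sum Finset.univ fun i _ => h1 i
    simp only [Finset.sum_fn] at h2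
    exact h2.neg
  have hFi : IntervalIntegrable (fun τ => κ τ * ‖ψ τ‖) volume 0 T :=
    hκi.mul_continuousOn (huI.symm ▸ hψc.norm)
  have hbound : ∀ t ∈ Icc 0 t₀, ‖ψ t‖ ≤ ∫ τ in t..t₀, κ τ * ‖ψ τ‖ := by
    intro t ht
    have htT : t ∈ Icc 0 T := ⟨ht.1, ht.2.trans ht₀.2⟩
    have hsub : uIcc t t₀ ⊆ uIcc 0 T := uIcc_subset_uIcc (huI.symm ▸ htT) (huI.symm ▸ ht₀)
    have hsub' : Icc t t₀ ⊆ Icc 0 T := Icc_subset_Icc ht.1 ht₀.2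
    have hnn : ∀ τ ∈ Icc t t₀, 0 ≤ κ τ * ‖ψ τ‖ := fun τ hτ =>
      mul_nonneg (hκ0 τ) (norm_nonneg _)
    refine ContinuousMultilinearMap.opNorm_le_bound
      (intervalIntegral.integral_nonneg ht.2 hnn) fun m => ?_
    have hm : m = fun _ => m 0 := funext fun i => by rw [Subsingleton.elim i 0]
    have hac : AbsolutelyContinuousOnInterval (fun τ => ψ τ fun _ => m 0) 0 T :=
      absCont_multilinear_apply hψ fun _ => absCont_const _
    have h1 := absCont_eq_add_integral hac (hGi (m 0)) (by simpa only [huI] using hd (m 0))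
      (huI.symm ▸ ht₀) (huI.symm ▸ htT)
    rw [h0, zero_apply, zero_add, intervalIntegral.integral_symm] at h1
    rw [hm, h1, norm_neg, Finset.prod_const, Finset.card_univ, Fintype.card_fin, pow_one,
      ← intervalIntegral.integral_mul_const]
    refine intervalIntegral.norm_integral_le_of_norm_le ht.2 (Eventually.of_forall fun τ hτ => ?_)
      ((hFi.mono_set hsub).mul_const _)
    have hτT := hsub' (Ioc_subset_Icc_self hτ)
    rw [norm_neg, hκ, Finset.sum_mul, Finset.sum_mul]
    refine (norm_sum_le _ _).trans (Finset.sum_le_sum fun i _ => ?_)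
    rw [norm_mul, Real.norm_eq_abs, mul_assoc, mul_assoc]
    refine mul_le_mul_of_nonneg_left ?_ (abs_nonneg _)
    refine ((ψ τ).le_opNorm _).trans ?_
    rw [Finset.prod_const, Finset.card_univ, Fintype.card_fin, pow_one, mul_left_comm]
    gcongr
    exact ((A i τ).le_opNorm _).trans (mul_le_mul_of_nonneg_right (hC i τ hτT) (norm_nonneg _))
  -- The bound integrates up to `t₀`, where `ψ` vanishes; reflecting time turns it into the forward
  -- Gronwall inequality.
  have hrefl : MapsTo (fun s => t₀ - s) (Icc 0 t₀) (Icc 0 t₀) := fun s hs =>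
    ⟨sub_nonneg.2 hs.2, sub_le_self _ hs.1⟩
  have hκr : IntervalIntegrable (fun s => κ (t₀ - s)) volume 0 t₀ := by
    have h := (hκi.mono_set (c := 0) (d := t₀) (by
      rw [huI, uIcc_of_le ht₀.1]; exact Icc_subset_Icc_right ht₀.2)).comp_sub_left t₀
    simpa using h.symm
  have key := eq_zero_of_norm_le_integral (k := fun s => κ (t₀ - s)) (y := fun s => ψ (t₀ - s))
    ht₀.1 hκr (fun s => hκ0 _)
    ((hψc.mono (Icc_subset_Icc_right ht₀.2)).comp (by fun_prop) hrefl) (fun s hs => by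
      refine (hbound _ (hrefl hs)).trans_eq ?_
      rw [intervalIntegral.integral_comp_sub_left (fun τ => κ τ * ‖ψ τ‖) t₀, sub_zero])
  simpa using key t₀ (right_mem_Icc.2 ht₀.1)

/-- A linear relation at time `t`, kept with constant coefficients, is a solution of the same linear
equation vanishing at `t`; it therefore holds at time `0`. -/
theorem linearIndependent_of_covector_evolution {l : ℕ} {ι : Type*} [Fintype ι] {T : ℝ}
    {Ψ : ι → ℝ → E [×1]→L[ℝ] ℝ} {u : ℝ → Fin l → ℝ} {A : Fin l → ℝ → E →L[ℝ] E}
    (hΨ : ∀ a, AbsolutelyContinuousOnInterval (Ψ a) 0 T)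
    (hu : ∀ i, IntervalIntegrable (fun t => u t i) volume 0 T)
    (hA : ∀ i, ContinuousOn (A i) (Icc 0 T))
    (hd : ∀ a, ∀ᵐ t, t ∈ Icc 0 T → ∀ b : E, HasDerivAt (fun τ => Ψ a τ fun _ => b)
      (-∑ i, u t i * Ψ a t fun _ => A i t b) t)
    (h0 : LinearIndependent ℝ fun a => Ψ a 0) {t : ℝ} (ht : t ∈ Icc 0 T) :
    LinearIndependent ℝ fun a => Ψ a t := by
  rw [Fintype.linearIndependent_iff] at h0 ⊢
  intro c hc
  refine h0 c (eq_zero_of_covector_evolution (ψ := fun τ => ∑ a, c a • Ψ a τ)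
    (absCont_sum _ fun a _ => (hΨ a).const_smul (c a)) hu hA (fun b => ?_) ht hc)
  filter_upwards [eventually_all.2 hd] with τ hτ hτT
  have h1 := HasDerivAt.fun_sum (u := Finset.univ) fun a _ => (hτ a hτT b).const_mul (c a)
  simp only [sum_apply, smul_apply, smul_eq_mul]
  refine h1.congr_deriv ?_
  simp only [Finset.mul_sum, mul_neg, Finset.sum_neg_distrib]
  rw [Finset.sum_comm]
  exact congrArg _ (Finset.sum_congr rfl fun i _ => Finset.sum_congr rfl fun a _ => by ring)

theorem ae_differentiableAt_of_absCont {F : Type*} [NormedAddCommGroup F] [NormedSpace ℝ F]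
    [FiniteDimensional ℝ F] {f : ℝ → F} {a b : ℝ} (hf : AbsolutelyContinuousOnInterval f a b) :
    ∀ᵐ t, t ∈ uIcc a b → DifferentiableAt ℝ f t :=
  hf.boundedVariationOn.ae_differentiableAt_of_mem_uIcc

/-- Finite dimension lets absolutely continuous families of forms be differentiated almost
everywhere. -/
instance finiteDimensional_continuousMultilinearMap {F : Type*} [NormedAddCommGroup F]
    [NormedSpace ℝ F] [FiniteDimensional ℝ E] [FiniteDimensional ℝ F] (k : ℕ) :
    FiniteDimensional ℝ (E [×k]→L[ℝ] F) :=
  FiniteDimensional.of_injective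
    (ContinuousMultilinearMap.toMultilinearMapLinear :
      (E [×k]→L[ℝ] F) →ₗ[ℝ] MultilinearMap ℝ (fun _ : Fin k => E) F)
    ContinuousMultilinearMap.toMultilinearMap_injective

end Evolution

/-! ### Regularity of adapted forms -/

section Forms

variable {n l : ℕ} {M : Type*} [TopologicalSpace M] [ChartedSpace (EuclideanSpace ℝ (Fin n)) M]
  {e : OpenPartialHomeomorph M (EuclideanSpace ℝ (Fin n))}
  {X : Fin l → (x : M) → TangentSpace (𝓡 n) x} {T : ℝ} {u : ℝ → Fin l → ℝ} {q : ℝ → M}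
  {Φ : (k : ℕ) → Fin n → ℝ → (Vec n) [×k]→L[ℝ] ℝ} {g : Fin l → Vec n → Vec n}

theorem IsAdaptedForms.evolution_of_eventuallyEq (hΦ : IsAdaptedForms e X T u q Φ)
    (hgX : ∀ᶠ x in 𝓝ˢ ((fun t => e (q t)) '' Icc 0 T), ∀ i, g i x = inChart e (X i) x)
    {k : ℕ} (hk : 1 ≤ k) (a : Fin n) : ∀ᵐ t, t ∈ Icc 0 T → ∀ b : Vec n,
    HasDerivAt (fun τ => Φ k a τ (fun _ => b))
      (-∑ i, u t i * ∑ s ∈ Finset.Icc 1 k, (k.choose s : ℝ) *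
        Φ (k - s + 1) a t (Fin.cons
          (iteratedFDeriv ℝ s (g i) (e (q t)) (fun _ => b)) (fun _ => b))) t := by
  filter_upwards [(ae_restrict_iff' measurableSet_Icc).1 (hΦ.evolution k hk a)] with t ht htT b
  have h1 : ∀ i, g i =ᶠ[𝓝 (e (q t))] inChart e (X i) := fun i =>
    (hgX.filter_mono (nhds_le_nhdsSet (mem_image_of_mem _ htT))).mono fun x hx => hx i
  refine (ht htT b).congr_deriv ?_
  simp only [fun i s => ((h1 i).iteratedFDeriv ℝ s).self_of_nhds]

/-- The hypothesis differentiates only diagonal values. Absolute continuity differentiates the forms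
themselves, and uniqueness of derivatives matches the two, off one null set for all `k`, `a` and
`b`. -/
theorem IsAdaptedForms.ae_hasDerivAt (hΦ : IsAdaptedForms e X T u q Φ) (hT : 0 ≤ T)
    (hgX : ∀ᶠ x in 𝓝ˢ ((fun t => e (q t)) '' Icc 0 T), ∀ i, g i x = inChart e (X i) x) :
    ∀ᵐ t, t ∈ Icc 0 T → ∀ a, ∃ Φ' : (k : ℕ) → (Vec n) [×k]→L[ℝ] ℝ, ∀ k, 1 ≤ k →
      HasDerivAt (Φ k a) (Φ' k) t ∧ ∀ b : Vec n, Φ' k (fun _ => b) =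
        -∑ i, u t i * ∑ s ∈ Finset.Icc 1 k, (k.choose s : ℝ) * Φ (k - s + 1) a t
          (Fin.cons (iteratedFDeriv ℝ s (g i) (e (q t)) fun _ => b) fun _ => b) := by
  have h1 : ∀ᵐ t, ∀ k a, 1 ≤ k → t ∈ Icc 0 T → DifferentiableAt ℝ (Φ k a) t := by
    rw [ae_all_iff]; intro k
    rw [eventually_all]; intro a
    by_cases hk : 1 ≤ k
    · filter_upwards [ae_differentiableAt_of_absCont (hΦ.absCont k hk a)] with t ht _ htT
      exact ht (uIcc_of_le hT ▸ htT)
    · exact Eventually.of_forall fun t h => absurd h hk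
  have h2 : ∀ᵐ t, ∀ k a, 1 ≤ k → t ∈ Icc 0 T → ∀ b : Vec n,
      HasDerivAt (fun τ => Φ k a τ (fun _ => b))
      (-∑ i, u t i * ∑ s ∈ Finset.Icc 1 k, (k.choose s : ℝ) *
        Φ (k - s + 1) a t (Fin.cons
          (iteratedFDeriv ℝ s (g i) (e (q t)) (fun _ => b)) (fun _ => b))) t := by
    rw [ae_all_iff]; intro k
    rw [eventually_all]; intro a
    by_cases hk : 1 ≤ k
    · filter_upwards [hΦ.evolution_of_eventuallyEq hgX hk a] with t ht _ htT using ht htT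
    · exact Eventually.of_forall fun t h => absurd h hk
  filter_upwards [h1, h2] with t h1 h2 htT a
  refine ⟨fun k => deriv (Φ k a) t, fun k hk => ⟨(h1 k a hk htT).hasDerivAt, fun b => ?_⟩⟩
  refine HasDerivAt.unique ?_ (h2 k a hk htT b)
  exact (ContinuousMultilinearMap.apply ℝ (fun _ : Fin k => Vec n) ℝ
    fun _ => b).hasFDerivAt.comp_hasDerivAt t (h1 k a hk htT).hasDerivAt

theorem IsAdaptedForms.linearIndependent (hΦ : IsAdaptedForms e X T u q Φ)
    (hu : ∀ i, IntervalIntegrable (fun t => u t i) volume 0 T)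
    (hq : ContinuousOn (fun t => e (q t)) (Icc 0 T)) (hg : ∀ i, ContDiff ℝ ∞ (g i))
    (hgX : ∀ᶠ x in 𝓝ˢ ((fun t => e (q t)) '' Icc 0 T), ∀ i, g i x = inChart e (X i) x)
    {t : ℝ} (ht : t ∈ Icc 0 T) : LinearIndependent ℝ fun a => Φ 1 a t := by
  refine linearIndependent_of_covector_evolution (Ψ := fun a => Φ 1 a)
    (A := fun i t => fderiv ℝ (g i) (e (q t))) (hΦ.absCont 1 le_rfl) hu
    (fun i => ((hg i).continuous_fderiv (by simp)).comp_continuousOn hq) (fun a => ?_) hΦ.basis ht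
  filter_upwards [hΦ.evolution_of_eventuallyEq hgX le_rfl a] with t ht htT b
  refine (ht htT b).congr_deriv ?_
  have hcons : ∀ c : Vec n, (Fin.cons c fun _ => b : Fin 1 → Vec n) = fun _ => c := fun c =>
    funext fun i => by
      rw [show i = 0 from Subsingleton.elim (α := Fin 1) i 0]; rfl
  simp only [Finset.Icc_self, Finset.sum_singleton, Nat.choose_self, Nat.cast_one, one_mul,
    iteratedFDeriv_one_apply]
  exact congrArg _ (Finset.sum_congr rfl fun i _ => congrArg _ (congrArg _ (hcons _)))

end Forms

/-! ### Recovering a jet from its adapted coordinates -/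

section SolveJet

variable {E F P : Type*} [NormedAddCommGroup E] [NormedSpace ℝ E]
  [NormedAddCommGroup F] [NormedSpace ℝ F]

theorem mulJet_one (Φ : E [×1]→L[ℝ] F) (c : Fin 1 → ℕ → E) (j : ℕ) :
    mulJet Φ c j = Φ fun i => c i j := by
  rw [mulJet, Finset.Nat.antidiagonalTuple_one, Finset.sum_singleton]
  congr 1
  ext1 i
  rw [Subsingleton.elim i 0]
  rfl

theorem mulJet_clm_comp {G : Type*} [NormedAddCommGroup G] [NormedSpace ℝ G] {r : ℕ}
    (L : F →L[ℝ] G) (Φ : E [×r]→L[ℝ] F) (c : Fin r → ℕ → E) (j : ℕ) :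
    mulJet (L.compContinuousMultilinearMap Φ) c j = L (mulJet Φ c j) := by
  simp [mulJet, map_sum]

theorem slotJet_clm_comp {G : Type*} [NormedAddCommGroup G] [NormedSpace ℝ G]
    (L : F →L[ℝ] G) (Φ : (k : ℕ) → E [×k]→L[ℝ] F) (c b : ℕ → E) (j : ℕ) :
    slotJet (fun k => L.compContinuousMultilinearMap (Φ k)) c b j = L (slotJet Φ c b j) := by
  simp [slotJet, mulJet_clm_comp, map_sum]

/-- With at least two slots, each of positive degree, no slot reaches the full degree `j + 1`. This
makes the recursion triangular. -/
theorem mulJet_const_congr_of_lt {r j : ℕ} (hr : 2 ≤ r) (Φ : E [×r]→L[ℝ] F) {b b' : ℕ → E}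
    (hb : b 0 = 0) (h : ∀ k < j + 1, b k = b' k) :
    mulJet Φ (fun _ => b) (j + 1) = mulJet Φ (fun _ => b') (j + 1) := by
  refine Finset.sum_congr rfl fun p hp => ?_
  rw [Finset.Nat.mem_antidiagonalTuple] at hp
  by_cases hp0 : ∃ i, p i = 0
  · obtain ⟨i, hi⟩ := hp0
    rw [Φ.map_coord_zero i ((congrArg b hi).trans hb),
      Φ.map_coord_zero i ((congrArg b' hi).trans ((h 0 j.succ_pos).symm.trans hb))]
  · push Not at hp0
    congr 1
    ext1 i
    refine h _ ?_
    have : Nontrivial (Fin r) := Fin.nontrivial_iff_two_le.2 hr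
    obtain ⟨i', hi'⟩ := exists_ne i
    have h1 : ∑ k ∈ {i, i'}, p k ≤ ∑ k, p k :=
      Finset.sum_le_sum_of_subset (Finset.subset_univ _)
    rw [Finset.sum_pair hi'.symm, hp] at h1
    have := hp0 i'
    omega

/-- The jet `b` with `b 0 = 0` and `∑ (1 / r!) Θ^r[b(s)^r] = ∑ s ^ j • x j`, where `R` is the
inverse of `Θ^1`. -/
def solveJet (R : E →L[ℝ] E) (Θ : (k : ℕ) → E [×k]→L[ℝ] E) (x : ℕ → E) : ℕ → E
  | 0 => 0
  | j + 1 => R (x (j + 1) - ∑ r ∈ Finset.Icc 2 (j + 1), (r.factorial : ℝ)⁻¹ •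
      mulJet (Θ r) (fun _ k => if _h : k < j + 1 then solveJet R Θ x k else 0) (j + 1))

theorem solveJet_zero (R : E →L[ℝ] E) (Θ : (k : ℕ) → E [×k]→L[ℝ] E) (x : ℕ → E) :
    solveJet R Θ x 0 = 0 := by
  rw [solveJet]

/-- The guard in the definition serves only termination: the nonlinear terms never read coefficients
beyond `j`. -/
theorem solveJet_succ (R : E →L[ℝ] E) (Θ : (k : ℕ) → E [×k]→L[ℝ] E) (x : ℕ → E) (j : ℕ) :
    solveJet R Θ x (j + 1) = R (x (j + 1) - ∑ r ∈ Finset.Icc 2 (j + 1), (r.factorial : ℝ)⁻¹ •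
      mulJet (Θ r) (fun _ => solveJet R Θ x) (j + 1)) := by
  rw [solveJet]
  congr 2
  refine Finset.sum_congr rfl fun r hr => congrArg _ ?_
  refine mulJet_const_congr_of_lt (Finset.mem_Icc.1 hr).1 _ ?_ fun k hk => dif_pos hk
  rw [dif_pos (Nat.succ_pos j), solveJet_zero]

theorem solveJet_congr (R : E →L[ℝ] E) (Θ : (k : ℕ) → E [×k]→L[ℝ] E) {x x' : ℕ → E} {j : ℕ}
    (h : ∀ k ≤ j, x k = x' k) : solveJet R Θ x j = solveJet R Θ x' j := by
  induction j using Nat.strong_induction_on with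
  | _ j ih =>
    rcases j with _ | j
    · rw [solveJet_zero, solveJet_zero]
    · rw [solveJet_succ, solveJet_succ, h _ le_rfl]
      congr 2
      refine Finset.sum_congr rfl fun r hr => congrArg _ ?_
      exact mulJet_const_congr_of_lt (Finset.mem_Icc.1 hr).1 _ (solveJet_zero ..) fun k hk =>
        ih k hk fun i hi => h i (hi.trans hk.le)

theorem solveJet_smul_pow (R : E →L[ℝ] E) (Θ : (k : ℕ) → E [×k]→L[ℝ] E) (x : ℕ → E) (c : ℝ)
    (j : ℕ) : solveJet R Θ (fun k => c ^ k • x k) j = c ^ j • solveJet R Θ x j := by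
  induction j using Nat.strong_induction_on with
  | _ j ih =>
    rcases j with _ | j
    · rw [solveJet_zero, solveJet_zero, smul_zero]
    · rw [solveJet_succ, solveJet_succ, ← map_smul, smul_sub, Finset.smul_sum]
      congr 2
      refine Finset.sum_congr rfl fun r hr => ?_
      rw [smul_comm, ← mulJet_smul_pow]
      exact congrArg _ (mulJet_const_congr_of_lt (Finset.mem_Icc.1 hr).1 _ (solveJet_zero ..) ih)

theorem solveJet_eq {R : E →L[ℝ] E} {Θ : (k : ℕ) → E [×k]→L[ℝ] E} {x b : ℕ → E} {N : ℕ}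
    (hR : ∀ y : E, R (Θ 1 fun _ => y) = y) (hb : b 0 = 0)
    (hx : ∀ j ≤ N, 1 ≤ j → x j = ∑ r ∈ Finset.range (j + 1),
      (r.factorial : ℝ)⁻¹ • mulJet (Θ r) (fun _ => b) j) :
    ∀ j ≤ N, solveJet R Θ x j = b j := by
  intro j
  induction j using Nat.strong_induction_on with
  | _ j ih =>
    intro hj
    rcases j with _ | j
    · rw [solveJet_zero, hb]
    · rw [solveJet_succ, hx _ hj (Nat.succ_pos j), Finset.range_eq_Ico,
        Finset.sum_eq_sum_Ico_succ_bot (by omega), Finset.sum_eq_sum_Ico_succ_bot (by omega),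
        mulJet_zero_succ, smul_zero, zero_add, mulJet_one, Nat.factorial_one, Nat.cast_one,
        inv_one, one_smul, Finset.sum_congr rfl fun r hr => congrArg _
          (mulJet_const_congr_of_lt (Finset.mem_Icc.1 hr).1 (Θ r) (solveJet_zero R Θ x)
            fun k hk => ih k hk (hk.le.trans hj))]
      refine (congrArg R ?_).trans (hR _)
      exact add_sub_cancel_right _ _

theorem continuous_mulJet [TopologicalSpace P] {r : ℕ} {Φ : P → E [×r]→L[ℝ] F}
    {c : P → Fin r → ℕ → E} (hΦ : Continuous Φ) (hc : ∀ i k, Continuous fun p => c p i k) (j : ℕ) :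
    Continuous fun p => mulJet (Φ p) (c p) j :=
  continuous_finsetSum _ fun _ _ => continuous_eval.comp
    (hΦ.prodMk (continuous_pi fun i => hc i _))

theorem contDiff_mulJet {G : Type*} [NormedAddCommGroup G] [NormedSpace ℝ G] {r : ℕ}
    (Φ : E [×r]→L[ℝ] F) {c : G → Fin r → ℕ → E} (hc : ∀ i k, ContDiff ℝ ∞ fun p => c p i k)
    (j : ℕ) : ContDiff ℝ ∞ fun p => mulJet Φ (c p) j :=
  ContDiff.sum fun _ _ => Φ.contDiff.comp (contDiff_pi.2 fun i => hc i _)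

theorem continuous_slotJet [TopologicalSpace P] {Φ : P → (k : ℕ) → E [×k]→L[ℝ] F}
    {c b : P → ℕ → E} (hΦ : ∀ k, 1 ≤ k → Continuous fun p => Φ p k)
    (hc : ∀ k, Continuous fun p => c p k) (hb : ∀ k, Continuous fun p => b p k) (j : ℕ) :
    Continuous fun p => slotJet (Φ p) (c p) (b p) j :=
  continuous_finsetSum _ fun r _ => (continuous_mulJet (hΦ (r + 1) (by omega))
    (Fin.cases hc fun _ => hb) j).const_smul _

theorem contDiff_slotJet {G : Type*} [NormedAddCommGroup G] [NormedSpace ℝ G]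
    (Φ : (k : ℕ) → E [×k]→L[ℝ] F) {c b : G → ℕ → E} (hc : ∀ k, ContDiff ℝ ∞ fun p => c p k)
    (hb : ∀ k, ContDiff ℝ ∞ fun p => b p k) (j : ℕ) :
    ContDiff ℝ ∞ fun p => slotJet Φ (c p) (b p) j :=
  ContDiff.sum fun r _ => (contDiff_mulJet (Φ (r + 1)) (c := fun p => Fin.cons (c p) fun _ => b p)
    (Fin.cases hc fun _ => hb) j).const_smul _

theorem continuous_compJet [TopologicalSpace P] {f : E → F} (hf : ContDiff ℝ ∞ f) {x : P → E}
    {b : P → ℕ → E} (hx : Continuous x) (hb : ∀ k, Continuous fun p => b p k) (j : ℕ) :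
    Continuous fun p => compJet f (x p) (b p) j :=
  continuous_finsetSum _ fun σ _ => (continuous_mulJet
    ((hf.continuous_iteratedFDeriv (by exact_mod_cast le_top)).comp hx) (fun _ => hb) j).const_smul _

theorem contDiff_compJet {G : Type*} [NormedAddCommGroup G] [NormedSpace ℝ G] (f : E → F) (x : E)
    {b : G → ℕ → E} (hb : ∀ k, ContDiff ℝ ∞ fun p => b p k) (j : ℕ) :
    ContDiff ℝ ∞ fun p => compJet f x (b p) j :=
  ContDiff.sum fun σ _ => (contDiff_mulJet (iteratedFDeriv ℝ σ f x) (fun _ => hb) j).const_smul _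

theorem continuous_solveJet [TopologicalSpace P] {R : P → E →L[ℝ] E}
    {Θ : P → (k : ℕ) → E [×k]→L[ℝ] E} {x : P → ℕ → E} (hR : Continuous R)
    (hΘ : ∀ k, 1 ≤ k → Continuous fun p => Θ p k) (hx : ∀ k, Continuous fun p => x p k) (j : ℕ) :
    Continuous fun p => solveJet (R p) (Θ p) (x p) j := by
  induction j using Nat.strong_induction_on with
  | _ j ih =>
    rcases j with _ | j
    · simp only [solveJet_zero, continuous_const]
    · simp only [solveJet]
      refine hR.clm_apply ((hx _).sub (continuous_finsetSum _ fun r hr => Continuous.const_smul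
        (continuous_mulJet (hΘ r (one_le_two.trans (Finset.mem_Icc.1 hr).1)) (fun _ k => ?_) _) _))
      split_ifs with h
      exacts [ih k h, continuous_const]

theorem contDiff_solveJet {G : Type*} [NormedAddCommGroup G] [NormedSpace ℝ G] (R : E →L[ℝ] E)
    (Θ : (k : ℕ) → E [×k]→L[ℝ] E) {x : G → ℕ → E} (hx : ∀ k, ContDiff ℝ ∞ fun p => x p k) (j : ℕ) :
    ContDiff ℝ ∞ fun p => solveJet R Θ (x p) j := by
  induction j using Nat.strong_induction_on with
  | _ j ih =>
    rcases j with _ | j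
    · simp only [solveJet_zero, contDiff_const]
    · simp only [solveJet]
      refine R.contDiff.comp ((hx _).sub (ContDiff.sum fun r hr => ContDiff.const_smul _
        (contDiff_mulJet (Θ r) (fun _ k => ?_) _)))
      split_ifs with h
      exacts [ih k h, contDiff_const]

theorem compJet_congr (f : E → F) (x : E) {b b' : ℕ → E} {j : ℕ} (h : ∀ k ≤ j, b k = b' k) :
    compJet f x b j = compJet f x b' j :=
  Finset.sum_congr rfl fun _ _ => congrArg _ (mulJet_congr _ fun _ => h)

theorem compJet_smul_pow (f : E → F) (x : E) (b : ℕ → E) (c : ℝ) (j : ℕ) :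
    compJet f x (fun k => c ^ k • b k) j = c ^ j • compJet f x b j := by
  rw [compJet, compJet, Finset.smul_sum]
  exact Finset.sum_congr rfl fun σ _ => by rw [smul_comm, ← mulJet_smul_pow]

theorem slotJet_smul_pow (Φ : (k : ℕ) → E [×k]→L[ℝ] F) (d b : ℕ → E) (c : ℝ) (j : ℕ) :
    slotJet Φ (fun k => c ^ k • d k) (fun k => c ^ k • b k) j = c ^ j • slotJet Φ d b j := by
  rw [slotJet, slotJet, Finset.smul_sum]
  refine Finset.sum_congr rfl fun r _ => ?_
  rw [smul_comm, ← mulJet_smul_pow]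
  congr 2
  ext1 i
  cases i using Fin.cases <;> rfl

/-- The coefficients of `∑ (1 / r!) Θ^{r+1}[f(x₀ + b(s)), b(s), …, b(s)]`, where `b` is the jet with
`∑ (1 / r!) Θ^r[b(s)^r] = ∑ s ^ j • x j`. -/
def fieldJet (R : E →L[ℝ] E) (Θ : (k : ℕ) → E [×k]→L[ℝ] E) (f : E → E) (x₀ : E) (x : ℕ → E)
    (j : ℕ) : E :=
  slotJet Θ (compJet f x₀ (solveJet R Θ x)) (solveJet R Θ x) j

theorem fieldJet_congr (R : E →L[ℝ] E) (Θ : (k : ℕ) → E [×k]→L[ℝ] E) (f : E → E) (x₀ : E)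
    {x x' : ℕ → E} {j : ℕ} (h : ∀ k ≤ j, x k = x' k) :
    fieldJet R Θ f x₀ x j = fieldJet R Θ f x₀ x' j := by
  have h1 : ∀ k ≤ j, solveJet R Θ x k = solveJet R Θ x' k := fun k hk =>
    solveJet_congr R Θ fun i hi => h i (hi.trans hk)
  exact slotJet_congr Θ (fun k hk => compJet_congr f x₀ fun i hi => h1 i (hi.trans hk)) h1

theorem fieldJet_smul_pow (R : E →L[ℝ] E) (Θ : (k : ℕ) → E [×k]→L[ℝ] E) (f : E → E) (x₀ : E)
    (x : ℕ → E) (c : ℝ) (j : ℕ) :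
    fieldJet R Θ f x₀ (fun k => c ^ k • x k) j = c ^ j • fieldJet R Θ f x₀ x j := by
  have h1 : solveJet R Θ (fun k => c ^ k • x k) = fun k => c ^ k • solveJet R Θ x k :=
    funext (solveJet_smul_pow R Θ x c)
  have h2 : compJet f x₀ (fun k => c ^ k • solveJet R Θ x k) =
      fun k => c ^ k • compJet f x₀ (solveJet R Θ x) k := funext (compJet_smul_pow f x₀ _ c)
  rw [fieldJet, fieldJet, h1, h2, slotJet_smul_pow]

theorem continuous_fieldJet [TopologicalSpace P] {R : P → E →L[ℝ] E}
    {Θ : P → (k : ℕ) → E [×k]→L[ℝ] E} {f : E → E} {x₀ : P → E} {x : P → ℕ → E} (hR : Continuous R)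
    (hΘ : ∀ k, 1 ≤ k → Continuous fun p => Θ p k) (hf : ContDiff ℝ ∞ f) (hx₀ : Continuous x₀)
    (hx : ∀ k, Continuous fun p => x p k) (j : ℕ) :
    Continuous fun p => fieldJet (R p) (Θ p) f (x₀ p) (x p) j :=
  have h := continuous_solveJet hR hΘ hx
  continuous_slotJet hΘ (continuous_compJet hf hx₀ h) h j

theorem contDiff_fieldJet {G : Type*} [NormedAddCommGroup G] [NormedSpace ℝ G] (R : E →L[ℝ] E)
    (Θ : (k : ℕ) → E [×k]→L[ℝ] E) (f : E → E) (x₀ : E) {x : G → ℕ → E}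
    (hx : ∀ k, ContDiff ℝ ∞ fun p => x p k) (j : ℕ) :
    ContDiff ℝ ∞ fun p => fieldJet R Θ f x₀ (x p) j :=
  have h := contDiff_solveJet R Θ hx
  contDiff_slotJet Θ (contDiff_compJet f x₀ h) h j

end SolveJet

/-! ### Vector-valued forms and truncated jets -/

section FormMap

variable {n k : ℕ}

/-- The vector-valued form whose coordinates are the forms `φ a`. -/
def formMap (φ : Fin n → (Vec n) [×k]→L[ℝ] ℝ) : (Vec n) [×k]→L[ℝ] Vec n :=
  ∑ a, (ContinuousLinearMap.toSpanSingleton ℝ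
    (EuclideanSpace.single a (1 : ℝ))).compContinuousMultilinearMap (φ a)

theorem formMap_apply (φ : Fin n → (Vec n) [×k]→L[ℝ] ℝ) (w : Fin k → Vec n) (a : Fin n) :
    formMap φ w a = φ a w := by
  simp [formMap, Pi.single_apply]

theorem proj_comp_formMap (φ : Fin n → (Vec n) [×k]→L[ℝ] ℝ) (a : Fin n) :
    (EuclideanSpace.proj a : Vec n →L[ℝ] ℝ).compContinuousMultilinearMap (formMap φ) = φ a := by
  ext w
  exact formMap_apply φ w a

theorem continuous_formMap {P : Type*} [TopologicalSpace P]
    {φ : P → Fin n → (Vec n) [×k]→L[ℝ] ℝ} (hφ : ∀ a, Continuous fun p => φ p a) :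
    Continuous fun p => formMap (φ p) :=
  continuous_finsetSum _ fun a _ => (ContinuousLinearMap.compContinuousMultilinearMapL ℝ
    (fun _ : Fin k => Vec n) ℝ (Vec n) (ContinuousLinearMap.toSpanSingleton ℝ
      (EuclideanSpace.single a (1 : ℝ)))).continuous.comp (hφ a)

/-- A vector orthogonal to the range is a linear relation among the covectors, so the map is onto,
hence bijective. -/
theorem isUnit_formMap {φ : Fin n → (Vec n) [×1]→L[ℝ] ℝ} (hφ : LinearIndependent ℝ φ) :
    IsUnit (continuousMultilinearCurryFin1 ℝ (Vec n) (Vec n) (formMap φ)) := by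
  set L := continuousMultilinearCurryFin1 ℝ (Vec n) (Vec n) (formMap φ) with hL
  have hLa : ∀ y a, L y a = φ a (fun _ => y) := fun y a => by
    rw [hL, continuousMultilinearCurryFin1_apply, formMap_apply]
    congr 1
  have hsurj : Function.Surjective L := by
    refine LinearMap.range_eq_top (f := (L : Vec n →ₗ[ℝ] Vec n)).1 ?_
    rw [← Submodule.orthogonal_eq_bot_iff,
      Submodule.eq_bot_iff]
    intro v hv
    have h1 : ∀ y, ∑ a, v a * φ a (fun _ => y) = 0 := fun y => by
      have := hv (L y) (LinearMap.mem_range_self (L : Vec n →ₗ[ℝ] Vec n) y)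
      simpa [PiLp.inner_apply, hLa] using this
    ext a
    refine (Fintype.linearIndependent_iff.1 hφ) v ?_ a
    ext w
    have hw : w = fun _ => w 0 := funext fun i => by rw [Subsingleton.elim i 0]
    rw [hw]
    simpa using h1 (w 0)
  exact ContinuousLinearMap.isUnit_iff_bijective.2
    ⟨(LinearMap.injective_iff_surjective (f := (L : Vec n →ₗ[ℝ] Vec n))).2 hsurj, hsurj⟩

theorem continuous_ringInverse_formMap {P : Type*} [TopologicalSpace P]
    {φ : P → Fin n → (Vec n) [×1]→L[ℝ] ℝ} (hφ : ∀ a, Continuous fun p => φ p a)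
    (hli : ∀ p, LinearIndependent ℝ (φ p)) : Continuous fun p =>
      Ring.inverse (continuousMultilinearCurryFin1 ℝ (Vec n) (Vec n) (formMap (φ p))) := by
  have h1 : Continuous fun p => continuousMultilinearCurryFin1 ℝ (Vec n) (Vec n) (formMap (φ p)) :=
    (continuousMultilinearCurryFin1 ℝ (Vec n) (Vec n)).continuous.comp (continuous_formMap hφ)
  refine continuous_iff_continuousAt.2 fun p => ?_
  obtain ⟨U, hU⟩ := isUnit_formMap (hli p)
  exact ContinuousAt.comp (g := Ring.inverse) (hU ▸ NormedRing.inverse_continuousAt U)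
    h1.continuousAt

theorem ringInverse_formMap_apply {φ : Fin n → (Vec n) [×1]→L[ℝ] ℝ} (hφ : LinearIndependent ℝ φ)
    (y : Vec n) : Ring.inverse (continuousMultilinearCurryFin1 ℝ (Vec n) (Vec n) (formMap φ))
      (formMap φ fun _ => y) = y := by
  have h1 : (formMap φ fun _ => y) =
      continuousMultilinearCurryFin1 ℝ (Vec n) (Vec n) (formMap φ) y := by
    rw [continuousMultilinearCurryFin1_apply]
    congr 1
  rw [h1]
  exact congrArg (fun A : Vec n →L[ℝ] Vec n => A y) (Ring.inverse_mul_cancel _ (isUnit_formMap hφ))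

/-- The jet `0, x 0, …, x (k - 1), 0, 0, …`. -/
def extendJet {E : Type*} [Zero E] {k : ℕ} (x : Fin k → E) : ℕ → E
  | 0 => 0
  | j + 1 => if h : j < k then x ⟨j, h⟩ else 0

theorem extendJet_truncate (p : ℝ × (Fin (k + 1) → Vec n)) {j : ℕ} (hj : j ≤ k) :
    extendJet (truncate p).2 j = extendJet p.2 j := by
  rcases j with _ | j
  · rfl
  · rw [extendJet, extendJet, dif_pos (show j < k by omega), dif_pos (show j < k + 1 by omega)]
    rfl

theorem extendJet_dilation (c : ℝ) (p : ℝ × (Fin k → Vec n)) :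
    extendJet (dilation c p).2 = fun j => c ^ j • extendJet p.2 j := by
  ext1 j
  rcases j with _ | j
  · simp [extendJet]
  · simp only [extendJet]
    split_ifs
    · rfl
    · rw [smul_zero]

theorem contDiff_extendJet {E : Type*} [NormedAddCommGroup E] [NormedSpace ℝ E] (j : ℕ) :
    ContDiff ℝ ∞ fun x : Fin k → E => extendJet x j := by
  rcases j with _ | j
  · exact contDiff_const
  · simp only [extendJet]
    split_ifs
    exacts [contDiff_apply ℝ E _, contDiff_const]

end FormMap

/-! ### Derivatives of the adapted coordinates -/

section Curve

variable {n l : ℕ} {M : Type*} [TopologicalSpace M] [ChartedSpace (EuclideanSpace ℝ (Fin n)) M]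
  {e : OpenPartialHomeomorph M (EuclideanSpace ℝ (Fin n))}
  {X : Fin l → (x : M) → TangentSpace (𝓡 n) x} {T : ℝ} {q₀ : M} {u Δu : ℝ → Fin l → ℝ} {q : ℝ → M}
  {Φ : (k : ℕ) → Fin n → ℝ → (Vec n) [×k]→L[ℝ] ℝ} {g : Fin l → Vec n → Vec n}

theorem adaptedCoord_eq_sum_mulJet (hΦ : IsAdaptedForms e X T u q Φ) {t : ℝ} (ht : t ∈ Icc 0 T)
    (m : ℕ) (a : Fin n) : adaptedCoord e X T q₀ u Φ Δu m a t =
      ∑ r ∈ Finset.range (m + 1), (r.factorial : ℝ)⁻¹ *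
        mulJet (Φ r a t) (fun _ => variationJet e X T q₀ u Δu t) m :=
  jetCoord_eq_sum_mulJet (b := variationJet e X T q₀ u Δu t)
    (fun k hk σ w => hΦ.symm k hk a t ht σ w) rfl m

theorem absCont_adaptedCoord (hΦ : IsAdaptedForms e X T u q Φ) (hT : 0 ≤ T)
    (hb : ∀ j, AbsolutelyContinuousOnInterval (fun t => variationJet e X T q₀ u Δu t j) 0 T)
    (m : ℕ) (a : Fin n) :
    AbsolutelyContinuousOnInterval (adaptedCoord e X T q₀ u Φ Δu (m + 1) a) 0 T := by
  -- The sum starts at `Φ 1`, since no regularity of `Φ 0` is assumed.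
  refine absCont_congr (f := fun t => ∑ r ∈ Finset.range (m + 1), ((r + 1).factorial : ℝ)⁻¹ *
    mulJet (Φ (r + 1) a t) (fun _ => variationJet e X T q₀ u Δu t) (m + 1)) ?_ fun t ht => ?_
  · exact absCont_sum _ fun r _ => (absCont_sum _ fun p _ => absCont_multilinear_apply
      (hΦ.absCont _ (by omega) a) fun i => hb _).const_mul _
  · simp only []
    rw [adaptedCoord_eq_sum_mulJet hΦ (uIcc_of_le hT ▸ ht), Finset.sum_range_succ' _ (m + 1),
      mulJet_zero_succ, mul_zero, add_zero]

theorem ae_hasDerivAt_adaptedCoord (hΦ : IsAdaptedForms e X T u q Φ) (hT : 0 ≤ T)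
    (hgX : ∀ᶠ x in 𝓝ˢ ((fun t => e (q t)) '' Icc 0 T), ∀ i, g i x = inChart e (X i) x)
    (hb : ∀ j, ∀ᵐ t, t ∈ Icc 0 T → HasDerivAt (fun t => variationJet e X T q₀ u Δu t (j + 1))
      (∑ i, (u t i • compJet (g i) (e (q t)) (variationJet e X T q₀ u Δu t) (j + 1) +
        Δu t i • compJet (g i) (e (q t)) (variationJet e X T q₀ u Δu t) j)) t) :
    ∀ᵐ t, t ∈ Icc 0 T → ∀ m a, HasDerivAt (adaptedCoord e X T q₀ u Φ Δu (m + 1) a)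
      (∑ i, Δu t i * slotJet (fun k => Φ k a t)
        (compJet (g i) (e (q t)) (variationJet e X T q₀ u Δu t))
        (variationJet e X T q₀ u Δu t) m) t := by
  have h0 : ∀ᵐ t : ℝ, t ≠ 0 := by simp [ae_iff, measure_singleton]
  have h1 : ∀ᵐ t : ℝ, t ≠ T := by simp [ae_iff, measure_singleton]
  filter_upwards [hΦ.ae_hasDerivAt hT hgX, ae_all_iff.2 hb, h0, h1] with t ht hbt h0 h1 htT m a
  obtain ⟨Φ', hΦ'⟩ := ht htT a
  have h2 := hasDerivAt_sum_mulJet (Φ := fun τ k => Φ k a τ)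
    (b := variationJet e X T q₀ u Δu) (w := Δu t)
    (fun k hk σ w => hΦ.symm k hk a t htT σ w) (fun k hk => (hΦ' k hk).1)
    (fun k hk => (hΦ' k hk).2) (fun _ => rfl) (fun k => hbt k htT) m
  refine h2.congr_of_eventuallyEq ?_
  filter_upwards [Icc_mem_nhds (lt_of_le_of_ne htT.1 h0.symm) (lt_of_le_of_ne htT.2 h1)]
    with s hs using adaptedCoord_eq_sum_mulJet hΦ hs (m + 1) a

end Curve

/-! ### The control vector fields in adapted coordinates -/

section Fields

variable {n l : ℕ}

/-- The control vector fields of the adapted coordinates, as functions of the inverses `R` of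
the first forms, the forms `Θ`, the vector fields `f` and the base curve `γ`. -/
def adaptedField (R : ℝ → Vec n →L[ℝ] Vec n) (Θ : ℝ → (j : ℕ) → (Vec n) [×j]→L[ℝ] Vec n)
    (f : Fin l → Vec n → Vec n) (γ : ℝ → Vec n) (k : ℕ) (i : Fin l)
    (p : ℝ × (Fin k → Vec n)) : ℝ × (Fin k → Vec n) :=
  (0, fun s => fieldJet (R p.1) (Θ p.1) (f i) (γ p.1) (extendJet p.2) s)

variable {R : ℝ → Vec n →L[ℝ] Vec n} {Θ : ℝ → (j : ℕ) → (Vec n) [×j]→L[ℝ] Vec n}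
  {f : Fin l → Vec n → Vec n} {γ : ℝ → Vec n}

theorem continuous_adaptedField (hR : Continuous R) (hΘ : ∀ j, 1 ≤ j → Continuous fun t => Θ t j)
    (hf : ∀ i, ContDiff ℝ ∞ (f i)) (hγ : Continuous γ) (k : ℕ) (i : Fin l) :
    Continuous (adaptedField R Θ f γ k i) :=
  continuous_const.prodMk (continuous_pi fun s => continuous_fieldJet (hR.comp continuous_fst)
    (fun j hj => (hΘ j hj).comp continuous_fst) (hf i) (hγ.comp continuous_fst)
    (fun j => (contDiff_extendJet j).continuous.comp continuous_snd) s)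

theorem contDiff_adaptedField (k : ℕ) (i : Fin l) (t : ℝ) :
    ContDiff ℝ ∞ fun x => adaptedField R Θ f γ k i (t, x) :=
  contDiff_const.prodMk (contDiff_pi.2 fun s =>
    contDiff_fieldJet (R t) (Θ t) (f i) (γ t) contDiff_extendJet s)

/-- The component of index `s` belongs to a coordinate of degree `s + 1` but is a coefficient of
order `s`; hence degree `-1`. -/
theorem isHomogeneousField_adaptedField (k : ℕ) (i : Fin l) :
    IsHomogeneousField (-1) (adaptedField R Θ f γ k i) := by
  intro c hc p
  refine Prod.ext (smul_zero _).symm (funext fun s => ?_)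
  change fieldJet _ _ _ _ (extendJet (dilation c p).2) s =
    c ^ (-1 : ℤ) • c ^ ((s : ℕ) + 1) • fieldJet _ _ _ _ (extendJet p.2) s
  rw [extendJet_dilation, fieldJet_smul_pow, smul_smul, zpow_neg_one, pow_succ',
    inv_mul_cancel_left₀ hc]
  rfl

/-- A coefficient of order `s` reads only coordinates of degree at most `s`. -/
theorem truncate_adaptedField (k : ℕ) (i : Fin l) (p : ℝ × (Fin (k + 1) → Vec n)) :
    truncate (adaptedField R Θ f γ (k + 1) i p) = adaptedField R Θ f γ k i (truncate p) := by
  refine Prod.ext rfl (funext fun s => fieldJet_congr _ _ _ _ fun j hj => ?_)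
  exact (extendJet_truncate p (hj.trans s.2.le)).symm

end Fields

/-! ### The equation of the adapted curve -/

theorem absCont_toLp {n : ℕ} {f : Fin n → ℝ → ℝ} {a b : ℝ}
    (hf : ∀ i, AbsolutelyContinuousOnInterval (f i) a b) :
    AbsolutelyContinuousOnInterval (fun t => (WithLp.toLp 2 fun i => f i t : Vec n)) a b :=
  absCont_congr (absCont_sum Finset.univ fun i _ => absCont_clm_comp (hf i)
    (ContinuousLinearMap.toSpanSingleton ℝ (EuclideanSpace.single i (1 : ℝ)))) fun t _ => by
      ext j
      simp [Pi.single_apply]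

theorem hasDerivAt_toLp {n : ℕ} {f : Fin n → ℝ → ℝ} {f' : Fin n → ℝ} {t : ℝ}
    (hf : ∀ i, HasDerivAt (f i) (f' i) t) :
    HasDerivAt (fun t => (WithLp.toLp 2 fun i => f i t : Vec n)) (WithLp.toLp 2 f') t :=
  ((EuclideanSpace.equiv (Fin n) ℝ).symm.toContinuousLinearMap.hasFDerivAt
    (x := fun i => f i t)).comp_hasDerivAt t (hasDerivAt_pi.2 hf)

/-- On the curve, `solveJet` recovers the variation jet from the adapted coordinates up to order
`k`, so the field evaluates to the slot coefficients found by differentiating those coordinates. -/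
theorem isAffineTrajectory_adaptedCurve {n l : ℕ} {M : Type*} [TopologicalSpace M]
    [ChartedSpace (EuclideanSpace ℝ (Fin n)) M]
    {e : OpenPartialHomeomorph M (EuclideanSpace ℝ (Fin n))}
    {X : Fin l → (x : M) → TangentSpace (𝓡 n) x} {T : ℝ} {q₀ : M} {u Δu : ℝ → Fin l → ℝ} {q : ℝ → M}
    {Φ : (k : ℕ) → Fin n → ℝ → (Vec n) [×k]→L[ℝ] ℝ} {g : Fin l → Vec n → Vec n}
    {R : ℝ → Vec n →L[ℝ] Vec n} {Θ : ℝ → (j : ℕ) → (Vec n) [×j]→L[ℝ] Vec n} {γ : ℝ → Vec n}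
    (hΦ : IsAdaptedForms e X T u q Φ) (hT : 0 ≤ T)
    (hgX : ∀ᶠ x in 𝓝ˢ ((fun t => e (q t)) '' Icc 0 T), ∀ i, g i x = inChart e (X i) x)
    (hγ : ∀ t ∈ Icc 0 T, γ t = e (q t)) (hΘ : ∀ t ∈ Icc 0 T, ∀ j, Θ t j = formMap fun a => Φ j a t)
    (hR : ∀ t ∈ Icc 0 T, ∀ y, R t (Θ t 1 fun _ => y) = y)
    (hb0 : ∀ j, variationJet e X T q₀ u Δu 0 j = 0)
    (hb : ∀ j, AbsolutelyContinuousOnInterval (fun t => variationJet e X T q₀ u Δu t j) 0 T ∧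
      ∀ᵐ t, t ∈ Icc 0 T → HasDerivAt (fun t => variationJet e X T q₀ u Δu t (j + 1))
        (∑ i, (u t i • compJet (g i) (e (q t)) (variationJet e X T q₀ u Δu t) (j + 1) +
          Δu t i • compJet (g i) (e (q t)) (variationJet e X T q₀ u Δu t) j)) t) (k : ℕ) :
    IsAffineTrajectory (adaptedField R Θ g γ k) T Δu (adaptedCurve e X T q₀ u Φ Δu k) := by
  have hcoord : ∀ t ∈ Icc 0 T, ∀ m, (WithLp.toLp 2 fun a => adaptedCoord e X T q₀ u Φ Δu m a t) =
      ∑ r ∈ Finset.range (m + 1), (r.factorial : ℝ)⁻¹ •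
        mulJet (Θ t r) (fun _ => variationJet e X T q₀ u Δu t) m := fun t ht m => by
    ext a
    have h1 : ∀ v : Vec n, v a = (EuclideanSpace.proj a : Vec n →L[ℝ] ℝ) v := fun _ => rfl
    rw [h1 (∑ r ∈ _, _), map_sum]
    simp only [map_smul, hΘ t ht, ← mulJet_clm_comp, proj_comp_formMap, smul_eq_mul]
    exact adaptedCoord_eq_sum_mulJet hΦ ht m a
  have hsolve : ∀ t ∈ Icc 0 T, ∀ j ≤ k, solveJet (R t) (Θ t)
      (extendJet (adaptedCurve e X T q₀ u Φ Δu k t).2) j = variationJet e X T q₀ u Δu t j :=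
    fun t ht => solveJet_eq (hR t ht) rfl fun j hj hj1 => by
    obtain ⟨j, rfl⟩ := Nat.exists_eq_add_of_le' hj1
    rw [← hcoord t ht, extendJet, dif_pos (Nat.lt_of_succ_le hj)]
    rfl
  refine ⟨?_, ?_, (ae_restrict_iff' measurableSet_Icc).2 ?_⟩
  · refine Prod.ext rfl (funext fun s => (hcoord 0 (left_mem_Icc.2 hT) _).trans ?_)
    have h0 : variationJet e X T q₀ u Δu 0 = 0 := funext hb0
    refine Finset.sum_eq_zero fun r _ => ?_
    rcases r with _ | r
    · rw [mulJet_zero_succ, smul_zero]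
    · rw [h0, mulJet, Finset.sum_eq_zero fun p _ => (Θ 0 (r + 1)).map_coord_zero 0 rfl, smul_zero]
  · refine absCont_prodMk ?_ (absCont_pi fun s => ?_)
    · exact (LipschitzWith.id.lipschitzOnWith).absolutelyContinuousOnInterval
    · exact absCont_toLp fun a => absCont_adaptedCoord hΦ hT (fun j => (hb j).1) s a
  · filter_upwards [ae_hasDerivAt_adaptedCoord hΦ hT hgX fun j => (hb j).2] with t ht htT
    have h1 : ∀ s : Fin k, HasDerivAt
        (fun τ => WithLp.toLp 2 fun a => adaptedCoord e X T q₀ u Φ Δu ((s : ℕ) + 1) a τ)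
        (∑ i, Δu t i • fieldJet (R t) (Θ t) (g i) (γ t)
          (extendJet (adaptedCurve e X T q₀ u Φ Δu k t).2) s) t := fun s => by
      refine (hasDerivAt_toLp fun a => ht htT s a).congr_deriv ?_
      ext a
      simp only [WithLp.ofLp_sum, Finset.sum_apply, PiLp.smul_apply, smul_eq_mul]
      refine Finset.sum_congr rfl fun i _ => ?_
      have h4 : ∀ j ≤ (s : ℕ), solveJet (R t) (Θ t)
          (extendJet (adaptedCurve e X T q₀ u Φ Δu k t).2) j = variationJet e X T q₀ u Δu t j :=
        fun j hj => hsolve t htT j (hj.trans s.2.le)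
      rw [fieldJet, hγ t htT,
        slotJet_congr (Θ t) (fun j hj => compJet_congr _ _ fun i hi => h4 i (hi.trans hj)) h4]
      have h5 := slotJet_clm_comp (EuclideanSpace.proj a : Vec n →L[ℝ] ℝ) (Θ t)
        (compJet (g i) (e (q t)) (variationJet e X T q₀ u Δu t)) (variationJet e X T q₀ u Δu t) s
      simp only [hΘ t htT, proj_comp_formMap] at h5
      exact congrArg _ h5
    refine ((hasDerivAt_id t).prodMk (hasDerivAt_pi.2 h1)).congr_deriv (Prod.ext ?_ ?_)
    · simp [adaptedField, Prod.fst_sum]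
    · ext1 s
      simp [adaptedField, Prod.snd_sum, adaptedCurve]

end AdaptedCoords

end

/-! ### Assembly of the theorem -/

open AdaptedCoords in
theorem theorem2 {n l : ℕ} {M : Type*} [TopologicalSpace M] [T2Space M]
    [ChartedSpace (EuclideanSpace ℝ (Fin n)) M] [IsManifold (𝓡 n) ∞ M]
    -- the control system: smooth vector fields `X_1, …, X_l`
    (X : Fin l → (x : M) → TangentSpace (𝓡 n) x)
    (hX : ∀ i, ContMDiff (𝓡 n) (𝓡 n).tangent ∞
      (fun x => (⟨x, X i x⟩ : TangentBundle (𝓡 n) M)))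
    -- a control `u` and its trajectory `q`
    (T : ℝ) (hT : 0 < T) (q₀ : M)
    (u : ℝ → Fin l → ℝ) (hu : IntegrableOn u (Icc 0 T))
    (q : ℝ → M) (hq : IsTrajectory X T q₀ u q)
    -- local coordinates of `M` along the trajectory
    (e : OpenPartialHomeomorph M (EuclideanSpace ℝ (Fin n)))
    (he : e ∈ IsManifold.maximalAtlas (𝓡 n) ∞ M) (hqe : MapsTo q (Icc 0 T) e.source)
    -- the multilinear forms that define the adapted coordinates
    (Φ : (k : ℕ) → Fin n → ℝ → (Vec n) [×k]→L[ℝ] ℝ)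
    (hΦ : IsAdaptedForms e X T u q Φ) :
    ∃ Y : (k : ℕ) → Fin l → ℝ × (Fin k → Vec n) → ℝ × (Fin k → Vec n),
      -- the `Y k i` are vector fields, continuous, and smooth in the coordinates `q^(s)`
      (∀ k i, Continuous (Y k i) ∧ ∀ t, ContDiff ℝ ∞ (fun x => Y k i (t, x))) ∧
      (∀ k i, IsHomogeneousField (-1) (Y k i)) ∧
      (∀ Δu : ℝ → Fin l → ℝ, IntegrableOn Δu (Icc 0 T) →
        -- the Taylor coefficients of `s ↦ End^t(u + s Δu)` at `0` are well defined
        (∀ᶠ s in 𝓝 (0 : ℝ), ∃ qs : ℝ → M,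
          IsTrajectory X T q₀ (u + s • Δu) qs ∧ MapsTo qs (Icc 0 T) e.source) ∧
        (∀ t ∈ Icc 0 T, ContDiffAt ℝ ∞ (variation e X T q₀ u Δu t) 0) ∧
        -- and the adapted coordinates are a trajectory of the affine control system
        ∀ k, IsAffineTrajectory (Y k) T Δu (adaptedCurve e X T q₀ u Φ Δu k)) ∧
      (∀ k i p, truncate (Y (k + 1) i p) = Y k i (truncate p)) := by
  have huI : uIcc 0 T = Icc 0 T := uIcc_of_le hT.le
  have hcontrol : ∀ {v : ℝ → Fin l → ℝ}, IntegrableOn v (Icc 0 T) →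
      ∀ i, IntervalIntegrable (fun t => v t i) volume 0 T := fun hv i =>
    (intervalIntegrable_iff_integrableOn_Icc_of_le hT.le).2 (hv.eval i)
  have hqc : ContinuousOn (fun t => e (q t)) (Icc 0 T) :=
    huI ▸ (hq.absCont e he 0 T le_rfl hT.le le_rfl hqe).continuousOn
  have hK : IsClosed ((fun t => e (q t)) '' Icc 0 T) :=
    (isCompact_Icc.image_of_continuousOn hqc).isClosed
  choose g hg hgX using fun i => exists_contDiff_eq_nhdsSet e.open_target hK
    (image_subset_iff.2 fun t ht => e.map_source (hqe ht)) (contDiffOn_inChart he (hX i))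
  have hgX' : ∀ᶠ x in 𝓝ˢ ((fun t => e (q t)) '' Icc 0 T), ∀ i, g i x = inChart e (X i) x :=
    eventually_all.2 hgX
  -- The data live on `[0, T]` but the fields need all times; clamping time extends them with
  -- continuity and invertibility intact.
  set π : ℝ → ℝ := fun t => projIcc 0 T hT.le t with hπ
  have hπT : ∀ t, π t ∈ Icc 0 T := fun t => (projIcc 0 T hT.le t).2
  have hπ_of_mem : ∀ t ∈ Icc 0 T, π t = t := fun t ht =>
    congrArg Subtype.val (projIcc_of_mem hT.le ht)
  have hcont : ∀ {Z : Type} [TopologicalSpace Z] {h : ℝ → Z}, ContinuousOn h (Icc 0 T) →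
      Continuous fun t => h (π t) := fun hh =>
    hh.comp_continuous (continuous_subtype_val.comp continuous_projIcc) hπT
  have hΦc : ∀ j, 1 ≤ j → ∀ a, Continuous fun t => Φ j a (π t) := fun j hj a =>
    hcont (huI ▸ (hΦ.absCont j hj a).continuousOn)
  have hli : ∀ t ∈ Icc 0 T, LinearIndependent ℝ fun a => Φ 1 a t := fun t ht =>
    hΦ.linearIndependent (hcontrol hu) hqc hg hgX' ht
  set Θ : ℝ → (j : ℕ) → (Vec n) [×j]→L[ℝ] Vec n := fun t j => formMap fun a => Φ j a (π t) with hΘ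
  set R : ℝ → Vec n →L[ℝ] Vec n :=
    fun t => Ring.inverse (continuousMultilinearCurryFin1 ℝ (Vec n) (Vec n) (Θ t 1)) with hR
  refine ⟨adaptedField R Θ g fun t => e (q (π t)), fun k i => ⟨?_, contDiff_adaptedField k i⟩,
    isHomogeneousField_adaptedField, fun Δu hΔu => ?_, truncate_adaptedField⟩
  · exact continuous_adaptedField
      (continuous_ringInverse_formMap (hΦc 1 le_rfl) fun t => hli _ (hπT t))
      (fun j hj => continuous_formMap (hΦc j hj)) hg (hcont hqc) k i
  · obtain ⟨hsm, hb0, hb⟩ := contDiffAt_variation_and_variationJet he hX hT.le (hcontrol hu) hq hqe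
      hg hgX' (hcontrol hΔu)
    refine ⟨(variation_family he hX hT.le (hcontrol hu) hq hqe hg hgX' (hcontrol hΔu)).1, hsm,
      isAffineTrajectory_adaptedCurve hΦ hT.le hgX' (fun t ht => by rw [hπ_of_mem t ht])
        (fun t ht j => by simp only [hΘ, hπ_of_mem t ht]) (fun t ht y => ?_) hb0 hb⟩
    exact ringInverse_formMap_apply (hli _ (hπT t)) y
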